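/- Let $\Omega\subset\mathbb R^2$ be a bounded domain with smooth boundary, let $N\ge 1$, $m_1,\dots,m_N\in\mathbb Z\setminus\{0\}$, $a_1,\dots,a_N\in\Omega$ and $r>0$ be such that the closed discs $\overline B(a_j,r)$ are contained in $\Omega$ and pairwise disjoint, and let $$W=\Omega\setminus\bigcup_{j=1}^N\overline B(a_j,r),\qquad D\theta(x)=\sum_{j=1}^N\frac{m_j\,(x-a_j)^\perp}{|x-a_j|^2},\qquad (x_1,x_2)^\perp=(-x_2,x_1),$$ so that $D\theta$ is the (single-valued) gradient of the multi-valued function $\theta(x)=\sum_j m_j\arg(x-a_j)$; write $D(v-\theta)=Dv-D\theta$. Let $\mathbf n$ be the outward unit normal to $\partial W$. Let $$C_0=\max\{-\lambda:\ \lambda\text{ is the curvature of }\partial W\text{ at some point of }\partial W\},\qquad K_0=\min\{d:\ d\text{ is the diameter of an open ball inscribed in }W\},$$ where the curvature is the divergence of the outward unit normal (positive for the boundary of a disc), and an open ball is inscribed in $W$ if it is contained in $W$ and in no strictly larger open ball contained in $W$. Let $c\in C^\infty(\overline W)$ with $c>0$ on $\overline W$, and let $u_0\in C^2(\overline W)$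 with $D(u_0-\theta)\cdot\mathbf n=0$ on $\partial W$. Assume that there is $\delta>0$ such that $$c(x)^2-2|Dc(x)|-2C_0|c(x)|-\frac{8C_0}{K_0}\ \ge\ \delta\qquad\text{for all }x\in W.$$ Then there is a constant $L>0$, depending only on $\|u_0\|_{C^2(\overline W)}$, $\|D\theta\|_{C^1(\overline W)}$, $\|c\|_{C^1(\overline W)}$, $C_0$, $K_0$ and $\delta$ (it may be chosen uniformly for all data for which $C_0$, $K_0$, $\delta$ have given values and the three norms have given upper bounds), with the following property. Let $\varepsilon\in(0,1)$, let $J=[0,T]$ with $T>0$ or $J=[0,\infty)$, and let $u^\varepsilon\in C^\infty(\overline W\times (J\setminus\{0\}))\cap C^1(\overline W\times J)$ be a solution of $$\begin{cases}u^\varepsilon_t=\sqrt{\varepsilon^2+|D(u^\varepsilon-\theta)|^2}\left(\operatorname{div}\left(\dfrac{D(u^\varepsilon-\theta)}{\sqrt{\varepsilon^2+|D(u^\varepsilon-\theta)|^2}}\right)+c(x)\right)&\text{in }W\times(J\setminus\{0\}),\\ D(u^\varepsilon-\theta)\cdot\mathbf n=0&\text{on }\partial W\times J,\\ u^\varepsilon(\cdot,0)=u_0&\text{on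 }\overline W.\end{cases}$$ Then $$\|u^\varepsilon_t\|_{L^\infty(W\times J)}+\|Du^\varepsilon\|_{L^\infty(W\times J)}\le L.$$ In particular, $L$ is independent of $\varepsilon$ and $T$. -/

import Mathlib

open scoped ENNReal ContDiff Gradient

namespace Spiral

/-- The Euclidean plane. -/
abbrev Plane : Type := EuclideanSpace ℝ (Fin 2)

/-- `x^⊥ = (-x₂, x₁)`, the rotation of `x` through `π/2`. -/
noncomputable def perp (x : Plane) : Plane := !₂[-(x 1), x 0]

/-- The divergence `∂₁F₁ + ∂₂F₂` of a planar vector field. -/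
noncomputable def divergence (F : Plane → Plane) (x : Plane) : ℝ :=
  ∑ i : Fin 2, (fderiv ℝ F x (EuclideanSpace.single i 1)) i

/-- The supremum of `‖f x‖` over `x ∈ S`, as an extended nonnegative real. -/
noncomputable def supNorm {X F : Type*} [NormedAddCommGroup F] (S : Set X) (f : X → F) : ℝ≥0∞ :=
  ⨆ x ∈ S, ‖f x‖ₑ

/-- The `C¹` norm on an open set `W`. For a function that is `C¹` up to the boundary this is also
the norm of `C¹` on the closure of `W`. -/
noncomputable def c1Norm {F : Type*} [NormedAddCommGroup F] [NormedSpace ℝ F]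
    (W : Set Plane) (f : Plane → F) : ℝ≥0∞ :=
  supNorm W f + supNorm W (fderiv ℝ f)

/-- The `C²` norm on an open set `W`. -/
noncomputable def c2Norm {F : Type*} [NormedAddCommGroup F] [NormedSpace ℝ F]
    (W : Set Plane) (f : Plane → F) : ℝ≥0∞ :=
  supNorm W f + supNorm W (fderiv ℝ f) + supNorm W (fderiv ℝ (fderiv ℝ f))

/-- `φ` is a smooth function with nonzero gradient at `x` such that, near `x`, the set `W` is
`{φ < 0}`. -/
structure IsDefiningFunctionAt (W : Set Plane) (x : Plane) (φ : Plane → ℝ) : Prop where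
  smooth : ContDiff ℝ ∞ φ
  gradient_ne_zero : ∇ φ x ≠ 0
  mem_iff : ∀ᶠ y in nhds x, (y ∈ W ↔ φ y < 0)

/-- The boundary of `W` is smooth, and `W` lies locally on one side of it. -/
def HasSmoothBoundary (W : Set Plane) : Prop :=
  ∀ x ∈ frontier W, ∃ φ : Plane → ℝ, IsDefiningFunctionAt W x φ

/-- `n` is the outward unit normal vector to `∂W` at `x`. -/
def IsOutwardUnitNormal (W : Set Plane) (x n : Plane) : Prop :=
  x ∈ frontier W ∧
    ∃ φ : Plane → ℝ, IsDefiningFunctionAt W x φ ∧ n = ‖∇ φ x‖⁻¹ • ∇ φ x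

/-- `κ` is the curvature of `∂W` at `x`: the divergence of the outward unit normal field
`Dφ/|Dφ|`. The sign is such that the curvature of the boundary of a disc is positive. -/
def IsBoundaryCurvature (W : Set Plane) (x : Plane) (κ : ℝ) : Prop :=
  x ∈ frontier W ∧
    ∃ φ : Plane → ℝ, IsDefiningFunctionAt W x φ ∧
      κ = divergence (fun y => ‖∇ φ y‖⁻¹ • ∇ φ y) x

/-- The set of the numbers `-κ`, where `κ` is the curvature of `∂W` at some point of `∂W`. -/
def negCurvatures (W : Set Plane) : Set ℝ :=
  {k | ∃ x κ, IsBoundaryCurvature W x κ ∧ k = -κ}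

/-- The open ball `B(z, ρ)` is inscribed in `W`: it lies in `W`, and no strictly larger open ball
containing it does. -/
def IsInscribedBall (W : Set Plane) (z : Plane) (ρ : ℝ) : Prop :=
  0 < ρ ∧ Metric.ball z ρ ⊆ W ∧
    ∀ (z' : Plane) (ρ' : ℝ), Metric.ball z ρ ⊆ Metric.ball z' ρ' → Metric.ball z' ρ' ⊆ W →
      Metric.ball z' ρ' = Metric.ball z ρ

/-- The set of the diameters of the open balls inscribed in `W`. -/
def inscribedDiameters (W : Set Plane) : Set ℝ :=
  {d | ∃ z ρ, IsInscribedBall W z ρ ∧ d = 2 * ρ}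

/-- The domain `Ω` with the discs of radius `r` around the centers `a j` removed. The closed discs
are removed, so that the result is open. -/
def puncturedDomain {N : ℕ} (Ω : Set Plane) (a : Fin N → Plane) (r : ℝ) : Set Plane :=
  Ω \ ⋃ j, Metric.closedBall (a j) r

/-- The single-valued gradient `Dθ` of the multi-valued function `θ(x) = ∑ⱼ mⱼ arg (x - aⱼ)`. -/
noncomputable def gradTheta {N : ℕ} (a : Fin N → Plane) (m : Fin N → ℤ) (x : Plane) : Plane :=
  ∑ j, ((m j : ℝ) / ‖x - a j‖ ^ 2) • perp (x - a j)

/-- `√(ε² + |p|²)`. -/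
noncomputable def regNorm (ε : ℝ) (p : Plane) : ℝ := Real.sqrt (ε ^ 2 + ‖p‖ ^ 2)

/-- `u` is a classical solution, on the time interval `J` with initial time `0`, of the
`ε`-regularized level-set forced mean curvature flow equation in `W` with forcing term `c`,
boundary condition `D(u - θ) · n = 0` and initial value `u₀`. The vector field `Dθ` is written `q`,
and `u` is a function of `(x, t)`. It is smooth on `closure W × (J \ {0})` and `C¹` on
`closure W × J`. -/
structure IsRegularizedSolution (W : Set Plane) (q : Plane → Plane) (c u₀ : Plane → ℝ) (ε : ℝ)
    (J : Set ℝ) (u : Plane × ℝ → ℝ) : Prop where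
  smooth : ContDiffOn ℝ ∞ u (closure W ×ˢ (J \ {0}))
  contDiffOn_one : ContDiffOn ℝ 1 u (closure W ×ˢ J)
  equation : ∀ x ∈ W, ∀ t ∈ J \ {0},
    derivWithin (fun s => u (x, s)) J t =
      regNorm ε (∇ (fun y => u (y, t)) x - q x) *
        (divergence
          (fun z => (regNorm ε (∇ (fun y => u (y, t)) z - q z))⁻¹ •
            (∇ (fun y => u (y, t)) z - q z)) x + c x)
  neumann : ∀ x n, IsOutwardUnitNormal W x n → ∀ t ∈ J,
    inner ℝ (gradientWithin (fun y => u (y, t)) (closure W) x - q x) n = 0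
  initial : ∀ x ∈ closure W, u (x, 0) = u₀ x

end Spiral

/-!
Write `p = D(u - θ)`, `w = √(ε² + |p|²)` and `S = closure W`. The field `Dθ` is smooth and closed on
`S`, so that `p` has a symmetric derivative there, and the equation reads
`u_t = tr X - ⟨p, X p⟩ / w² + c w` with `X = Dp`. In the plane the coefficient matrix is
`(ε² I + p^⊥ ⊗ p^⊥) / w²`.

*Time derivative.* At a maximum over `S` of the difference of two functions with the same normal
derivative on `∂W`, the whole gradient vanishes and the Hessian is nonpositive, even if the maximum
lies on the boundary (`derivative_tests_of_isMaxOn`): for every direction `e`, one of `± e`, or a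
perturbation of it, points into `W`. Since the equation holds up to the boundary by continuity, this
gives a comparison principle (`comparison`). The barriers `u₀ ± M t`, and then the translates of `u`
in time, yield `|u_t| ≤ M` (`Setting.abs_derivWithin_time_le`).

*Gradient at interior points.* Let `ρ` be the concave multiplier `1 + k (R² - |x - z|²)`, and let
`ρ w` have a maximum at an interior point. In a frame whose first vector is parallel to `p`, the
equation is differentiated in the direction of `p` and combined with the first and second order
conditions (`bernstein_interior`). The squares of the entries of `X` in the first row compensate the
terms that come from `Dρ`; what remains bounds the tangential second derivative `d` by
`d² ≤ (|Dc| + c |Dρ| + 2k) w² + O(1)`. The equation gives `d = u_t - c w + O(1)`, so that the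
hypothesis on `c` forces `w` to be bounded (`Setting.regNorm_le_of_interior_max`).

*Gradient at the boundary.* Differentiating the boundary condition along `∂W` gives
`w ∂w/∂n = - κ |p|² ≤ C₀ w²` with the curvature `κ` (`Setting.inner_field_normal_derivative`). If `w`
is maximal at a boundary point, there is a ball of diameter `K₀` in `W` that touches `∂W` at this
point (`IsDefiningFunctionAt.ball_subset_of_isLeast`). With its center as `z`, its radius as `R` and
`k = 2 C₀ / K₀`, the multiplier is `1` on the circle, and `ρ w` strictly increases in the inward
normal direction. Hence its maximum over the closed ball lies in the open ball, where the interior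
estimate applies (`Setting.regNorm_le_of_boundary_max`). Here `C₀ > 0` because every removed disc
contributes the curvature `-1/r`.
-/

namespace Spiral

open Set Filter Topology Metric

/-! ### Domains with smooth boundary -/

/-- A function with a negative one-sided derivative drops below its value at the base point. -/
lemma eventually_lt_of_hasDerivWithinAt_neg {g : ℝ → ℝ} {d : ℝ}
    (h : HasDerivWithinAt g d (Ioi 0) 0) (hd : d < 0) : ∀ᶠ s in 𝓝[>] (0 : ℝ), g s < g 0 := by
  rw [hasDerivWithinAt_iff_tendsto_slope' (by simp)] at h
  filter_upwards [h.eventually_lt_const hd, self_mem_nhdsWithin] with s hs hs0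
  have hs0' : (0 : ℝ) < s := hs0
  rw [slope_def_field, sub_zero, div_lt_iff₀ hs0'] at hs
  linarith

lemma hasDerivAt_line {φ : Plane → ℝ} (h : ContDiff ℝ ∞ φ) (x e : Plane) :
    HasDerivAt (fun s : ℝ => φ (x + s • e)) (inner ℝ (∇ φ x) e) 0 := by
  have h1 : HasFDerivAt φ (fderiv ℝ φ x) (x + (0 : ℝ) • e) := by
    simpa using ((h.differentiable (by simp)) x).hasFDerivAt
  have h2 : HasDerivAt (fun s : ℝ => x + s • e) e 0 := by
    simpa using ((hasDerivAt_id (0 : ℝ)).smul_const e).const_add x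
  rw [inner_gradient_left]
  exact h1.comp_hasDerivAt (0 : ℝ) h2

namespace IsDefiningFunctionAt

variable {W : Set Plane} {x : Plane} {φ : Plane → ℝ}

lemma eventually (h : IsDefiningFunctionAt W x φ) :
    ∀ᶠ y in 𝓝 x, IsDefiningFunctionAt W y φ := by
  have hc : Continuous (∇ φ) :=
    (InnerProductSpace.toDual ℝ Plane).symm.continuous.comp
      (h.smooth.continuous_fderiv (by simp))
  filter_upwards [h.mem_iff.eventually_nhds, hc.continuousAt.eventually_ne h.gradient_ne_zero]
    with y h1 h2
  exact ⟨h.smooth, h2, h1⟩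

lemma eventually_add_smul_mem (h : IsDefiningFunctionAt W x φ) (hx : φ x = 0) {e : Plane}
    (he : inner ℝ (∇ φ x) e < 0) : ∀ᶠ s in 𝓝[>] (0 : ℝ), x + s • e ∈ W := by
  have h1 := eventually_lt_of_hasDerivWithinAt_neg
    (hasDerivAt_line h.smooth x e).hasDerivWithinAt he
  have h2 : Tendsto (fun s : ℝ => x + s • e) (𝓝[>] 0) (𝓝 x) := by
    have : Continuous fun s : ℝ => x + s • e := by fun_prop
    simpa using (this.tendsto 0).mono_left nhdsWithin_le_nhds
  filter_upwards [h1, h2.eventually h.mem_iff] with s h3 h4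
  rw [h4]
  simpa [hx] using h3

lemma eq_zero (h : IsDefiningFunctionAt W x φ) (hW : IsOpen W) (hx : x ∈ frontier W) :
    φ x = 0 := by
  rw [hW.frontier_eq] at hx
  have h1 : ¬ φ x < 0 := fun h' => hx.2 (h.mem_iff.self_of_nhds.2 h')
  by_contra h2
  have h3 : 0 < φ x := lt_of_le_of_ne (not_lt.1 h1) (Ne.symm h2)
  have h4 := h.smooth.continuous.continuousAt.eventually_const_lt h3
  obtain ⟨y, hy3, hy1, hy2⟩ :=
    ((mem_closure_iff_frequently.1 hx.1).and_eventually (h4.and h.mem_iff)).exists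
  exact absurd (hy2.1 hy3) (not_lt.2 hy1.le)

lemma mem_frontier (h : IsDefiningFunctionAt W x φ) (hW : IsOpen W) (hx : φ x = 0) :
    x ∈ frontier W := by
  rw [hW.frontier_eq]
  constructor
  · have h1 : inner ℝ (∇ φ x) (-∇ φ x) < 0 := by
      rw [inner_neg_right, neg_lt_zero]
      exact real_inner_self_pos.2 h.gradient_ne_zero
    have h2 : Tendsto (fun s : ℝ => x + s • (-∇ φ x)) (𝓝[>] 0) (𝓝 x) := by
      have : Continuous fun s : ℝ => x + s • (-∇ φ x) := by fun_prop
      simpa using (this.tendsto 0).mono_left nhdsWithin_le_nhds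
    exact mem_closure_of_tendsto h2 (h.eventually_add_smul_mem hx h1)
  · intro h'
    have := h.mem_iff.self_of_nhds.1 h'
    linarith

lemma isOutwardUnitNormal (h : IsDefiningFunctionAt W x φ) (hx : x ∈ frontier W) :
    IsOutwardUnitNormal W x (‖∇ φ x‖⁻¹ • ∇ φ x) := ⟨hx, φ, h, rfl⟩

end IsDefiningFunctionAt

lemma HasSmoothBoundary.uniqueDiffOn {W : Set Plane} (h : HasSmoothBoundary W) (hW : IsOpen W) :
    UniqueDiffOn ℝ (closure W) := by
  intro x hx
  by_cases hxW : x ∈ W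
  · exact uniqueDiffWithinAt_of_mem_nhds (mem_of_superset (hW.mem_nhds hxW) subset_closure)
  have hxf : x ∈ frontier W := by rw [hW.frontier_eq]; exact ⟨hx, hxW⟩
  obtain ⟨φ, hφ⟩ := h x hxf
  refine ⟨?_, by simpa using hx⟩
  have key : ∀ e : Plane, inner ℝ (∇ φ x) e < 0 →
      e ∈ Submodule.span ℝ (tangentConeAt ℝ (closure W) x) := by
    intro e he
    have h1 := hφ.eventually_add_smul_mem (hφ.eq_zero hW hxf) he
    obtain ⟨s₀, hs₀, hs⟩ := mem_nhdsGT_iff_exists_Ioo_subset.1 h1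
    have hs₀' : (0 : ℝ) < s₀ := hs₀
    have h2 : (s₀ • e) ∈ tangentConeAt ℝ (closure W) x := by
      have := mem_tangentConeAt_of_openSegment_subset (s := closure W) (x := x) (y := x + s₀ • e)
        (by
          intro y hy
          rw [openSegment_eq_image'] at hy
          obtain ⟨θ, hθ, rfl⟩ := hy
          have : θ * s₀ ∈ Ioo 0 s₀ := ⟨mul_pos hθ.1 hs₀', by nlinarith [hθ.2]⟩
          have h3 : x + (θ * s₀) • e ∈ W := hs this
          simpa [smul_smul] using subset_closure h3)
      simpa using this
    have h3 := Submodule.smul_mem _ (s₀⁻¹) (Submodule.subset_span h2 (R := ℝ))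
    rwa [smul_smul, inv_mul_cancel₀ hs₀'.ne', one_smul] at h3
  have htop : Submodule.span ℝ (tangentConeAt ℝ (closure W) x) = ⊤ := by
    rw [eq_top_iff]
    intro e _
    have hpos := real_inner_self_pos.2 hφ.gradient_ne_zero
    rcases lt_trichotomy (inner ℝ (∇ φ x) e) 0 with h1 | h1 | h1
    · exact key e h1
    · have h2 := key (-∇ φ x) (by rw [inner_neg_right]; linarith)
      have h3 := key (e + (-∇ φ x)) (by rw [inner_add_right, inner_neg_right]; linarith)
      simpa using Submodule.sub_mem _ h3 h2
    · have := key (-e) (by rw [inner_neg_right]; linarith)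
      simpa using Submodule.neg_mem _ this
  rw [htop]
  simp

/-! ### The punctured domain -/

/-- The function `y ↦ r² - |y - a|²`, which defines the complement of a disc. -/
noncomputable def discComplement (a : Plane) (r : ℝ) (y : Plane) : ℝ := r ^ 2 - ‖y - a‖ ^ 2

lemma contDiff_discComplement (a : Plane) (r : ℝ) : ContDiff ℝ ∞ (discComplement a r) :=
  contDiff_const.sub ((contDiff_id.sub contDiff_const).norm_sq ℝ)

lemma gradient_discComplement (a : Plane) (r : ℝ) (y : Plane) :
    ∇ (discComplement a r) y = (-2 : ℝ) • (y - a) := by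
  apply HasGradientAt.gradient
  rw [hasGradientAt_iff_hasFDerivAt]
  have h := (((hasFDerivAt_id y).sub_const a).norm_sq).const_sub (r ^ 2)
  refine h.congr_fderiv ?_
  ext v
  simp

section Punctured

variable {N : ℕ} {Ω : Set Plane} {a : Fin N → Plane} {r : ℝ}

lemma isOpen_puncturedDomain (hΩ : IsOpen Ω) : IsOpen (puncturedDomain Ω a r) :=
  hΩ.sdiff (isClosed_iUnion_of_finite fun _ => isClosed_closedBall)

lemma isDefiningFunctionAt_of_mem_sphere (hΩ : IsOpen Ω) (hr : 0 < r)
    (hsub : ∀ j, closedBall (a j) r ⊆ Ω)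
    (hdisj : ∀ i j, i ≠ j → Disjoint (closedBall (a i) r) (closedBall (a j) r))
    {j : Fin N} {x : Plane} (hx : x ∈ sphere (a j) r) :
    IsDefiningFunctionAt (puncturedDomain Ω a r) x (discComplement (a j) r) := by
  refine ⟨contDiff_discComplement _ _, ?_, ?_⟩
  · rw [gradient_discComplement]
    have : x - a j ≠ 0 := by
      intro h
      rw [mem_sphere, dist_eq_norm, h, norm_zero] at hx
      exact hr.ne hx
    simpa using this
  · have h1 : Ω ∈ 𝓝 x := hΩ.mem_nhds (hsub j (sphere_subset_closedBall hx))
    have h2 : ∀ᶠ y in 𝓝 x, ∀ i, i ≠ j → y ∉ closedBall (a i) r := by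
      rw [eventually_all]
      intro i
      by_cases hij : i = j
      · simp [hij]
      · have : x ∉ closedBall (a i) r := fun h =>
          (Set.disjoint_left.1 (hdisj i j hij)) h (sphere_subset_closedBall hx)
        filter_upwards [isClosed_closedBall.isOpen_compl.mem_nhds this] with y hy _
        exact hy
    filter_upwards [h1, h2] with y hy1 hy2
    have h3 : y ∈ puncturedDomain Ω a r ↔ y ∉ closedBall (a j) r := by
      simp only [puncturedDomain, Set.mem_sdiff, mem_iUnion, not_exists, hy1, true_and]
      refine ⟨fun h => h j, fun h i => ?_⟩
      by_cases hij : i = j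
      · rwa [hij]
      · exact hy2 i hij
    rw [h3, mem_closedBall, dist_eq_norm, not_le, discComplement, sub_neg,
      sq_lt_sq₀ hr.le (norm_nonneg _)]

lemma hasSmoothBoundary_puncturedDomain (hΩ : IsOpen Ω) (hΩs : HasSmoothBoundary Ω) (hr : 0 < r)
    (hsub : ∀ j, closedBall (a j) r ⊆ Ω)
    (hdisj : ∀ i j, i ≠ j → Disjoint (closedBall (a i) r) (closedBall (a j) r)) :
    HasSmoothBoundary (puncturedDomain Ω a r) := by
  intro x hx
  have hcl : IsClosed (⋃ j, closedBall (a j) r) :=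
    isClosed_iUnion_of_finite fun _ => isClosed_closedBall
  rw [(isOpen_puncturedDomain hΩ).frontier_eq] at hx
  by_cases hxΩ : x ∈ Ω
  · have hxb : x ∈ ⋃ j, closedBall (a j) r := by
      by_contra h
      exact hx.2 ⟨hxΩ, h⟩
    obtain ⟨j, hj⟩ := mem_iUnion.1 hxb
    refine ⟨_, isDefiningFunctionAt_of_mem_sphere hΩ hr hsub hdisj (j := j) ?_⟩
    rw [mem_sphere]
    refine le_antisymm hj (not_lt.1 fun hlt => ?_)
    obtain ⟨y, hy1, hy2⟩ := mem_closure_iff.1 hx.1 _ isOpen_ball (mem_ball.2 hlt)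
    exact hy2.2 (mem_iUnion.2 ⟨j, ball_subset_closedBall hy1⟩)
  · have hxΩ' : x ∈ frontier Ω := by
      rw [hΩ.frontier_eq]
      exact ⟨closure_mono sdiff_subset hx.1, hxΩ⟩
    obtain ⟨φ, hφ⟩ := hΩs x hxΩ'
    have hxb : x ∉ ⋃ j, closedBall (a j) r := fun h => by
      obtain ⟨j, hj⟩ := mem_iUnion.1 h
      exact hxΩ (hsub j hj)
    refine ⟨φ, hφ.smooth, hφ.gradient_ne_zero, ?_⟩
    filter_upwards [hφ.mem_iff, hcl.isOpen_compl.mem_nhds hxb] with y hy1 hy2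
    rw [← hy1]
    exact ⟨fun h => h.1, fun h => ⟨h, hy2⟩⟩

end Punctured

/-! ### Interior balls -/

lemma mem_ball_sub_smul_iff {x n y : Plane} {ρ : ℝ} (hn : ‖n‖ = 1) (hρ : 0 < ρ) :
    y ∈ ball (x - ρ • n) ρ ↔ ‖y - x‖ ^ 2 + 2 * ρ * inner ℝ (y - x) n < 0 := by
  rw [mem_ball, dist_eq_norm, ← sq_lt_sq₀ (norm_nonneg _) hρ.le,
    show y - (x - ρ • n) = (y - x) + ρ • n by abel, norm_add_sq_real, inner_smul_right, norm_smul,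
    hn, Real.norm_of_nonneg hρ.le]
  constructor <;> intro h <;> nlinarith

lemma ball_sub_smul_mono {x n : Plane} {ρ ρ' : ℝ} (hn : ‖n‖ = 1) (hρ : 0 < ρ) (h : ρ ≤ ρ') :
    ball (x - ρ • n) ρ ⊆ ball (x - ρ' • n) ρ' := by
  intro y hy
  rw [mem_ball_sub_smul_iff hn hρ] at hy
  rw [mem_ball_sub_smul_iff hn (hρ.trans_le h)]
  nlinarith [sq_nonneg ‖y - x‖]

/-- A smooth function is bounded above by its first-order expansion plus a quadratic term. -/
lemma exists_quadratic_upper_bound {φ : Plane → ℝ} (h : ContDiff ℝ ∞ φ) (x : Plane) :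
    ∃ C > 0, ∃ s > 0, ∀ y ∈ ball x s,
      φ y ≤ φ x + inner ℝ (∇ φ x) (y - x) + C * ‖y - x‖ ^ 2 := by
  have h1 : ContDiffAt ℝ 1 (fderiv ℝ φ) x :=
    ((h.fderiv_right (m := 1) (by norm_cast)).contDiffAt)
  obtain ⟨K, t, ht, hK⟩ := h1.exists_lipschitzOnWith
  obtain ⟨s, hs, hst⟩ := Metric.mem_nhds_iff.1 ht
  refine ⟨K + 1, by positivity, s, hs, fun y hy => ?_⟩
  have hsub : closedBall x ‖y - x‖ ⊆ t := by
    refine Subset.trans (closedBall_subset_ball ?_) hst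
    rwa [mem_ball, dist_eq_norm] at hy
  have hy' : y ∈ closedBall x ‖y - x‖ := by simp [dist_eq_norm]
  have hx' : x ∈ closedBall x ‖y - x‖ := by simp
  have key := (convex_closedBall x ‖y - x‖).norm_image_sub_le_of_norm_hasFDerivWithin_le'
    (f := φ) (f' := fderiv ℝ φ) (φ := fderiv ℝ φ x) (C := K * ‖y - x‖)
    (fun z _ => ((h.differentiable (by simp)) z).hasFDerivAt.hasFDerivWithinAt)
    (fun z hz => by
      have := hK.dist_le_mul z (hsub hz) x (hsub hx')
      rw [dist_eq_norm, dist_eq_norm] at this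
      refine this.trans (mul_le_mul_of_nonneg_left ?_ K.2)
      simpa [dist_eq_norm] using hz) hx' hy'
  rw [inner_gradient_left]
  have := (le_abs_self _).trans key
  nlinarith [sq_nonneg ‖y - x‖]

lemma IsDefiningFunctionAt.exists_ball_subset {W : Set Plane} {x : Plane} {φ : Plane → ℝ}
    (h : IsDefiningFunctionAt W x φ) (hx : φ x = 0) :
    ∃ ρ > 0, ball (x - ρ • (‖∇ φ x‖⁻¹ • ∇ φ x)) ρ ⊆ W := by
  obtain ⟨C, hC, s, hs, hb⟩ := exists_quadratic_upper_bound h.smooth x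
  obtain ⟨s', hs', hmem⟩ := Metric.eventually_nhds_iff.1 h.mem_iff
  set g := ‖∇ φ x‖ with hg
  have hg0 : 0 < g := norm_pos_iff.2 h.gradient_ne_zero
  set n := g⁻¹ • ∇ φ x with hn
  have hn1 : ‖n‖ = 1 := by
    rw [hn, norm_smul, Real.norm_of_nonneg (inv_nonneg.2 hg0.le), ← hg, inv_mul_cancel₀ hg0.ne']
  have hgn : ∇ φ x = g • n := by rw [hn, smul_smul, mul_inv_cancel₀ hg0.ne', one_smul]
  refine ⟨min (g / (2 * C)) (min (s / 2) (s' / 2)), by positivity, fun y hy => ?_⟩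
  set ρ := min (g / (2 * C)) (min (s / 2) (s' / 2)) with hρ
  have hρ0 : 0 < ρ := by positivity
  have hρ1 : ρ ≤ g / (2 * C) := min_le_left _ _
  have hρ2 : ρ ≤ s / 2 := (min_le_right _ _).trans (min_le_left _ _)
  have hρ3 : ρ ≤ s' / 2 := (min_le_right _ _).trans (min_le_right _ _)
  have hdist : dist y x < 2 * ρ := by
    have h1 := mem_ball.1 hy
    have h2 : dist (x - ρ • n) x = ρ := by
      rw [dist_eq_norm]; simp [norm_smul, hn1, abs_of_pos hρ0]
    linarith [dist_triangle y (x - ρ • n) x]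
  rw [mem_ball_sub_smul_iff hn1 hρ0] at hy
  rw [hmem (by linarith)]
  have h3 := hb y (by rw [mem_ball]; linarith)
  rw [hx, hgn, inner_smul_left, real_inner_comm] at h3
  rw [le_div_iff₀ (by positivity)] at hρ1
  simp only [conj_trivial] at h3
  have h4 : ρ * (g * inner ℝ (y - x) n + C * ‖y - x‖ ^ 2) < 0 := by
    nlinarith [mul_le_mul_of_nonneg_right hρ1 (sq_nonneg ‖y - x‖), mul_pos hg0 hρ0]
  have h5 : g * inner ℝ (y - x) n + C * ‖y - x‖ ^ 2 < 0 := by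
    by_contra hcon
    exact absurd h4 (not_lt.2 (mul_nonneg hρ0.le (not_lt.1 hcon)))
  linarith

/-- The center of a disc in `W` that touches `∂W` at `x` lies on the inner normal at `x`. -/
lemma IsDefiningFunctionAt.center_eq {W : Set Plane} {x : Plane} {φ : Plane → ℝ}
    (h : IsDefiningFunctionAt W x φ) (hx : φ x = 0) {z : Plane} {ρ : ℝ}
    (hz : ball z ρ ⊆ W) (hzx : dist x z = ρ) (hρ : 0 < ρ) :
    z = x - ρ • (‖∇ φ x‖⁻¹ • ∇ φ x) := by
  set p := z - x with hp
  set v := ∇ φ x with hv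
  have hpn : ‖p‖ = ρ := by rw [hp, ← dist_eq_norm, dist_comm, hzx]
  have hv0 : 0 < ‖v‖ := norm_pos_iff.2 h.gradient_ne_zero
  have key : ∀ e, 0 < inner ℝ p e → inner ℝ v e ≤ 0 := by
    intro e he
    by_contra hcon
    have hcon' : inner ℝ (∇ φ x) e > 0 := not_le.1 hcon
    have h1 := eventually_lt_of_hasDerivWithinAt_neg
      (g := fun s => -φ (x + s • e)) (hasDerivAt_line h.smooth x e).neg.hasDerivWithinAt
      (by linarith)
    have h2 : Tendsto (fun s : ℝ => x + s • e) (𝓝[>] 0) (𝓝 x) := by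
      have : Continuous fun s : ℝ => x + s • e := by fun_prop
      simpa using (this.tendsto 0).mono_left nhdsWithin_le_nhds
    have h3 : ∀ᶠ s in 𝓝[>] (0 : ℝ), s * ‖e‖ ^ 2 < 2 * inner ℝ p e := by
      have : Continuous fun s : ℝ => s * ‖e‖ ^ 2 := by fun_prop
      have h4 := (this.tendsto 0).mono_left (nhdsWithin_le_nhds (s := Ioi 0))
      exact h4.eventually_lt_const (by simpa using he)
    obtain ⟨s, hs1, hs2, hs3, hs0⟩ :=
      (h1.and ((h2.eventually h.mem_iff).and (h3.and self_mem_nhdsWithin))).exists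
    have hs0' : (0 : ℝ) < s := hs0
    have hin : x + s • e ∈ ball z ρ := by
      rw [mem_ball, dist_eq_norm, ← hpn, ← sq_lt_sq₀ (norm_nonneg _) (norm_nonneg _),
        show x + s • e - z = s • e - p by rw [hp]; abel, norm_sub_sq_real, norm_smul, mul_pow,
        inner_smul_left, real_inner_comm, Real.norm_of_nonneg hs0'.le]
      simp only [conj_trivial]
      nlinarith
    have := hs2.1 (hz hin)
    simp [hx] at hs1
    linarith
  -- Apply the sign condition to a vector that nearly realizes equality in Cauchy-Schwarz.
  have hle : inner ℝ p v ≤ -(‖p‖ * ‖v‖) := by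
    have hp0 : 0 < ‖p‖ := hpn ▸ hρ
    by_contra hcon
    push Not at hcon
    have h1 := key (‖v‖ • p + ‖p‖ • v) (by
      rw [inner_add_right, inner_smul_right, inner_smul_right, real_inner_self_eq_norm_sq]
      nlinarith [mul_pos hp0 hv0])
    rw [inner_add_right, inner_smul_right, inner_smul_right, real_inner_self_eq_norm_sq,
      real_inner_comm] at h1
    nlinarith [mul_pos hp0 hv0]
  have heq : inner ℝ p (-v) = ‖p‖ * ‖-v‖ := by
    rw [inner_neg_right, norm_neg]
    have := abs_le.1 (abs_real_inner_le_norm p v)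
    linarith
  rw [inner_eq_norm_mul_iff_real, norm_neg, hpn] at heq
  have h6 : p = -(ρ • ‖v‖⁻¹ • v) := by
    have := congrArg (fun w => ‖v‖⁻¹ • w) heq
    simp only [smul_smul, inv_mul_cancel₀ hv0.ne', one_smul] at this
    rw [this, smul_neg, smul_smul, mul_comm]
  rw [sub_eq_add_neg, ← h6, hp]
  abel

/-- The radius of the largest ball in `W` that touches `∂W` at a given point is the radius of an
inscribed ball. Hence balls whose diameter is at most that of every inscribed ball fit. -/
lemma IsDefiningFunctionAt.ball_subset_of_isLeast {W : Set Plane} {x : Plane} {φ : Plane → ℝ}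
    {K : ℝ} (h : IsDefiningFunctionAt W x φ) (hW : IsOpen W) (hbdd : Bornology.IsBounded W)
    (hx : x ∈ frontier W) (hK : IsLeast (inscribedDiameters W) K) :
    ball (x - (K / 2) • (‖∇ φ x‖⁻¹ • ∇ φ x)) (K / 2) ⊆ W := by
  have hx0 := h.eq_zero hW hx
  have hK0 : 0 < K := by
    obtain ⟨z, ρ, hρ, rfl⟩ := hK.1
    linarith [hρ.1]
  set n := ‖∇ φ x‖⁻¹ • ∇ φ x with hn
  have hg0 : 0 < ‖∇ φ x‖ := norm_pos_iff.2 h.gradient_ne_zero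
  have hn1 : ‖n‖ = 1 := by
    rw [hn, norm_smul, norm_inv, norm_norm, inv_mul_cancel₀ hg0.ne']
  set S : Set ℝ := {ρ | 0 < ρ ∧ ball (x - ρ • n) ρ ⊆ W} with hS
  have hne : S.Nonempty := by
    obtain ⟨ρ, h1, h2⟩ := h.exists_ball_subset hx0
    exact ⟨ρ, h1, h2⟩
  have hxcl : ∀ ρ > 0, x ∈ closure (ball (x - ρ • n) ρ) := by
    intro ρ hρ
    rw [closure_ball _ hρ.ne', mem_closedBall, dist_eq_norm]
    simp [norm_smul, hn1, abs_of_pos hρ]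
  obtain ⟨R, hR⟩ := hbdd.closure.subset_closedBall x
  have hbd : BddAbove S := by
    refine ⟨R, fun ρ hρ => ?_⟩
    have h1 : x - ρ • n ∈ closedBall x R := hR (subset_closure (hρ.2 (mem_ball_self hρ.1)))
    simpa [dist_eq_norm, norm_smul, hn1, abs_of_pos hρ.1] using h1
  obtain ⟨ρ₁, hρ₁⟩ := hne
  have hs0 : 0 < sSup S := hρ₁.1.trans_le (le_csSup hbd hρ₁)
  have hsub : ball (x - sSup S • n) (sSup S) ⊆ W := by
    intro y hy
    rw [mem_ball_sub_smul_iff hn1 hs0] at hy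
    have hcont : Continuous fun ρ : ℝ => ‖y - x‖ ^ 2 + 2 * ρ * inner ℝ (y - x) n := by fun_prop
    have h1 : ∀ᶠ ρ in 𝓝[<] (sSup S), ‖y - x‖ ^ 2 + 2 * ρ * inner ℝ (y - x) n < 0 :=
      ((hcont.tendsto _).mono_left nhdsWithin_le_nhds).eventually_lt_const hy
    have h2 : ∀ᶠ ρ in 𝓝[<] (sSup S), 0 < ρ :=
      (eventually_gt_nhds hs0).filter_mono nhdsWithin_le_nhds
    obtain ⟨ρ, h3, h4, h5⟩ := (h1.and (h2.and self_mem_nhdsWithin)).exists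
    obtain ⟨ρ', h6, h7⟩ := exists_lt_of_lt_csSup ⟨ρ₁, hρ₁⟩ h5
    exact h6.2 (ball_sub_smul_mono hn1 h4 h7.le ((mem_ball_sub_smul_iff hn1 h4).2 h3))
  have hins : IsInscribedBall W (x - sSup S • n) (sSup S) := by
    refine ⟨hs0, hsub, fun z' ρ' h1 h2 => Subset.antisymm ?_ h1⟩
    have hρ' : 0 < ρ' := by
      rw [← nonempty_ball (x := z')]
      exact ⟨_, h1 (mem_ball_self hs0)⟩
    have hxz : dist x z' = ρ' := by
      refine le_antisymm ?_ (not_lt.1 fun hlt => ?_)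
      · have := closure_mono h1 (hxcl _ hs0)
        exact closure_ball_subset_closedBall this
      · rw [hW.frontier_eq] at hx
        exact hx.2 (h2 hlt)
    have hz' := h.center_eq hx0 h2 hxz hρ'
    rw [← hn] at hz'
    have : ρ' ≤ sSup S := le_csSup hbd ⟨hρ', hz' ▸ h2⟩
    rw [hz']
    exact ball_sub_smul_mono hn1 hρ' this
  have hle := hK.2 ⟨_, _, hins, rfl⟩
  exact (ball_sub_smul_mono hn1 (by linarith) (by linarith)).trans hsub

/-! ### The curvature operator in orthonormal frames -/

lemma divergence_eq_trace (F : Plane → Plane) (x : Plane) :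
    divergence F x = LinearMap.trace ℝ Plane (fderiv ℝ F x : Plane →ₗ[ℝ] Plane) := by
  rw [LinearMap.trace_eq_sum_inner _ (EuclideanSpace.basisFun (Fin 2) ℝ)]
  simp [divergence, EuclideanSpace.inner_single_left]

/-- The second-order part `tr X - ⟨p, X p⟩ / (ε² + |p|²)` of the regularized equation, at the
gradient `p` and the Hessian `X`. -/
noncomputable def curvOp (ε : ℝ) (p : Plane) (X : Plane →L[ℝ] Plane) : ℝ :=
  LinearMap.trace ℝ Plane (X : Plane →ₗ[ℝ] Plane) - inner ℝ p (X p) / (ε ^ 2 + ‖p‖ ^ 2)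

lemma norm_sq_frame (b : OrthonormalBasis (Fin 2) ℝ Plane) (p : Plane) :
    ‖p‖ ^ 2 = inner ℝ (b 0) p ^ 2 + inner ℝ (b 1) p ^ 2 := by
  rw [← b.sum_sq_norm_inner_right p]
  simp

lemma eq_frame (b : OrthonormalBasis (Fin 2) ℝ Plane) (p : Plane) :
    p = inner ℝ (b 0) p • b 0 + inner ℝ (b 1) p • b 1 := by
  conv_lhs => rw [← b.sum_repr' p]
  simp

lemma trace_frame (b : OrthonormalBasis (Fin 2) ℝ Plane) (X : Plane →L[ℝ] Plane) :
    LinearMap.trace ℝ Plane (X : Plane →ₗ[ℝ] Plane) =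
      inner ℝ (b 0) (X (b 0)) + inner ℝ (b 1) (X (b 1)) := by
  rw [LinearMap.trace_eq_sum_inner _ b]
  simp

/-- In two dimensions the coefficient matrix is `(ε² I + p^⊥ ⊗ p^⊥) / (ε² + |p|²)`, which shows its
degenerate ellipticity. -/
lemma curvOp_frame (b : OrthonormalBasis (Fin 2) ℝ Plane) {ε : ℝ} {p : Plane}
    (hG : 0 < ε ^ 2 + ‖p‖ ^ 2) (X : Plane →L[ℝ] Plane) :
    curvOp ε p X =
      ((ε ^ 2 + inner ℝ (b 1) p ^ 2) * inner ℝ (b 0) (X (b 0))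
        - inner ℝ (b 0) p * inner ℝ (b 1) p * (inner ℝ (b 0) (X (b 1)) + inner ℝ (b 1) (X (b 0)))
        + (ε ^ 2 + inner ℝ (b 0) p ^ 2) * inner ℝ (b 1) (X (b 1))) / (ε ^ 2 + ‖p‖ ^ 2) := by
  have h1 : inner ℝ p (X p) = inner ℝ (b 0) p ^ 2 * inner ℝ (b 0) (X (b 0))
      + inner ℝ (b 0) p * inner ℝ (b 1) p * (inner ℝ (b 0) (X (b 1)) + inner ℝ (b 1) (X (b 0)))
      + inner ℝ (b 1) p ^ 2 * inner ℝ (b 1) (X (b 1)) := by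
    conv_lhs => rw [eq_frame b p]
    simp only [map_add, map_smul, inner_add_left, inner_add_right, inner_smul_left,
      inner_smul_right, conj_trivial]
    ring
  rw [curvOp, trace_frame b, h1, eq_div_iff hG.ne', sub_mul, div_mul_cancel₀ _ hG.ne',
    norm_sq_frame b]
  ring

lemma curvOp_mono {ε : ℝ} {p : Plane} (hG : 0 < ε ^ 2 + ‖p‖ ^ 2) {X Y : Plane →L[ℝ] Plane}
    (h : ∀ v, inner ℝ v (X v) ≤ inner ℝ v (Y v)) : curvOp ε p X ≤ curvOp ε p Y := by
  set b := EuclideanSpace.basisFun (Fin 2) ℝ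
  rw [curvOp_frame b hG, curvOp_frame b hG]
  apply div_le_div_of_nonneg_right _ hG.le
  have h0 := mul_le_mul_of_nonneg_left (h (b 0)) (sq_nonneg ε)
  have h1 := mul_le_mul_of_nonneg_left (h (b 1)) (sq_nonneg ε)
  have h2 := h (inner ℝ (b 1) p • b 0 - inner ℝ (b 0) p • b 1)
  simp only [map_sub, map_smul, inner_sub_left, inner_sub_right, inner_smul_left,
    inner_smul_right, conj_trivial] at h2
  nlinarith

lemma abs_curvOp_le (ε : ℝ) (p : Plane) (X : Plane →L[ℝ] Plane) : |curvOp ε p X| ≤ 3 * ‖X‖ := by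
  set b := EuclideanSpace.basisFun (Fin 2) ℝ
  have hb : ∀ i, |inner ℝ (b i) (X (b i))| ≤ ‖X‖ := fun i => by
    refine (abs_real_inner_le_norm _ _).trans ?_
    have := X.le_opNorm (b i)
    simp only [b.norm_eq_one, one_mul, mul_one] at this ⊢
    exact this
  have hp : |inner ℝ p (X p) / (ε ^ 2 + ‖p‖ ^ 2)| ≤ ‖X‖ := by
    rw [abs_div, abs_of_nonneg (by positivity : 0 ≤ ε ^ 2 + ‖p‖ ^ 2)]
    refine div_le_of_le_mul₀ (by positivity) (norm_nonneg _) ?_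
    refine (abs_real_inner_le_norm _ _).trans ?_
    nlinarith [mul_le_mul_of_nonneg_left (X.le_opNorm p) (norm_nonneg p),
      mul_nonneg (norm_nonneg X) (sq_nonneg ε)]
  rw [curvOp, trace_frame b]
  have h0 := abs_le.1 (hb 0)
  have h1 := abs_le.1 (hb 1)
  have h2 := abs_le.1 hp
  rw [abs_le]
  constructor <;> linarith [h0.1, h0.2, h1.1, h1.2, h2.1, h2.2]

lemma regNorm_sq (ε : ℝ) (p : Plane) : regNorm ε p ^ 2 = ε ^ 2 + ‖p‖ ^ 2 :=
  Real.sq_sqrt (by positivity)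

lemma regNorm_nonneg (ε : ℝ) (p : Plane) : 0 ≤ regNorm ε p := Real.sqrt_nonneg _

lemma regNorm_pos {ε : ℝ} (hε : 0 < ε) (p : Plane) : 0 < regNorm ε p :=
  Real.sqrt_pos.2 (by positivity)

lemma norm_le_regNorm (ε : ℝ) (p : Plane) : ‖p‖ ≤ regNorm ε p :=
  Real.le_sqrt_of_sq_le (by nlinarith [sq_nonneg ε])

lemma regNorm_le {ε : ℝ} (hε : 0 ≤ ε) (p : Plane) : regNorm ε p ≤ ε + ‖p‖ := by
  rw [regNorm, Real.sqrt_le_left (by positivity)]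
  nlinarith [norm_nonneg p, mul_nonneg hε (norm_nonneg p)]

lemma continuous_regNorm (ε : ℝ) : Continuous (regNorm ε) := by
  unfold regNorm
  fun_prop

lemma hasFDerivAt_regNorm {ε : ℝ} {p : Plane → Plane} {X : Plane →L[ℝ] Plane} {x : Plane}
    (hp : HasFDerivAt p X x) (hG : 0 < ε ^ 2 + ‖p x‖ ^ 2) :
    HasFDerivAt (fun z => regNorm ε (p z))
      ((regNorm ε (p x))⁻¹ • (innerSL ℝ (p x)).comp X) x := by
  have h := ((hp.norm_sq).const_add (ε ^ 2)).sqrt hG.ne'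
  refine h.congr_fderiv ?_
  ext v
  simp [regNorm]
  ring

/-- The operator of the equation in nondivergence form. It also covers the curvature of level sets,
which is the case `ε = 0`. -/
lemma regNorm_mul_divergence {ε : ℝ} {p : Plane → Plane} {X : Plane →L[ℝ] Plane} {x : Plane}
    (hp : HasFDerivAt p X x) (hG : 0 < ε ^ 2 + ‖p x‖ ^ 2) :
    regNorm ε (p x) * divergence (fun z => (regNorm ε (p z))⁻¹ • p z) x = curvOp ε (p x) X := by
  have hw : 0 < regNorm ε (p x) := Real.sqrt_pos.2 hG
  have h1 : HasFDerivAt (fun z => (regNorm ε (p z))⁻¹ • p z) _ x :=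
    ((hasDerivAt_inv hw.ne').comp_hasFDerivAt x (hasFDerivAt_regNorm hp hG)).smul hp
  rw [divergence_eq_trace, h1.fderiv]
  set b := EuclideanSpace.basisFun (Fin 2) ℝ
  rw [curvOp, trace_frame b, trace_frame b, ← regNorm_sq]
  have h2 : inner ℝ (p x) (X (p x)) = inner ℝ (b 0) (p x) * inner ℝ (p x) (X (b 0)) +
      inner ℝ (b 1) (p x) * inner ℝ (p x) (X (b 1)) := by
    have h3 : X (p x) = inner ℝ (b 0) (p x) • X (b 0) + inner ℝ (b 1) (p x) • X (b 1) := by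
      conv_lhs => rw [eq_frame b (p x)]
      rw [map_add, map_smul, map_smul]
    rw [h3, inner_add_right, inner_smul_right, inner_smul_right]
  rw [h2]
  simp only [Function.comp_apply, add_apply, smul_apply,
    ContinuousLinearMap.smulRight_apply, inner_add_right, inner_smul_right,
    ContinuousLinearMap.comp_apply, innerSL_apply_apply, smul_eq_mul]
  field_simp
  ring

lemma exists_frame {v : Plane} (hv : v ≠ 0) :
    ∃ b : OrthonormalBasis (Fin 2) ℝ Plane, b 0 = ‖v‖⁻¹ • v := by
  have hn : ‖‖v‖⁻¹ • v‖ = 1 := by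
    rw [norm_smul, norm_inv, norm_norm, inv_mul_cancel₀ (norm_ne_zero_iff.2 hv)]
  obtain ⟨b, hb⟩ := Orthonormal.exists_orthonormalBasis_extension_of_card_eq
    (𝕜 := ℝ) (E := Plane) (ι := Fin 2) (by simp) (v := fun _ => ‖v‖⁻¹ • v) (s := {0})
    (by
      constructor
      · intro i; simpa using hn
      · intro i j hij
        exact absurd (Subsingleton.elim i j) hij)
  exact ⟨b, hb 0 rfl⟩

/-- The curvature of a level set is the tangential second derivative of the defining function
divided by the length of its gradient. -/
lemma divergence_normalized_gradient {φ : Plane → ℝ} {x : Plane} {H : Plane →L[ℝ] Plane}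
    (hH : HasFDerivAt (∇ φ) H x) (b : OrthonormalBasis (Fin 2) ℝ Plane)
    (h0 : ∇ φ x ≠ 0) (hb : b 0 = ‖∇ φ x‖⁻¹ • ∇ φ x) :
    ‖∇ φ x‖ * divergence (fun y => ‖∇ φ y‖⁻¹ • ∇ φ y) x = inner ℝ (b 1) (H (b 1)) := by
  have hg : 0 < ‖∇ φ x‖ := norm_pos_iff.2 h0
  have hG : 0 < (0 : ℝ) ^ 2 + ‖∇ φ x‖ ^ 2 := by positivity
  have h1 := regNorm_mul_divergence (ε := 0) hH hG
  have h2 : ∀ p, regNorm 0 p = ‖p‖ := fun p => by simp [regNorm]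
  simp only [h2] at h1
  have h3 : ∇ φ x = ‖∇ φ x‖ • b 0 := by
    rw [hb, smul_smul, mul_inv_cancel₀ hg.ne', one_smul]
  have h4 : inner ℝ (b 0) (∇ φ x) = ‖∇ φ x‖ := by
    conv_lhs => rw [h3]
    simp [inner_smul_right]
  have h5 : inner ℝ (b 1) (∇ φ x) = 0 := by
    rw [h3]
    simp [inner_smul_right]
  rw [h1, curvOp_frame b hG, h4, h5]
  field_simp
  ring

/-! ### The vector field `Dθ` -/

/-- The rotation `x ↦ x^⊥` as a continuous linear map. -/
noncomputable def perpL : Plane →L[ℝ] Plane :=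
  LinearMap.toContinuousLinearMap
    { toFun := perp
      map_add' := fun x y => by
        ext i; fin_cases i <;> simp [perp]; ring
      map_smul' := fun c x => by
        ext i; fin_cases i <;> simp [perp] }

lemma perpL_apply (x : Plane) : perpL x = perp x := rfl

lemma inner_plane (x y : Plane) : inner ℝ x y = x 0 * y 0 + x 1 * y 1 := by
  rw [PiLp.inner_apply]
  simp [mul_comm]

lemma norm_sq_plane (x : Plane) : ‖x‖ ^ 2 = x 0 ^ 2 + x 1 ^ 2 := by
  rw [EuclideanSpace.norm_sq_eq]
  simp

section GradTheta

variable {N : ℕ} (a : Fin N → Plane) (m : Fin N → ℤ)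

lemma gradTheta_eq (a : Fin N → Plane) (m : Fin N → ℤ) :
    gradTheta a m = fun x => ∑ j, ((m j : ℝ) * (‖x - a j‖ ^ 2)⁻¹) • perpL (x - a j) := by
  ext1 x
  simp [gradTheta, div_eq_mul_inv, perpL_apply]

lemma contDiffAt_gradTheta {x : Plane} (hx : ∀ j, x ≠ a j) :
    ContDiffAt ℝ ∞ (gradTheta a m) x := by
  rw [gradTheta_eq]
  refine ContDiffAt.sum fun j _ => ?_
  have h1 : ContDiffAt ℝ ∞ (fun x : Plane => x - a j) x := contDiffAt_id.sub contDiffAt_const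
  have h2 : ‖x - a j‖ ^ 2 ≠ 0 := by
    have := sub_ne_zero.2 (hx j)
    positivity
  exact (contDiffAt_const.mul ((h1.norm_sq ℝ).inv h2)).smul (perpL.contDiff.contDiffAt.comp x h1)

/-- `Dθ` is closed: its derivative is symmetric. -/
lemma inner_fderiv_gradTheta_comm {x : Plane} (hx : ∀ j, x ≠ a j) (g h : Plane) :
    inner ℝ g (fderiv ℝ (gradTheta a m) x h) = inner ℝ h (fderiv ℝ (gradTheta a m) x g) := by
  have hd : ∀ j, HasFDerivAt (fun x => ((m j : ℝ) * (‖x - a j‖ ^ 2)⁻¹) • perpL (x - a j)) _ x :=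
    fun j => by
      have h1 : HasFDerivAt (fun x : Plane => x - a j) (ContinuousLinearMap.id ℝ Plane) x :=
        (hasFDerivAt_id x).sub_const (a j)
      have h2 : ‖x - a j‖ ^ 2 ≠ 0 := by
        have := sub_ne_zero.2 (hx j)
        positivity
      exact (((hasDerivAt_inv h2).comp_hasFDerivAt x h1.norm_sq).const_mul (m j : ℝ)).smul
        (perpL.hasFDerivAt.comp x h1)
  rw [gradTheta_eq, (HasFDerivAt.fun_sum fun j _ => hd j).fderiv]
  simp only [sum_apply, inner_sum]
  refine Finset.sum_congr rfl fun j _ => ?_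
  have h2 : ‖x - a j‖ ^ 2 ≠ 0 := by
    have := sub_ne_zero.2 (hx j)
    positivity
  simp only [Function.comp_apply, add_apply, smul_apply,
    ContinuousLinearMap.smulRight_apply, ContinuousLinearMap.comp_apply, innerSL_apply_apply,
    smul_eq_mul, inner_add_right, inner_smul_right, ContinuousLinearMap.id_apply, perpL_apply]
  set y := x - a j
  have e1 : ∀ u v : Plane, inner ℝ u (perp v) = -(u 0 * v 1) + u 1 * v 0 := fun u v => by
    rw [inner_plane]; simp [perp]
  rw [e1, e1, e1, e1, inner_plane, inner_plane]
  field_simp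
  rw [norm_sq_plane]
  ring

end GradTheta

/-! ### Derivative tests up to the boundary -/

lemma contDiffOn_gradientWithin {S : Set Plane} (hS : UniqueDiffOn ℝ S) {f : Plane → ℝ}
    {n k : WithTop ℕ∞} (hf : ContDiffOn ℝ n f S) (hk : k + 1 ≤ n) :
    ContDiffOn ℝ k (gradientWithin f S) S :=
  (InnerProductSpace.toDual ℝ Plane).symm.toContinuousLinearEquiv.contDiff.comp_contDiffOn
    (hf.fderivWithin hS hk)

lemma inner_gradientWithin {S : Set Plane} {f : Plane → ℝ} {x e : Plane} :
    inner ℝ (gradientWithin f S x) e = fderivWithin ℝ f S x e := inner_gradientWithin_left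

section DerivativeTests

variable {W : Set Plane} {f : Plane → ℝ} {x e : Plane}

/-- The derivative along a segment that enters `W`. -/
lemma hasDerivWithinAt_segment {F : Type*} [NormedAddCommGroup F] [NormedSpace ℝ F]
    {f : Plane → F} {L : Plane →L[ℝ] F} (hf : HasFDerivWithinAt f L (closure W) x)
    (he : ∀ᶠ s in 𝓝[>] (0 : ℝ), x + s • e ∈ W) :
    HasDerivWithinAt (fun s : ℝ => f (x + s • e)) (L e) (Ioi 0) 0 := by
  obtain ⟨s₀, hs₀, hs⟩ := mem_nhdsGT_iff_exists_Ioo_subset.1 he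
  have h2 : HasDerivWithinAt (fun s : ℝ => x + s • e) e (Ioo 0 s₀) 0 := by
    simpa using (((hasDerivAt_id (0 : ℝ)).smul_const e).const_add x).hasDerivWithinAt
  have h1 : HasFDerivWithinAt f L (closure W) (x + (0 : ℝ) • e) := by simpa using hf
  have h3 := h1.comp_hasDerivWithinAt (0 : ℝ) h2 fun s hs' => subset_closure (hs hs')
  exact h3.mono_of_mem_nhdsWithin (Ioo_mem_nhdsGT hs₀)

lemma inner_gradientWithin_nonpos_of_isMaxOn
    (hf : DifferentiableWithinAt ℝ f (closure W) x) (hmax : IsMaxOn f (closure W) x)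
    (he : ∀ᶠ s in 𝓝[>] (0 : ℝ), x + s • e ∈ W) :
    inner ℝ (gradientWithin f (closure W) x) e ≤ 0 := by
  rw [inner_gradientWithin]
  by_contra hcon
  have h1 := eventually_lt_of_hasDerivWithinAt_neg
    (hasDerivWithinAt_segment hf.hasFDerivWithinAt he).neg (by linarith)
  obtain ⟨s, hs1, hs2⟩ := (h1.and he).exists
  have := hmax (subset_closure hs2)
  simp at hs1 this
  linarith

lemma inner_hessian_nonpos_of_isMaxOn (hW : IsOpen W) (hS : UniqueDiffOn ℝ (closure W))
    (hf : ContDiffOn ℝ 2 f (closure W)) (hx : x ∈ closure W) (hmax : IsMaxOn f (closure W) x)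
    (hg : gradientWithin f (closure W) x = 0)
    (he : ∀ᶠ s in 𝓝[>] (0 : ℝ), x + s • e ∈ W) :
    inner ℝ e (fderivWithin ℝ (gradientWithin f (closure W)) (closure W) x e) ≤ 0 := by
  by_contra hcon
  have hcon' := not_le.1 hcon
  have hg1 := (contDiffOn_gradientWithin hS hf (k := 1) (by norm_num)).differentiableOn (by simp)
  have h1 := hasDerivWithinAt_segment (hg1 x hx).hasFDerivWithinAt he
  have h2 : HasDerivWithinAt
      (fun s : ℝ => -inner ℝ e (gradientWithin f (closure W) (x + s • e))) _ (Ioi 0) 0 :=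
    ((innerSL ℝ e).hasFDerivAt.comp_hasDerivWithinAt (0 : ℝ) h1).neg
  have h3 := eventually_lt_of_hasDerivWithinAt_neg h2 (by simpa using hcon')
  obtain ⟨s₀, hs₀, hs⟩ := mem_nhdsGT_iff_exists_Ioo_subset.1 (h3.and he)
  have hs₀' : (0 : ℝ) < s₀ := hs₀
  have hmem : ∀ s ∈ Ico 0 s₀, x + s • e ∈ closure W := by
    intro s hs'
    rcases hs'.1.eq_or_lt with h | h
    · simpa [← h] using hx
    · exact subset_closure (hs ⟨h, hs'.2⟩).2
  have hmono : StrictMonoOn (fun s : ℝ => f (x + s • e)) (Ico 0 s₀) := by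
    apply strictMonoOn_of_deriv_pos (convex_Ico 0 s₀)
    · exact hf.continuousOn.comp (by fun_prop) hmem
    · intro s hs'
      rw [interior_Ico] at hs'
      have h4 := hs hs'
      have h5 : closure W ∈ 𝓝 (x + s • e) :=
        mem_of_superset (hW.mem_nhds h4.2) subset_closure
      have h6 : HasFDerivAt f (fderivWithin ℝ f (closure W) (x + s • e)) (x + s • e) :=
        ((hf.differentiableOn (by simp)) _ (subset_closure h4.2)).hasFDerivWithinAt.hasFDerivAt h5
      have h7 : HasDerivAt (fun s : ℝ => x + s • e) e s := by
        simpa using ((hasDerivAt_id s).smul_const e).const_add x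
      have h8 : HasDerivAt (fun s : ℝ => f (x + s • e)) _ s := h6.comp_hasDerivAt s h7
      rw [h8.deriv, ← inner_gradientWithin, real_inner_comm]
      have := h4.1
      simp only [zero_smul, add_zero, hg, inner_zero_right, neg_zero] at this
      linarith
  have h8 := hmono (a := 0) (b := s₀ / 2) ⟨le_rfl, hs₀'⟩ ⟨by linarith, by linarith⟩ (by linarith)
  have h9 := hmax (hmem (s₀ / 2) ⟨by linarith, by linarith⟩)
  simp at h8 h9
  linarith

/-- At a maximum over a domain with boundary, a vanishing normal derivative forces the whole
gradient to vanish, and then the Hessian is nonpositive in every direction, because both `e` and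
`-e` cannot point outwards. -/
lemma derivative_tests_of_isMaxOn (hW : IsOpen W) (hsm : HasSmoothBoundary W)
    (hf : ContDiffOn ℝ 2 f (closure W)) (hx : x ∈ closure W) (hmax : IsMaxOn f (closure W) x)
    (hneu : ∀ n, IsOutwardUnitNormal W x n → inner ℝ (gradientWithin f (closure W) x) n = 0) :
    gradientWithin f (closure W) x = 0 ∧
      ∀ e, inner ℝ e (fderivWithin ℝ (gradientWithin f (closure W)) (closure W) x e) ≤ 0 := by
  have hS := hsm.uniqueDiffOn hW
  have hd := (hf.differentiableOn (by simp)) x hx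
  by_cases hxW : x ∈ W
  · have hadm : ∀ e : Plane, ∀ᶠ s in 𝓝[>] (0 : ℝ), x + s • e ∈ W := by
      intro e
      have h2 : Tendsto (fun s : ℝ => x + s • e) (𝓝[>] 0) (𝓝 x) := by
        have : Continuous fun s : ℝ => x + s • e := by fun_prop
        simpa using (this.tendsto 0).mono_left nhdsWithin_le_nhds
      exact h2 (hW.mem_nhds hxW)
    have hg : gradientWithin f (closure W) x = 0 := by
      have := inner_gradientWithin_nonpos_of_isMaxOn hd hmax
        (hadm (gradientWithin f (closure W) x))
      exact real_inner_self_nonpos.1 this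
    exact ⟨hg, fun e => inner_hessian_nonpos_of_isMaxOn hW hS hf hx hmax hg (hadm e)⟩
  · have hxf : x ∈ frontier W := by rw [hW.frontier_eq]; exact ⟨hx, hxW⟩
    obtain ⟨φ, hφ⟩ := hsm x hxf
    have hφ0 := hφ.eq_zero hW hxf
    have hadm : ∀ e : Plane, inner ℝ (∇ φ x) e < 0 → ∀ᶠ s in 𝓝[>] (0 : ℝ), x + s • e ∈ W :=
      fun e he => hφ.eventually_add_smul_mem hφ0 he
    set v := ∇ φ x
    set g := gradientWithin f (closure W) x with hgdef
    have hv : 0 < inner ℝ v v := real_inner_self_pos.2 hφ.gradient_ne_zero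
    have hgn : inner ℝ g v = 0 := by
      have h1 := hneu _ (hφ.isOutwardUnitNormal hxf)
      rw [inner_smul_right] at h1
      rcases mul_eq_zero.1 h1 with h2 | h2
      · exact absurd h2 (inv_ne_zero (norm_ne_zero_iff.2 hφ.gradient_ne_zero))
      · exact h2
    have hg : g = 0 := by
      have h1 := inner_gradientWithin_nonpos_of_isMaxOn hd hmax
        (hadm (g - v) (by rw [inner_sub_right, real_inner_comm, hgn]; linarith))
      rw [← hgdef, inner_sub_right, hgn, sub_zero] at h1
      exact real_inner_self_nonpos.1 h1
    refine ⟨hg, fun e => ?_⟩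
    set H := fderivWithin ℝ (gradientWithin f (closure W)) (closure W) x
    have key : ∀ e, inner ℝ v e < 0 → inner ℝ e (H e) ≤ 0 := fun e he =>
      inner_hessian_nonpos_of_isMaxOn hW hS hf hx hmax hg (hadm e he)
    rcases lt_trichotomy (inner ℝ v e) 0 with h1 | h1 | h1
    · exact key e h1
    · have hc : Continuous fun t : ℝ => inner ℝ (e - t • v) (H (e - t • v)) := by fun_prop
      have h2 := (hc.tendsto 0).mono_left (nhdsWithin_le_nhds (s := Ioi 0))
      simp only [zero_smul, sub_zero] at h2
      refine le_of_tendsto h2 ?_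
      filter_upwards [self_mem_nhdsWithin] with t ht
      apply key
      rw [inner_sub_right, inner_smul_right, h1]
      have : (0 : ℝ) < t := ht
      nlinarith
    · have := key (-e) (by rw [inner_neg_right]; linarith)
      simpa using this

end DerivativeTests

/-! ### The comparison principle -/

/-- The right-hand side of the equation in nondivergence form, with derivatives relative to `S`, so
that it makes sense up to the boundary. -/
noncomputable def pdeOp (S : Set Plane) (q : Plane → Plane) (c : Plane → ℝ) (ε : ℝ)
    (f : Plane → ℝ) (x : Plane) : ℝ :=
  curvOp ε (gradientWithin f S x - q x)
      (fderivWithin ℝ (gradientWithin f S) S x - fderiv ℝ q x) +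
    c x * regNorm ε (gradientWithin f S x - q x)

lemma gradientWithin_sub {S : Set Plane} (hS : UniqueDiffOn ℝ S) {f g : Plane → ℝ} {x : Plane}
    (hx : x ∈ S) (hf : DifferentiableWithinAt ℝ f S x) (hg : DifferentiableWithinAt ℝ g S x) :
    gradientWithin (fun y => f y - g y) S x = gradientWithin f S x - gradientWithin g S x := by
  rw [gradientWithin, gradientWithin, gradientWithin, ← map_sub]
  congr 1
  exact fderivWithin_fun_sub (hS x hx) hf hg

/-- The comparison principle for the Neumann problem. The derivative tests hold up to
the boundary, so that no perturbation of the boundary condition is needed. -/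
theorem comparison {W : Set Plane} {q : Plane → Plane} {c : Plane → ℝ} {ε T : ℝ} (hε : 0 < ε)
    (hW : IsOpen W) (hsm : HasSmoothBoundary W) (hbdd : Bornology.IsBounded W)
    {f g : Plane → ℝ → ℝ} {df dg : Plane → ℝ → ℝ}
    (hfc : ContinuousOn (fun z : Plane × ℝ => f z.1 z.2) (closure W ×ˢ Icc 0 T))
    (hgc : ContinuousOn (fun z : Plane × ℝ => g z.1 z.2) (closure W ×ˢ Icc 0 T))
    (hf2 : ∀ t ∈ Ioc 0 T, ContDiffOn ℝ 2 (fun x => f x t) (closure W))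
    (hg2 : ∀ t ∈ Ioc 0 T, ContDiffOn ℝ 2 (fun x => g x t) (closure W))
    (hneu : ∀ t ∈ Ioc 0 T, ∀ x n, IsOutwardUnitNormal W x n →
      inner ℝ (gradientWithin (fun x => f x t) (closure W) x) n =
        inner ℝ (gradientWithin (fun x => g x t) (closure W) x) n)
    (hdf : ∀ x ∈ closure W, ∀ t ∈ Ioc 0 T, HasDerivWithinAt (f x) (df x t) (Icc 0 T) t)
    (hdg : ∀ x ∈ closure W, ∀ t ∈ Ioc 0 T, HasDerivWithinAt (g x) (dg x t) (Icc 0 T) t)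
    (hsub : ∀ x ∈ closure W, ∀ t ∈ Ioc 0 T, df x t ≤ pdeOp (closure W) q c ε (fun x => f x t) x)
    (hsup : ∀ x ∈ closure W, ∀ t ∈ Ioc 0 T, pdeOp (closure W) q c ε (fun x => g x t) x ≤ dg x t)
    (h0 : ∀ x ∈ closure W, f x 0 ≤ g x 0) :
    ∀ x ∈ closure W, ∀ t ∈ Icc 0 T, f x t ≤ g x t := by
  intro x hx t ht
  have hS := hsm.uniqueDiffOn hW
  by_contra hcon
  push Not at hcon
  -- A small multiple of time is subtracted to make the differential inequality strict.
  set η := (f x t - g x t) / (2 * (t + 1)) with hη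
  have hη0 : 0 < η := div_pos (by linarith) (by linarith [ht.1])
  have hηt : η * t < f x t - g x t := by
    have h1 : η * (2 * (t + 1)) = f x t - g x t := by
      rw [hη]; exact div_mul_cancel₀ _ (by linarith [ht.1])
    nlinarith [ht.1]
  have hcpt : IsCompact (closure W ×ˢ Icc 0 T) := hbdd.isCompact_closure.prod isCompact_Icc
  have hcont : ContinuousOn (fun z : Plane × ℝ => f z.1 z.2 - g z.1 z.2 - η * z.2)
      (closure W ×ˢ Icc 0 T) := (hfc.sub hgc).sub (by fun_prop)
  obtain ⟨⟨x₀, t₀⟩, ⟨hx₀, ht₀⟩, hmax⟩ := hcpt.exists_isMaxOn ⟨(x, t), hx, ht⟩ hcont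
  simp only at hx₀ ht₀
  have hpos : 0 < f x₀ t₀ - g x₀ t₀ - η * t₀ := by
    have h1 : f x t - g x t - η * t ≤ f x₀ t₀ - g x₀ t₀ - η * t₀ := hmax (mk_mem_prod hx ht)
    linarith
  have ht₀' : 0 < t₀ := by
    rcases ht₀.1.eq_or_lt with h | h
    · rw [← h] at hpos
      linarith [h0 x₀ hx₀]
    · exact h
  have ht₁ : t₀ ∈ Ioc 0 T := ⟨ht₀', ht₀.2⟩
  -- In time, the maximum gives an inequality for the one-sided derivative.
  have htime : η ≤ df x₀ t₀ - dg x₀ t₀ := by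
    have h1 := ((hdf x₀ hx₀ t₀ ht₁).sub (hdg x₀ hx₀ t₀ ht₁)).sub
      ((hasDerivWithinAt_id t₀ (Icc 0 T)).const_mul η)
    have h2 : IsMaxOn (fun s => f x₀ s - g x₀ s - η * s) (Icc 0 T) t₀ := fun s hs =>
      hmax (mk_mem_prod hx₀ hs)
    have h3 : (0 - t₀ : ℝ) ∈ posTangentConeAt (Icc 0 T) t₀ :=
      sub_mem_posTangentConeAt_of_segment_subset ((convex_Icc 0 T).segment_subset ht₀
        ⟨le_rfl, ht₀.1.trans ht₀.2⟩)
    have h4 := h2.localize.hasFDerivWithinAt_nonpos h1.hasFDerivWithinAt h3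
    simp at h4
    nlinarith
  have hd1 := ((hf2 t₀ ht₁).differentiableOn (by simp))
  have hd2 := ((hg2 t₀ ht₁).differentiableOn (by simp))
  have hmaxx : IsMaxOn (fun y => f y t₀ - g y t₀) (closure W) x₀ := by
    intro y hy
    have : f y t₀ - g y t₀ - η * t₀ ≤ f x₀ t₀ - g x₀ t₀ - η * t₀ := hmax (mk_mem_prod hy ht₀)
    simp only [mem_ofPred_eq]
    linarith
  obtain ⟨hgr, hhess⟩ := derivative_tests_of_isMaxOn hW hsm ((hf2 t₀ ht₁).sub (hg2 t₀ ht₁)) hx₀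
    hmaxx (fun n hn => by
      rw [gradientWithin_sub hS hx₀ (hd1 x₀ hx₀) (hd2 x₀ hx₀), inner_sub_left,
        hneu t₀ ht₁ x₀ n hn, sub_self])
  have hgr' := hgr
  rw [gradientWithin_sub hS hx₀ (hd1 x₀ hx₀) (hd2 x₀ hx₀), sub_eq_zero] at hgr'
  have hH : fderivWithin ℝ (gradientWithin (fun y => f y t₀ - g y t₀) (closure W)) (closure W) x₀ =
      fderivWithin ℝ (gradientWithin (fun y => f y t₀) (closure W)) (closure W) x₀ -
        fderivWithin ℝ (gradientWithin (fun y => g y t₀) (closure W)) (closure W) x₀ := by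
    rw [← fderivWithin_sub (hS x₀ hx₀)
      (((contDiffOn_gradientWithin hS (hf2 t₀ ht₁) (k := 1) (by norm_num)).differentiableOn
        (by simp)) x₀ hx₀)
      (((contDiffOn_gradientWithin hS (hg2 t₀ ht₁) (k := 1) (by norm_num)).differentiableOn
        (by simp)) x₀ hx₀)]
    exact fderivWithin_congr (fun y hy => gradientWithin_sub hS hy (hd1 y hy) (hd2 y hy))
      (gradientWithin_sub hS hx₀ (hd1 x₀ hx₀) (hd2 x₀ hx₀))
  have hop : pdeOp (closure W) q c ε (fun x => f x t₀) x₀ ≤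
      pdeOp (closure W) q c ε (fun x => g x t₀) x₀ := by
    unfold pdeOp
    rw [hgr']
    gcongr
    refine curvOp_mono (by positivity) fun v => ?_
    have := hhess v
    rw [hH] at this
    simp only [sub_apply, inner_sub_right] at this ⊢
    linarith
  have e1 := hsub x₀ hx₀ t₀ ht₁
  have e2 := hsup x₀ hx₀ t₀ ht₁
  linarith

/-! ### The interior gradient estimate -/

/-- The necessary second-order condition at an interior maximum of a function of one variable. -/
lemma second_derivative_test {h h' : ℝ → ℝ} {d : ℝ} (hmax : IsLocalMax h 0)
    (h1 : ∀ᶠ r in 𝓝 (0 : ℝ), HasDerivAt h (h' r) r) (h2 : HasDerivAt h' d 0) :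
    h' 0 = 0 ∧ d ≤ 0 := by
  have h0 : h' 0 = 0 := hmax.hasDerivAt_eq_zero h1.self_of_nhds
  refine ⟨h0, not_lt.1 fun hd => ?_⟩
  have e1 : deriv h =ᶠ[𝓝 0] h' := h1.mono fun r hr => hr.deriv
  have e2 : deriv (deriv h) 0 = d := by rw [e1.deriv_eq, h2.deriv]
  have hmin : IsLocalMin h 0 := isLocalMin_of_deriv_deriv_pos (by rw [e2]; exact hd)
    (by rw [e1.self_of_nhds, h0]) h1.self_of_nhds.continuousAt
  have hconst : h =ᶠ[𝓝 0] fun _ => h 0 := by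
    filter_upwards [hmax, hmin] with r hr1 hr2
    exact le_antisymm hr1 hr2
  have e3 : deriv h =ᶠ[𝓝 0] fun _ => 0 := by
    filter_upwards [hconst.eventually_nhds] with r hr
    rw [EventuallyEq.deriv_eq hr, deriv_const]
  rw [e3.deriv_eq, deriv_const] at e2
  exact hd.ne e2

section Lines

variable {E F : Type*} [NormedAddCommGroup E] [NormedSpace ℝ E] [NormedAddCommGroup F]
  [NormedSpace ℝ F] {z v : E}

lemma hasDerivAt_add_smul (z v : E) (r : ℝ) : HasDerivAt (fun r : ℝ => z + r • v) v r := by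
  simpa using ((hasDerivAt_id r).smul_const v).const_add z

lemma tendsto_add_smul (z v : E) : Tendsto (fun r : ℝ => z + r • v) (𝓝 0) (𝓝 z) := by
  have : Continuous fun r : ℝ => z + r • v := by fun_prop
  simpa using this.tendsto 0

lemma hasDerivAt_comp_line {f : E → F} (hf : DifferentiableAt ℝ f z) :
    HasDerivAt (fun r : ℝ => f (z + r • v)) (fderiv ℝ f z v) 0 := by
  have h1 : HasFDerivAt f (fderiv ℝ f z) (z + (0 : ℝ) • v) := by simpa using hf.hasFDerivAt
  exact h1.comp_hasDerivAt (0 : ℝ) (hasDerivAt_add_smul z v 0)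

lemma eventually_differentiableAt {f : E → F} {n : WithTop ℕ∞} (hf : ContDiffAt ℝ n f z)
    (hn : 1 ≤ n) : ∀ᶠ y in 𝓝 z, DifferentiableAt ℝ f y :=
  ((hf.of_le hn).eventually (by simp)).mono fun _ hy => hy.differentiableAt (by simp)

lemma eventually_hasDerivAt_line {f : E → F} {n : WithTop ℕ∞} (hf : ContDiffAt ℝ n f z)
    (hn : 1 ≤ n) : ∀ᶠ r in 𝓝 (0 : ℝ),
      HasDerivAt (fun r : ℝ => f (z + r • v)) (fderiv ℝ f (z + r • v) v) r := by
  filter_upwards [(tendsto_add_smul z v).eventually (eventually_differentiableAt hf hn)] with r hr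
  exact hr.hasFDerivAt.comp_hasDerivAt r (hasDerivAt_add_smul z v r)

lemma contDiffAt_fderiv_apply {f : E → F} {n k : WithTop ℕ∞} (hf : ContDiffAt ℝ n f z)
    (hk : k + 1 ≤ n) (v : E) : ContDiffAt ℝ k (fun y => fderiv ℝ f y v) z :=
  (hf.fderiv_right hk).clm_apply contDiffAt_const

lemma fderiv_fderiv_apply {f : E → F} (hf : ContDiffAt ℝ 2 f z) (v w : E) :
    fderiv ℝ (fun y => fderiv ℝ f y v) z w = fderiv ℝ (fderiv ℝ f) z w v := by
  have h : DifferentiableAt ℝ (fderiv ℝ f) z :=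
    (hf.fderiv_right (m := 1) (by norm_num)).differentiableAt (by simp)
  rw [fderiv_clm_apply h (differentiableAt_const v)]
  simp

lemma fderiv_fderiv_comm {f : E → F} (hf : ContDiffAt ℝ 2 f z) (v w : E) :
    fderiv ℝ (fun y => fderiv ℝ f y v) z w = fderiv ℝ (fun y => fderiv ℝ f y w) z v := by
  rw [fderiv_fderiv_apply hf, fderiv_fderiv_apply hf]
  exact (hf.isSymmSndFDerivAt (by simp)) w v

end Lines

/-- The multiplier: a concave paraboloid that equals `1` on the circle of radius `R` about `z`. -/
noncomputable def multiplier (z : Plane) (k R : ℝ) (x : Plane) : ℝ := 1 + k * (R ^ 2 - ‖x - z‖ ^ 2)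

lemma hasDerivAt_multiplier_line (z : Plane) (k R : ℝ) (x v : Plane) (r : ℝ) :
    HasDerivAt (fun r : ℝ => multiplier z k R (x + r • v))
      (-2 * k * inner ℝ (x + r • v - z) v) r := by
  have h := ((((hasDerivAt_add_smul x v r).sub_const z).norm_sq).const_sub (R ^ 2)).const_mul k
    |>.const_add 1
  refine h.congr_deriv ?_
  ring

lemma hasDerivAt_deriv_multiplier_line (z : Plane) (k : ℝ) (x : Plane) {v : Plane} (hv : ‖v‖ = 1)
    (r : ℝ) : HasDerivAt (fun r : ℝ => -2 * k * inner ℝ (x + r • v - z) v) (-2 * k) r := by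
  have h := (((hasDerivAt_add_smul x v r).sub_const z).inner ℝ (hasDerivAt_const r v)).const_mul
    (-2 * k)
  refine h.congr_deriv ?_
  rw [inner_zero_right, real_inner_self_eq_norm_sq, hv]
  ring

/-- The first and second order conditions at a maximum of `ρ² (ε² + P² + Q²)` along a line, at a
point where `Q` vanishes. -/
lemma max_conditions {P Q : Plane × ℝ → ℝ} {x₁ z v : Plane} {t₁ k R ε : ℝ}
    (hP : ContDiffAt ℝ 2 P (x₁, t₁)) (hQ : ContDiffAt ℝ 2 Q (x₁, t₁)) (hv : ‖v‖ = 1)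
    (hQ0 : Q (x₁, t₁) = 0) (hρ : 0 < multiplier z k R x₁)
    (hmax : ∀ᶠ x in 𝓝 x₁, multiplier z k R x ^ 2 * (ε ^ 2 + P (x, t₁) ^ 2 + Q (x, t₁) ^ 2) ≤
      multiplier z k R x₁ ^ 2 * (ε ^ 2 + P (x₁, t₁) ^ 2 + Q (x₁, t₁) ^ 2)) :
    multiplier z k R x₁ * (P (x₁, t₁) * fderiv ℝ P (x₁, t₁) (v, 0)) +
        (-2 * k * inner ℝ (x₁ - z) v) * (ε ^ 2 + P (x₁, t₁) ^ 2) = 0 ∧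
      ((-2 * k * inner ℝ (x₁ - z) v) ^ 2 - 2 * k * multiplier z k R x₁) *
            (ε ^ 2 + P (x₁, t₁) ^ 2) +
          4 * multiplier z k R x₁ * (-2 * k * inner ℝ (x₁ - z) v) *
            (P (x₁, t₁) * fderiv ℝ P (x₁, t₁) (v, 0)) +
          multiplier z k R x₁ ^ 2 * (fderiv ℝ P (x₁, t₁) (v, 0) ^ 2 +
            fderiv ℝ Q (x₁, t₁) (v, 0) ^ 2 +
            P (x₁, t₁) * fderiv ℝ (fun y => fderiv ℝ P y (v, 0)) (x₁, t₁) (v, 0)) ≤ 0 := by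
  have hline : ∀ r : ℝ, (x₁, t₁) + r • ((v, 0) : Plane × ℝ) = (x₁ + r • v, t₁) := fun r => by simp
  have hP1 := eventually_hasDerivAt_line (v := ((v, 0) : Plane × ℝ)) hP (by norm_num)
  have hQ1 := eventually_hasDerivAt_line (v := ((v, 0) : Plane × ℝ)) hQ (by norm_num)
  have hP2 := hasDerivAt_comp_line (v := ((v, 0) : Plane × ℝ))
    ((contDiffAt_fderiv_apply hP (k := 1) (by norm_num) (v, 0)).differentiableAt (by simp))
  have hQ2 := hasDerivAt_comp_line (v := ((v, 0) : Plane × ℝ))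
    ((contDiffAt_fderiv_apply hQ (k := 1) (by norm_num) (v, 0)).differentiableAt (by simp))
  simp only [hline] at hP1 hQ1 hP2 hQ2
  have hρ1 := hasDerivAt_multiplier_line z k R x₁ v
  have hρ2 := hasDerivAt_deriv_multiplier_line z k x₁ hv 0
  have hlm : IsLocalMax (fun r : ℝ => multiplier z k R (x₁ + r • v) ^ 2 *
      (ε ^ 2 + P (x₁ + r • v, t₁) ^ 2 + Q (x₁ + r • v, t₁) ^ 2)) 0 := by
    have := (tendsto_add_smul x₁ v).eventually hmax
    simpa [IsLocalMax, IsMaxFilter] using this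
  have h1 : ∀ᶠ r in 𝓝 (0 : ℝ), HasDerivAt (fun r : ℝ => multiplier z k R (x₁ + r • v) ^ 2 *
      (ε ^ 2 + P (x₁ + r • v, t₁) ^ 2 + Q (x₁ + r • v, t₁) ^ 2))
      (2 * multiplier z k R (x₁ + r • v) * (-2 * k * inner ℝ (x₁ + r • v - z) v) *
        (ε ^ 2 + P (x₁ + r • v, t₁) ^ 2 + Q (x₁ + r • v, t₁) ^ 2) +
        multiplier z k R (x₁ + r • v) ^ 2 *
          (2 * P (x₁ + r • v, t₁) * fderiv ℝ P (x₁ + r • v, t₁) (v, 0) +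
            2 * Q (x₁ + r • v, t₁) * fderiv ℝ Q (x₁ + r • v, t₁) (v, 0))) r := by
    filter_upwards [hP1, hQ1] with r hPr hQr
    refine (((hρ1 r).pow 2).mul (((hPr.pow 2).const_add (ε ^ 2)).add (hQr.pow 2))).congr_deriv ?_
    simp
  have hP0 := hP1.self_of_nhds
  have hQ0' := hQ1.self_of_nhds
  have h2 := ((((hρ1 0).const_mul 2).mul hρ2).mul
      (((hP0.pow 2).const_add (ε ^ 2)).add (hQ0'.pow 2))).add
    (((hρ1 0).pow 2).mul (((hP0.const_mul 2).mul hP2).add ((hQ0'.const_mul 2).mul hQ2)))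
  obtain ⟨e1, e2⟩ := second_derivative_test hlm h1 h2
  simp only [zero_smul, add_zero, hQ0] at e1 e2
  constructor
  · have h3 : 2 * multiplier z k R x₁ * (multiplier z k R x₁ *
        (P (x₁, t₁) * fderiv ℝ P (x₁, t₁) (v, 0)) +
        (-2 * k * inner ℝ (x₁ - z) v) * (ε ^ 2 + P (x₁, t₁) ^ 2)) = 0 := by
      linear_combination e1
    exact (mul_eq_zero.1 h3).resolve_left (by positivity)
  · simp [hQ0] at e2
    nlinarith [e2]

/-- The algebraic core of the gradient estimate, at a point where the gradient is `s` times the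
first vector of the frame. The terms with `a²` and `b²` that come from the Hessian compensate those
produced by the gradient `(re, rf)` of the multiplier. -/
lemma bernstein_algebra {ε s G w ρ k re rf a b d Te Tf Pt c ce : ℝ} (hs : 0 < s) (hρ : 0 < ρ)
    (hG : G = ε ^ 2 + s ^ 2) (hw : 0 < w) (hwG : w ^ 2 = G)
    (e1 : ρ * (s * a) + re * G = 0) (f1 : ρ * (s * b) + rf * G = 0)
    (e2 : (re ^ 2 - 2 * k * ρ) * G + 4 * ρ * re * (s * a) + ρ ^ 2 * (a ^ 2 + b ^ 2 + s * Te) ≤ 0)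
    (f2 : (rf ^ 2 - 2 * k * ρ) * G + 4 * ρ * rf * (s * b) + ρ ^ 2 * (b ^ 2 + d ^ 2 + s * Tf) ≤ 0)
    (hPt : 0 ≤ Pt)
    (hpde : Pt = ((ε ^ 2 * Te - 2 * s * b ^ 2 + 2 * s * a * d + G * Tf) * G -
      (ε ^ 2 * a + G * d) * (2 * s * a)) / G ^ 2 + ce * w + c * (s * a / w)) :
    ρ * d ^ 2 ≤ 2 * k * (G + ε ^ 2) + ρ * (s * ce * w) - c * s * re * w := by
  have hG0 : 0 < G := by rw [hG]; positivity
  have hsG : s ^ 2 ≤ G := by rw [hG]; linarith [sq_nonneg ε]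
  have hsa : ρ * (s * a) = -(re * G) := by linarith
  have hsb : ρ * (s * b) = -(rf * G) := by linarith
  have ha2 : re ^ 2 * G ≤ ρ ^ 2 * a ^ 2 := by
    have h1 : ρ ^ 2 * a ^ 2 * s ^ 2 = re ^ 2 * G ^ 2 := by
      linear_combination (ρ * (s * a) - re * G) * hsa
    have h2 : re ^ 2 * G * s ^ 2 ≤ ρ ^ 2 * a ^ 2 * s ^ 2 := by
      rw [h1, sq G, ← mul_assoc]
      exact mul_le_mul_of_nonneg_left hsG (by positivity)
    exact le_of_mul_le_mul_right h2 (by positivity)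
  have hb2 : rf ^ 2 * G ≤ ρ ^ 2 * b ^ 2 := by
    have h1 : ρ ^ 2 * b ^ 2 * s ^ 2 = rf ^ 2 * G ^ 2 := by
      linear_combination (ρ * (s * b) - rf * G) * hsb
    have h2 : rf ^ 2 * G * s ^ 2 ≤ ρ ^ 2 * b ^ 2 * s ^ 2 := by
      rw [h1, sq G, ← mul_assoc]
      exact mul_le_mul_of_nonneg_left hsG (by positivity)
    exact le_of_mul_le_mul_right h2 (by positivity)
  have hexp : ρ ^ 2 * s * Pt * G = ε ^ 2 * (ρ ^ 2 * (s * Te)) + G * (ρ ^ 2 * (s * Tf))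
      - 2 * rf ^ 2 * G ^ 2 - 2 * ε ^ 2 * re ^ 2 * G + ρ ^ 2 * (s * ce * w) * G
      - ρ * c * s * re * G * w := by
    have h1 : ρ ^ 2 * s * Pt * G = ε ^ 2 * (ρ ^ 2 * (s * Te)) + G * (ρ ^ 2 * (s * Tf))
        - 2 * (ρ * (s * b)) ^ 2 - 2 * ε ^ 2 * (ρ * (s * a)) ^ 2 / G + ρ ^ 2 * (s * ce * w) * G
        + ρ * c * s * (ρ * (s * a)) * G / w := by
      rw [hpde]
      field_simp
      ring
    rw [h1, hsa, hsb, ← hwG]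
    field_simp
    ring
  have hlhs : 0 ≤ ρ ^ 2 * s * Pt * G := by positivity
  have key : ρ * G * (ρ * d ^ 2) ≤
      ρ * G * (2 * k * (G + ε ^ 2) + ρ * (s * ce * w) - c * s * re * w) := by
    have m1 := mul_le_mul_of_nonneg_left e2 (sq_nonneg ε)
    have m2 := mul_le_mul_of_nonneg_left f2 hG0.le
    have m3 := mul_le_mul_of_nonneg_left ha2 (sq_nonneg ε)
    have m4 := mul_le_mul_of_nonneg_left hb2 hG0.le
    have m5 : 0 ≤ ε ^ 2 * (ρ ^ 2 * b ^ 2) := by positivity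
    have e1' : 4 * ρ * re * (s * a) = -4 * re ^ 2 * G := by linear_combination 4 * re * hsa
    have f1' : 4 * ρ * rf * (s * b) = -4 * rf ^ 2 * G := by linear_combination 4 * rf * hsb
    rw [e1'] at m1
    rw [f1'] at m2
    rw [hexp] at hlhs
    nlinarith
  exact le_of_mul_le_mul_left key (by positivity)

/-- The field `D(u - θ)` as a function of space and time, defined through the joint derivative of
`u`. -/
noncomputable def jointGrad (u : Plane × ℝ → ℝ) (q : Plane → Plane) (z : Plane × ℝ) : Plane :=
  (InnerProductSpace.toDual ℝ Plane).symm
    ((fderiv ℝ u z).comp (ContinuousLinearMap.inl ℝ Plane ℝ)) - q z.1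

lemma inner_jointGrad (u : Plane × ℝ → ℝ) (q : Plane → Plane) (v : Plane) (z : Plane × ℝ) :
    inner ℝ v (jointGrad u q z) = fderiv ℝ u z (v, 0) - inner ℝ v (q z.1) := by
  rw [jointGrad, inner_sub_right, real_inner_comm, InnerProductSpace.toDual_symm_apply]
  simp

lemma contDiffAt_jointGrad {u : Plane × ℝ → ℝ} {q : Plane → Plane} {z : Plane × ℝ}
    (hu : ContDiffAt ℝ ∞ u z) (hq : ContDiffAt ℝ ∞ q z.1) :
    ContDiffAt ℝ ∞ (jointGrad u q) z := by
  have h1 : ContDiffAt ℝ ∞ (fderiv ℝ u) z := hu.fderiv_right (by simp)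
  have h2 : ContDiffAt ℝ ∞
      (fun z => (fderiv ℝ u z).comp (ContinuousLinearMap.inl ℝ Plane ℝ)) z :=
    h1.clm_comp contDiffAt_const
  have h3 := (InnerProductSpace.toDual ℝ Plane).symm.toContinuousLinearEquiv.contDiff.contDiffAt
    (n := ∞) (x := (fderiv ℝ u z).comp (ContinuousLinearMap.inl ℝ Plane ℝ))
  exact (h3.comp z h2).sub (hq.comp z contDiffAt_fst)

lemma fderiv_inner_jointGrad {u : Plane × ℝ → ℝ} {q : Plane → Plane} {z : Plane × ℝ} {v : Plane}
    (hu : DifferentiableAt ℝ (fun y => fderiv ℝ u y (v, 0)) z) (hq : DifferentiableAt ℝ q z.1)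
    (w : Plane × ℝ) :
    fderiv ℝ (fun y => inner ℝ v (jointGrad u q y)) z w =
      fderiv ℝ (fun y => fderiv ℝ u y (v, 0)) z w - inner ℝ v (fderiv ℝ q z.1 w.1) := by
  have h2 : HasFDerivAt (fun y : Plane × ℝ => inner ℝ v (q y.1)) _ z :=
    (innerSL ℝ v).hasFDerivAt.comp z (hq.hasFDerivAt.comp z hasFDerivAt_fst)
  have h3 : (fun y => inner ℝ v (jointGrad u q y)) =
      (fun y => fderiv ℝ u y (v, 0)) - fun y => inner ℝ v (q y.1) :=
    funext fun y => inner_jointGrad u q v y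
  rw [h3, (hu.hasFDerivAt.sub h2).fderiv]
  simp

/-- Bernstein's estimate at an interior maximum of the product of a multiplier and the regularized
length of `D(u - θ)`. Here `e` is the direction of `D(u - θ)`, `a` is the second derivative in the
direction `e` and `d` the one in the orthogonal direction. The maximum in time is only one-sided. -/
theorem bernstein_interior {u : Plane × ℝ → ℝ} {q : Plane → Plane} {c : Plane → ℝ} {ε : ℝ}
    (hε : 0 < ε) {x₁ z : Plane} {t₁ k R : ℝ} (hu : ContDiffAt ℝ ∞ u (x₁, t₁))
    (hq : ContDiffAt ℝ ∞ q x₁)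
    (hsym : ∀ᶠ x in 𝓝 x₁, ∀ g h, inner ℝ g (fderiv ℝ q x h) = inner ℝ h (fderiv ℝ q x g))
    (hc : DifferentiableAt ℝ c x₁)
    (hpde : ∀ᶠ y in 𝓝 (x₁, t₁), fderiv ℝ u y (0, 1) = curvOp ε (jointGrad u q y)
      ((fderiv ℝ (jointGrad u q) y).comp (ContinuousLinearMap.inl ℝ Plane ℝ)) +
        c y.1 * regNorm ε (jointGrad u q y))
    (hρ : 0 < multiplier z k R x₁)
    (hmaxx : ∀ᶠ x in 𝓝 x₁, multiplier z k R x * regNorm ε (jointGrad u q (x, t₁)) ≤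
      multiplier z k R x₁ * regNorm ε (jointGrad u q (x₁, t₁)))
    (hmaxt : ∀ᶠ t in 𝓝[<] t₁,
      regNorm ε (jointGrad u q (x₁, t)) ≤ regNorm ε (jointGrad u q (x₁, t₁)))
    (hp : jointGrad u q (x₁, t₁) ≠ 0) :
    ∃ (e : Plane) (a d : ℝ), ‖e‖ = 1 ∧
      multiplier z k R x₁ * (‖jointGrad u q (x₁, t₁)‖ * a) +
        (-2 * k * inner ℝ (x₁ - z) e) * regNorm ε (jointGrad u q (x₁, t₁)) ^ 2 = 0 ∧
      fderiv ℝ u (x₁, t₁) (0, 1) = ε ^ 2 * a / regNorm ε (jointGrad u q (x₁, t₁)) ^ 2 + d +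
        c x₁ * regNorm ε (jointGrad u q (x₁, t₁)) ∧
      multiplier z k R x₁ * d ^ 2 ≤
        2 * k * (regNorm ε (jointGrad u q (x₁, t₁)) ^ 2 + ε ^ 2) +
          multiplier z k R x₁ * (‖jointGrad u q (x₁, t₁)‖ * inner ℝ (∇ c x₁) e *
            regNorm ε (jointGrad u q (x₁, t₁))) -
          c x₁ * ‖jointGrad u q (x₁, t₁)‖ * (-2 * k * inner ℝ (x₁ - z) e) *
            regNorm ε (jointGrad u q (x₁, t₁)) := by
  set p := jointGrad u q with hpdef
  set z₁ : Plane × ℝ := (x₁, t₁) with hz₁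
  obtain ⟨b, hb⟩ := exists_frame hp
  set s := ‖p z₁‖ with hs
  have hs0 : 0 < s := norm_pos_iff.2 hp
  have hpb : p z₁ = s • b 0 := by rw [hb, smul_smul, mul_inv_cancel₀ hs0.ne', one_smul]
  set P : Plane × ℝ → ℝ := fun y => inner ℝ (b 0) (p y) with hP
  set Q : Plane × ℝ → ℝ := fun y => inner ℝ (b 1) (p y) with hQ
  have hP0 : P z₁ = s := by simp [hP, hpb, inner_smul_right]
  have hQ0 : Q z₁ = 0 := by simp [hQ, hpb, inner_smul_right]
  have hsm : ContDiffAt ℝ ∞ p z₁ := contDiffAt_jointGrad hu hq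
  have hPs : ContDiffAt ℝ ∞ P z₁ := contDiffAt_const.inner ℝ hsm
  have hQs : ContDiffAt ℝ ∞ Q z₁ := contDiffAt_const.inner ℝ hsm
  have hnorm : ∀ y, regNorm ε (p y) ^ 2 = ε ^ 2 + P y ^ 2 + Q y ^ 2 := fun y => by
    rw [regNorm_sq, norm_sq_frame b, add_assoc]
  have hG : regNorm ε (p z₁) ^ 2 = ε ^ 2 + s ^ 2 := by rw [hnorm, hP0, hQ0]; ring
  -- The field is curl-free near the point.
  have hfst : Tendsto (fun y : Plane × ℝ => y.1) (𝓝 z₁) (𝓝 x₁) := continuous_fst.tendsto z₁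
  have hcurl : ∀ᶠ y in 𝓝 z₁, fderiv ℝ P y (b 1, 0) = fderiv ℝ Q y (b 0, 0) := by
    have hu3 : ∀ᶠ y in 𝓝 z₁, ContDiffAt ℝ 2 u y := (hu.of_le (by norm_cast)).eventually (by simp)
    have hu4 := hu.fderiv_right (m := ∞) (by simp)
    have hd0 : ∀ v : Plane, ∀ᶠ y in 𝓝 z₁, DifferentiableAt ℝ (fun y => fderiv ℝ u y (v, 0)) y :=
      fun v => eventually_differentiableAt (hu4.clm_apply contDiffAt_const) (by norm_cast)
    have hq1 : ∀ᶠ y in 𝓝 z₁, DifferentiableAt ℝ q y.1 :=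
      hfst.eventually (eventually_differentiableAt hq (by norm_cast))
    filter_upwards [hu3, hd0 (b 0), hd0 (b 1), hq1, hfst.eventually hsym] with y h1 h2 h3 h4 h5
    rw [hP, hQ, hpdef, fderiv_inner_jointGrad h2 h4, fderiv_inner_jointGrad h3 h4,
      fderiv_fderiv_comm h1, h5]
  -- The equation near the point, in the frame.
  have hpd : ∀ᶠ y in 𝓝 z₁, DifferentiableAt ℝ p y :=
    eventually_differentiableAt hsm (by norm_cast)
  have hpde' : ∀ᶠ y in 𝓝 z₁, fderiv ℝ u y (0, 1) =
      ((ε ^ 2 + Q y ^ 2) * fderiv ℝ P y (b 0, 0) - P y * Q y * (2 * fderiv ℝ P y (b 1, 0)) +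
        (ε ^ 2 + P y ^ 2) * fderiv ℝ Q y (b 1, 0)) / (ε ^ 2 + P y ^ 2 + Q y ^ 2) +
        c y.1 * √(ε ^ 2 + P y ^ 2 + Q y ^ 2) := by
    filter_upwards [hpde, hcurl, hpd] with y h1 h2 h3
    have h4 : ∀ v w, fderiv ℝ (fun y => inner ℝ v (p y)) y w = inner ℝ v (fderiv ℝ p y w) := by
      intro v w
      have : HasFDerivAt (fun y => inner ℝ v (p y)) _ y :=
        (innerSL ℝ v).hasFDerivAt.comp y h3.hasFDerivAt
      rw [this.fderiv]
      simp
    have h5 : √(ε ^ 2 + P y ^ 2 + Q y ^ 2) = regNorm ε (p y) := by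
      rw [← hnorm, Real.sqrt_sq (regNorm_nonneg _ _)]
    rw [h1, curvOp_frame b (by positivity), ← regNorm_sq, h5, ← hnorm]
    simp only [ContinuousLinearMap.comp_apply, ContinuousLinearMap.inl_apply]
    rw [← h4, ← h4, ← h4, ← h4]
    have h6 : fderiv ℝ (fun y => inner ℝ (b 1) (p y)) y (b 0, 0) =
        fderiv ℝ (fun y => inner ℝ (b 0) (p y)) y (b 1, 0) := h2.symm
    simp only [hP, hQ, h6, two_mul]
  -- The conditions at the maximum.
  have hρc : Continuous (multiplier z k R) := by unfold multiplier; fun_prop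
  have hmax2 : ∀ᶠ x in 𝓝 x₁, multiplier z k R x ^ 2 * (ε ^ 2 + P (x, t₁) ^ 2 + Q (x, t₁) ^ 2) ≤
      multiplier z k R x₁ ^ 2 * (ε ^ 2 + P (x₁, t₁) ^ 2 + Q (x₁, t₁) ^ 2) := by
    filter_upwards [hmaxx, hρc.continuousAt.eventually_const_lt hρ] with x h1 h2
    rw [← hnorm, ← hnorm, ← mul_pow, ← mul_pow]
    exact pow_le_pow_left₀ (mul_nonneg h2.le (regNorm_nonneg _ _)) h1 2
  obtain ⟨e1, e2⟩ := max_conditions (hPs.of_le (by norm_cast)) (hQs.of_le (by norm_cast))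
    (b.norm_eq_one 0) hQ0 hρ hmax2
  obtain ⟨f1, f2⟩ := max_conditions (hPs.of_le (by norm_cast)) (hQs.of_le (by norm_cast))
    (b.norm_eq_one 1) hQ0 hρ hmax2
  have hPt : 0 ≤ fderiv ℝ P z₁ (0, 1) := by
    by_contra hcon
    have h1 := hasDerivAt_comp_line (v := ((0, -1) : Plane × ℝ)) (hPs.differentiableAt (by simp))
    have h2 := hasDerivAt_comp_line (v := ((0, -1) : Plane × ℝ)) (hQs.differentiableAt (by simp))
    have h3 := (((h1.pow 2).const_add (ε ^ 2)).add (h2.pow 2)).neg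
    have h4 : fderiv ℝ P z₁ (0, -1) = - fderiv ℝ P z₁ (0, 1) := by
      rw [← map_neg]; simp
    have h5 := eventually_lt_of_hasDerivWithinAt_neg h3.hasDerivWithinAt (by
      simp only [zero_smul, add_zero, hQ0, h4, hP0]
      have := not_le.1 hcon
      simp
      exact mul_neg_of_pos_of_neg (by positivity) this)
    have h6 : Tendsto (fun r : ℝ => t₁ - r) (𝓝[>] 0) (𝓝[<] t₁) := by
      refine tendsto_nhdsWithin_iff.2 ⟨?_, ?_⟩
      · have : Continuous fun r : ℝ => t₁ - r := by fun_prop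
        simpa using (this.tendsto 0).mono_left nhdsWithin_le_nhds
      · filter_upwards [self_mem_nhdsWithin] with r hr
        have : (0 : ℝ) < r := hr
        simpa using this
    obtain ⟨r, h7, h8⟩ := (h5.and (h6.eventually hmaxt)).exists
    have h9 := pow_le_pow_left₀ (regNorm_nonneg _ _) h8 2
    rw [hnorm, hnorm] at h9
    have h10 : z₁ + r • ((0, -1) : Plane × ℝ) = (x₁, t₁ - r) := by
      simp [hz₁, sub_eq_add_neg]
    simp only [Pi.neg_apply, Pi.add_apply, Pi.pow_apply, h10, zero_smul, add_zero] at h7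
    linarith
  -- The equation is differentiated in the direction of the field.
  set w := regNorm ε (p z₁) with hw
  have hw0 : 0 < w := regNorm_pos hε _
  have hdiff : fderiv ℝ P z₁ (0, 1) =
      ((ε ^ 2 * fderiv ℝ (fun y => fderiv ℝ P y (b 0, 0)) z₁ (b 0, 0) -
          2 * s * fderiv ℝ P z₁ (b 1, 0) ^ 2 +
          2 * s * fderiv ℝ P z₁ (b 0, 0) * fderiv ℝ Q z₁ (b 1, 0) +
          w ^ 2 * fderiv ℝ (fun y => fderiv ℝ P y (b 1, 0)) z₁ (b 1, 0)) * w ^ 2 -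
        (ε ^ 2 * fderiv ℝ P z₁ (b 0, 0) + w ^ 2 * fderiv ℝ Q z₁ (b 1, 0)) *
          (2 * s * fderiv ℝ P z₁ (b 0, 0))) / (w ^ 2) ^ 2 + inner ℝ (∇ c x₁) (b 0) * w +
        c x₁ * (s * fderiv ℝ P z₁ (b 0, 0) / w) := by
    have hdP := hasDerivAt_comp_line (v := ((b 0, 0) : Plane × ℝ))
      (hPs.differentiableAt (by simp))
    have hdQ := hasDerivAt_comp_line (v := ((b 0, 0) : Plane × ℝ))
      (hQs.differentiableAt (by simp))
    have hline : ∀ {f : Plane × ℝ → ℝ}, ContDiffAt ℝ ∞ f z₁ → ∀ v : Plane × ℝ,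
        HasDerivAt (fun r : ℝ => fderiv ℝ f (z₁ + r • ((b 0, 0) : Plane × ℝ)) v)
          (fderiv ℝ (fun y => fderiv ℝ f y v) z₁ (b 0, 0)) 0 := fun hf v =>
      hasDerivAt_comp_line
        ((contDiffAt_fderiv_apply hf (k := 1) (by norm_cast) v).differentiableAt (by simp))
    have hdPE := hline hPs (b 0, 0)
    have hdPF := hline hPs (b 1, 0)
    have hdQF := hline hQs (b 1, 0)
    have hdu := hline hu (0, 1)
    have hdc : HasDerivAt (fun r : ℝ => c (z₁ + r • ((b 0, 0) : Plane × ℝ)).1)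
        (inner ℝ (∇ c x₁) (b 0)) 0 := by
      have h1 := hasDerivAt_comp_line (v := b 0) hc
      rw [← inner_gradient_left] at h1
      simpa using h1
    have hGd := ((hdP.pow 2).const_add (ε ^ 2)).add (hdQ.pow 2)
    have hN := (((hdQ.pow 2).const_add (ε ^ 2)).mul hdPE).sub
      ((hdP.mul hdQ).mul (hdPF.const_mul 2)) |>.add (((hdP.pow 2).const_add (ε ^ 2)).mul hdQF)
    have hGne : ε ^ 2 + P z₁ ^ 2 + Q z₁ ^ 2 ≠ 0 := by positivity
    have hR := (hN.div hGd (by simpa only [zero_smul, add_zero, Pi.add_apply, Pi.pow_apply] using hGne)).add (hdc.mul (hGd.sqrt (by simpa only [zero_smul, add_zero, Pi.add_apply, Pi.pow_apply] using hGne)))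
    have heq := (tendsto_add_smul z₁ ((b 0, 0) : Plane × ℝ)).eventually hpde'
    have hval := (hdu.congr_of_eventuallyEq (heq.mono fun r hr => hr.symm)).unique hR
    have hTf : fderiv ℝ (fun y => fderiv ℝ Q y (b 1, 0)) z₁ (b 0, 0) =
        fderiv ℝ (fun y => fderiv ℝ P y (b 1, 0)) z₁ (b 1, 0) := by
      rw [fderiv_fderiv_comm (hQs.of_le (by norm_cast))]
      have : (fun y => fderiv ℝ P y (b 1, 0)) =ᶠ[𝓝 z₁] fun y => fderiv ℝ Q y (b 0, 0) := hcurl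
      rw [this.fderiv_eq]
    have hUt : fderiv ℝ (fun y => fderiv ℝ u y (0, 1)) z₁ (b 0, 0) = fderiv ℝ P z₁ (0, 1) := by
      rw [fderiv_fderiv_comm (hu.of_le (by norm_cast)), hP, hpdef,
        fderiv_inner_jointGrad ((contDiffAt_fderiv_apply hu (k := 1) (by norm_cast)
          _).differentiableAt (by simp)) (hq.differentiableAt (by simp))]
      simp
    rw [hUt] at hval
    rw [hval]
    simp only [Pi.add_apply, Pi.mul_apply, Pi.sub_apply, Pi.pow_apply, zero_smul, add_zero, hQ0,
      hP0, hTf, ← hcurl.self_of_nhds, ne_eq, OfNat.ofNat_ne_zero, not_false_eq_true, zero_pow,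
      ← hG, Real.sqrt_sq hw0.le, show z₁.1 = x₁ from rfl]
    field_simp
    ring
  simp only [← hz₁, hP0, ← hG, ← hcurl.self_of_nhds] at e1 e2 f1 f2
  have hfin := bernstein_algebra hs0 hρ hG hw0 rfl e1 f1 e2 f2 hPt hdiff
  refine ⟨b 0, _, fderiv ℝ Q z₁ (b 1, 0), b.norm_eq_one 0, e1, ?_, hfin⟩
  have h1 := hpde'.self_of_nhds
  rw [hQ0, hP0] at h1
  rw [h1]
  simp only [ne_eq, OfNat.ofNat_ne_zero, not_false_eq_true, zero_pow, add_zero, ← hG,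
    Real.sqrt_sq hw0.le, show z₁.1 = x₁ from rfl]
  field_simp
  ring

/-! ### The equation up to the boundary -/

lemma norm_le_of_supNorm_le {X F : Type*} [NormedAddCommGroup F] {S : Set X} {f : X → F} {A : ℝ}
    (h : supNorm S f ≤ ENNReal.ofReal A) {x : X} (hx : x ∈ S) : ‖f x‖ ≤ |A| := by
  have h1 : ‖f x‖ₑ ≤ ENNReal.ofReal |A| :=
    (le_iSup₂ (f := fun x (_ : x ∈ S) => ‖f x‖ₑ) x hx).trans
      (h.trans (ENNReal.ofReal_le_ofReal (le_abs_self A)))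
  rwa [← ofReal_norm, ENNReal.ofReal_le_ofReal_iff (abs_nonneg A)] at h1

lemma supNorm_le {X F : Type*} [NormedAddCommGroup F] {S : Set X} {f : X → F} {A : ℝ}
    (h : ∀ x ∈ S, ‖f x‖ ≤ A) : supNorm S f ≤ ENNReal.ofReal A := by
  refine iSup₂_le fun x hx => ?_
  rw [← ofReal_norm]
  exact ENNReal.ofReal_le_ofReal (h x hx)

lemma norm_gradientWithin {S : Set Plane} {f : Plane → ℝ} {x : Plane} :
    ‖gradientWithin f S x‖ = ‖fderivWithin ℝ f S x‖ := by
  rw [gradientWithin, LinearIsometryEquiv.norm_map]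

lemma gradientWithin_closure_eventuallyEq {W : Set Plane} (hW : IsOpen W) {x : Plane} (hx : x ∈ W)
    (f : Plane → ℝ) : gradientWithin f (closure W) =ᶠ[𝓝 x] ∇ f := by
  filter_upwards [hW.mem_nhds hx] with y hy
  rw [gradientWithin, gradient,
    fderivWithin_of_mem_nhds (mem_of_superset (hW.mem_nhds hy) subset_closure)]

lemma closure_mem_nhds {W : Set Plane} (hW : IsOpen W) {x : Plane} (hx : x ∈ W) :
    closure W ∈ 𝓝 x := mem_of_superset (hW.mem_nhds hx) subset_closure

/-- Inequalities between functions that are continuous on the closure extend to the closure. -/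
lemma le_on_closure {W : Set Plane} {f g : Plane → ℝ} (hf : ContinuousOn f (closure W))
    (hg : ContinuousOn g (closure W)) (h : ∀ x ∈ W, f x ≤ g x) : ∀ x ∈ closure W, f x ≤ g x :=
  fun x hx => ContinuousWithinAt.closure_le hx ((hf x hx).mono subset_closure)
    ((hg x hx).mono subset_closure) h

lemma pdeOp_eq_of_mem {W : Set Plane} {q : Plane → Plane} {c f : Plane → ℝ} {ε : ℝ} (hε : 0 < ε)
    (hW : IsOpen W) {x : Plane} (hx : x ∈ W) (hf : ContDiffOn ℝ 2 f (closure W))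
    (hq : DifferentiableAt ℝ q x) :
    pdeOp (closure W) q c ε f x = regNorm ε (∇ f x - q x) *
      (divergence (fun z => (regNorm ε (∇ f z - q z))⁻¹ • (∇ f z - q z)) x + c x) := by
  have h1 := gradientWithin_closure_eventuallyEq hW hx f
  have hf' : ContDiffAt ℝ 2 f x := hf.contDiffAt (closure_mem_nhds hW hx)
  have h2 : DifferentiableAt ℝ (∇ f) x :=
    (InnerProductSpace.toDual ℝ Plane).symm.toContinuousLinearEquiv.differentiableAt.comp x
      ((hf'.fderiv_right (m := 1) (by norm_num)).differentiableAt (by simp))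
  have h3 := regNorm_mul_divergence (ε := ε) (h2.hasFDerivAt.sub hq.hasFDerivAt) (by positivity)
  simp only [Pi.sub_apply] at h3
  rw [mul_add, h3, pdeOp, h1.self_of_nhds, fderivWithin_of_mem_nhds (closure_mem_nhds hW hx),
    h1.fderiv_eq]
  ring

lemma continuousOn_pdeOp {S : Set Plane} (hS : UniqueDiffOn ℝ S) {q : Plane → Plane}
    {c f : Plane → ℝ} {ε : ℝ} (hε : 0 < ε) (hf : ContDiffOn ℝ 2 f S)
    (hq : ∀ x ∈ S, ContDiffAt ℝ ∞ q x) (hc : ContinuousOn c S) :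
    ContinuousOn (pdeOp S q c ε f) S := by
  have hg := contDiffOn_gradientWithin hS hf (k := 1) (by norm_num)
  have hp : ContinuousOn (fun x => gradientWithin f S x - q x) S :=
    hg.continuousOn.sub fun x hx => (hq x hx).continuousAt.continuousWithinAt
  have hX : ContinuousOn (fun x => fderivWithin ℝ (gradientWithin f S) S x - fderiv ℝ q x) S :=
    (hg.continuousOn_fderivWithin hS (by simp)).sub fun x hx =>
      ((hq x hx).fderiv_right (m := 1) (by norm_cast)).continuousAt.continuousWithinAt
  have hXv : ∀ v w : Plane, ContinuousOn (fun x => inner ℝ v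
      ((fderivWithin ℝ (gradientWithin f S) S x - fderiv ℝ q x) w)) S := fun v w =>
    continuousOn_const.inner (hX.clm_apply continuousOn_const)
  have hpv : ∀ v : Plane, ContinuousOn (fun x => inner ℝ v (gradientWithin f S x - q x)) S :=
    fun v => continuousOn_const.inner hp
  set b := EuclideanSpace.basisFun (Fin 2) ℝ
  have hG : ∀ x, 0 < ε ^ 2 + ‖gradientWithin f S x - q x‖ ^ 2 := fun x => by positivity
  refine ContinuousOn.add ?_ (hc.mul ((continuous_regNorm ε).comp_continuousOn hp))
  refine ContinuousOn.congr ?_ fun x _ => curvOp_frame b (hG x) _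
  refine ContinuousOn.div ?_ (continuousOn_const.add (hp.norm.pow 2)) fun x _ => (hG x).ne'
  exact ((((continuousOn_const.add ((hpv _).pow 2)).mul (hXv _ _)).sub
    (((hpv _).mul (hpv _)).mul ((hXv _ _).add (hXv _ _))))).add
    ((continuousOn_const.add ((hpv _).pow 2)).mul (hXv _ _))

lemma gradientWithin_add_const (S : Set Plane) (f : Plane → ℝ) (k : ℝ) :
    gradientWithin (fun y => f y + k) S = gradientWithin f S := by
  ext1 x
  rw [gradientWithin, gradientWithin, fderivWithin_add_const]

lemma pdeOp_add_const (S : Set Plane) (q : Plane → Plane) (c : Plane → ℝ) (ε : ℝ) (f : Plane → ℝ)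
    (k : ℝ) : pdeOp S q c ε (fun y => f y + k) = pdeOp S q c ε f := by
  unfold pdeOp
  rw [gradientWithin_add_const]

lemma abs_pdeOp_le {S : Set Plane} {q : Plane → Plane} {c f : Plane → ℝ} {ε A B D : ℝ}
    (hε : 0 < ε) (hε1 : ε < 1) {x : Plane} (h1 : ‖gradientWithin f S x‖ ≤ A)
    (h2 : ‖fderivWithin ℝ (gradientWithin f S) S x‖ ≤ A) (h3 : ‖q x‖ ≤ B)
    (h4 : ‖fderiv ℝ q x‖ ≤ B) (h5 : |c x| ≤ D) :
    |pdeOp S q c ε f x| ≤ 3 * (A + B) + D * (1 + A + B) := by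
  have e1 := abs_curvOp_le ε (gradientWithin f S x - q x)
    (fderivWithin ℝ (gradientWithin f S) S x - fderiv ℝ q x)
  have e2 := norm_sub_le (fderivWithin ℝ (gradientWithin f S) S x) (fderiv ℝ q x)
  have e3 := regNorm_le hε.le (gradientWithin f S x - q x)
  have e4 := norm_sub_le (gradientWithin f S x) (q x)
  have e5 : |c x * regNorm ε (gradientWithin f S x - q x)| ≤ D * (1 + A + B) := by
    rw [abs_mul, abs_of_nonneg (regNorm_nonneg _ _)]
    exact mul_le_mul h5 (by linarith) (regNorm_nonneg _ _) ((abs_nonneg _).trans h5)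
  exact (abs_add_le _ _).trans (by linarith)

/-- The data of the initial value problem on a bounded time interval `[0, T]`, for a general closed
field `q` in place of `Dθ`. -/
structure Setting (W : Set Plane) (q : Plane → Plane) (c u₀ : Plane → ℝ) (ε T : ℝ)
    (u : Plane × ℝ → ℝ) : Prop where
  ε_pos : 0 < ε
  ε_lt_one : ε < 1
  T_pos : 0 < T
  isOpen : IsOpen W
  smooth : HasSmoothBoundary W
  bounded : Bornology.IsBounded W
  q_smooth : ∀ x ∈ closure W, ContDiffAt ℝ ∞ q x
  q_symm : ∀ x ∈ W, ∀ g h, inner ℝ g (fderiv ℝ q x h) = inner ℝ h (fderiv ℝ q x g)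
  c_smooth : ContDiffOn ℝ ∞ c (closure W)
  u₀_smooth : ContDiffOn ℝ 2 u₀ (closure W)
  u₀_neumann : ∀ x n, IsOutwardUnitNormal W x n →
    inner ℝ (gradientWithin u₀ (closure W) x - q x) n = 0
  sol : IsRegularizedSolution W q c u₀ ε (Icc 0 T) u

namespace Setting

variable {W : Set Plane} {q : Plane → Plane} {c u₀ : Plane → ℝ} {ε T : ℝ} {u : Plane × ℝ → ℝ}

lemma uniqueDiffOn (h : Setting W q c u₀ ε T u) : UniqueDiffOn ℝ (closure W) :=
  h.smooth.uniqueDiffOn h.isOpen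

lemma uniqueDiffOn_prod (h : Setting W q c u₀ ε T u) :
    UniqueDiffOn ℝ (closure W ×ˢ Icc 0 T) :=
  h.uniqueDiffOn.prod (uniqueDiffOn_Icc h.T_pos)

lemma contDiffOn_slice (h : Setting W q c u₀ ε T u) {t : ℝ} (ht : t ∈ Ioc 0 T) :
    ContDiffOn ℝ ∞ (fun x => u (x, t)) (closure W) :=
  h.sol.smooth.comp (by fun_prop) fun _ hx => ⟨hx, ⟨ht.1.le, ht.2⟩, ht.1.ne'⟩

lemma hasFDerivWithinAt (h : Setting W q c u₀ ε T u) {x : Plane} {t : ℝ} (hx : x ∈ closure W)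
    (ht : t ∈ Icc 0 T) :
    HasFDerivWithinAt u (fderivWithin ℝ u (closure W ×ˢ Icc 0 T) (x, t)) (closure W ×ˢ Icc 0 T)
      (x, t) :=
  (h.sol.contDiffOn_one.differentiableOn (by simp) (x, t) ⟨hx, ht⟩).hasFDerivWithinAt

lemma continuousOn_fderivWithin (h : Setting W q c u₀ ε T u) :
    ContinuousOn (fderivWithin ℝ u (closure W ×ˢ Icc 0 T)) (closure W ×ˢ Icc 0 T) :=
  h.sol.contDiffOn_one.continuousOn_fderivWithin h.uniqueDiffOn_prod (by simp)

lemma hasFDerivWithinAt_slice (h : Setting W q c u₀ ε T u) {x : Plane} {t : ℝ}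
    (hx : x ∈ closure W) (ht : t ∈ Icc 0 T) :
    HasFDerivWithinAt (fun y => u (y, t))
      ((fderivWithin ℝ u (closure W ×ˢ Icc 0 T) (x, t)).comp (ContinuousLinearMap.inl ℝ Plane ℝ))
      (closure W) x :=
  HasFDerivWithinAt.comp (t := closure W ×ˢ Icc 0 T) x (h.hasFDerivWithinAt hx ht)
    ((hasFDerivAt_prodMk_left x t).hasFDerivWithinAt) fun _ hy => ⟨hy, ht⟩

lemma hasDerivWithinAt_time' (h : Setting W q c u₀ ε T u) {x : Plane} {t : ℝ}
    (hx : x ∈ closure W) (ht : t ∈ Icc 0 T) :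
    HasDerivWithinAt (fun s => u (x, s))
      (fderivWithin ℝ u (closure W ×ˢ Icc 0 T) (x, t) (0, 1)) (Icc 0 T) t := by
  have := HasFDerivWithinAt.comp (t := closure W ×ˢ Icc 0 T) t (h.hasFDerivWithinAt hx ht)
    ((hasFDerivAt_prodMk_right x t).hasFDerivWithinAt (s := Icc 0 T)) fun _ hy => ⟨hx, hy⟩
  refine HasDerivWithinAt.congr_deriv (f' := _) this.hasDerivWithinAt ?_
  simp

lemma derivWithin_time (h : Setting W q c u₀ ε T u) {x : Plane} {t : ℝ}
    (hx : x ∈ closure W) (ht : t ∈ Icc 0 T) :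
    derivWithin (fun s => u (x, s)) (Icc 0 T) t =
      fderivWithin ℝ u (closure W ×ˢ Icc 0 T) (x, t) (0, 1) :=
  (h.hasDerivWithinAt_time' hx ht).derivWithin (uniqueDiffOn_Icc h.T_pos t ht)

lemma hasDerivWithinAt_time (h : Setting W q c u₀ ε T u) {x : Plane} {t : ℝ}
    (hx : x ∈ closure W) (ht : t ∈ Icc 0 T) :
    HasDerivWithinAt (fun s => u (x, s)) (derivWithin (fun s => u (x, s)) (Icc 0 T) t)
      (Icc 0 T) t := by
  rw [h.derivWithin_time hx ht]
  exact h.hasDerivWithinAt_time' hx ht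

lemma gradientWithin_slice (h : Setting W q c u₀ ε T u) {x : Plane} {t : ℝ}
    (hx : x ∈ closure W) (ht : t ∈ Icc 0 T) :
    gradientWithin (fun y => u (y, t)) (closure W) x = (InnerProductSpace.toDual ℝ Plane).symm
      ((fderivWithin ℝ u (closure W ×ˢ Icc 0 T) (x, t)).comp
        (ContinuousLinearMap.inl ℝ Plane ℝ)) := by
  rw [gradientWithin, (h.hasFDerivWithinAt_slice hx ht).fderivWithin (h.uniqueDiffOn x hx)]

/-- The field `D(u - θ)` up to the boundary. -/
noncomputable def field (W : Set Plane) (q : Plane → Plane) (u : Plane × ℝ → ℝ) (t : ℝ)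
    (x : Plane) : Plane := gradientWithin (fun y => u (y, t)) (closure W) x - q x

lemma continuousOn_field (h : Setting W q c u₀ ε T u) :
    ContinuousOn (fun z : Plane × ℝ => field W q u z.2 z.1) (closure W ×ˢ Icc 0 T) := by
  unfold field
  refine ContinuousOn.sub ?_ ?_
  · refine ContinuousOn.congr ?_ fun z hz => h.gradientWithin_slice hz.1 hz.2
    exact (InnerProductSpace.toDual ℝ Plane).symm.continuous.comp_continuousOn
      (h.continuousOn_fderivWithin.clm_comp continuousOn_const)
  · intro z hz
    exact ((h.q_smooth z.1 hz.1).continuousAt.comp continuousAt_fst).continuousWithinAt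

lemma continuousOn_regNorm_field (h : Setting W q c u₀ ε T u) :
    ContinuousOn (fun z : Plane × ℝ => regNorm ε (field W q u z.2 z.1))
      (closure W ×ˢ Icc 0 T) :=
  Continuous.comp_continuousOn (g := regNorm ε) (continuous_regNorm ε) h.continuousOn_field

/-- The equation holds up to the boundary. -/
lemma equation_closure (h : Setting W q c u₀ ε T u) {x : Plane} {t : ℝ} (hx : x ∈ closure W)
    (ht : t ∈ Ioc 0 T) :
    derivWithin (fun s => u (x, s)) (Icc 0 T) t =
      pdeOp (closure W) q c ε (fun y => u (y, t)) x := by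
  have ht' : t ∈ Icc 0 T := ⟨ht.1.le, ht.2⟩
  have h2 : ContDiffOn ℝ 2 (fun y => u (y, t)) (closure W) :=
    (h.contDiffOn_slice ht).of_le (by norm_cast)
  have heq : ∀ y ∈ W, derivWithin (fun s => u (y, s)) (Icc 0 T) t =
      pdeOp (closure W) q c ε (fun y => u (y, t)) y := fun y hy => by
    rw [pdeOp_eq_of_mem h.ε_pos h.isOpen hy h2
      ((h.q_smooth y (subset_closure hy)).differentiableAt (by simp))]
    exact h.sol.equation y hy t ⟨ht', ht.1.ne'⟩
  have hc1 : ContinuousOn (fun y => derivWithin (fun s => u (y, s)) (Icc 0 T) t) (closure W) := by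
    refine ContinuousOn.congr ?_ fun y hy => h.derivWithin_time hy ht'
    exact (h.continuousOn_fderivWithin.comp (by fun_prop) fun y hy => ⟨hy, ht'⟩).clm_apply
      continuousOn_const
  have hc2 : ContinuousOn (pdeOp (closure W) q c ε (fun y => u (y, t))) (closure W) :=
    continuousOn_pdeOp h.uniqueDiffOn h.ε_pos h2 h.q_smooth h.c_smooth.continuousOn
  exact le_antisymm (le_on_closure hc1 hc2 (fun y hy => (heq y hy).le) x hx)
    (le_on_closure hc2 hc1 (fun y hy => (heq y hy).ge) x hx)

/-! ### The estimate of the time derivative -/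

lemma neumann_eq (h : Setting W q c u₀ ε T u) {x n : Plane} (hn : IsOutwardUnitNormal W x n)
    {t : ℝ} (ht : t ∈ Icc 0 T) :
    inner ℝ (gradientWithin (fun y => u (y, t)) (closure W) x) n = inner ℝ (q x) n := by
  have := h.sol.neumann x n hn t ht
  rwa [inner_sub_left, sub_eq_zero] at this

lemma u₀_neumann_eq (h : Setting W q c u₀ ε T u) {x n : Plane} (hn : IsOutwardUnitNormal W x n) :
    inner ℝ (gradientWithin u₀ (closure W) x) n = inner ℝ (q x) n := by
  have := h.u₀_neumann x n hn
  rwa [inner_sub_left, sub_eq_zero] at this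

/-- The functions `u₀ ± M t` are barriers. -/
lemma abs_sub_initial_le (h : Setting W q c u₀ ε T u) {M : ℝ}
    (hM : ∀ x ∈ closure W, |pdeOp (closure W) q c ε u₀ x| ≤ M) {x : Plane} {t : ℝ}
    (hx : x ∈ closure W) (ht : t ∈ Icc 0 T) : |u (x, t) - u₀ x| ≤ M * t := by
  have hbar : ∀ k : ℝ, ContinuousOn (fun z : Plane × ℝ => u₀ z.1 + k * z.2)
      (closure W ×ˢ Icc 0 T) := fun k =>
    (h.u₀_smooth.continuousOn.comp continuousOn_fst fun z hz => hz.1).add (by fun_prop)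
  have hbar2 : ∀ k : ℝ, ∀ t, ContDiffOn ℝ 2 (fun x => u₀ x + k * t) (closure W) := fun k t =>
    h.u₀_smooth.add contDiffOn_const
  have hbard : ∀ k : ℝ, ∀ x, ∀ t, HasDerivWithinAt (fun t => u₀ x + k * t) k (Icc 0 T) t :=
    fun k x t => by
      simpa using (((hasDerivAt_id t).const_mul k).const_add (u₀ x)).hasDerivWithinAt
  have hu2 : ∀ t ∈ Ioc 0 T, ContDiffOn ℝ 2 (fun x => u (x, t)) (closure W) := fun t ht =>
    (h.contDiffOn_slice ht).of_le (by norm_cast)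
  have hup : u (x, t) ≤ u₀ x + M * t := by
    refine comparison (q := q) (c := c) h.ε_pos h.isOpen h.smooth h.bounded
      (f := fun x t => u (x, t)) (g := fun x t => u₀ x + M * t)
      (df := fun x t => derivWithin (fun s => u (x, s)) (Icc 0 T) t) (dg := fun _ _ => M)
      h.sol.contDiffOn_one.continuousOn (hbar M) hu2 (fun t _ => hbar2 M t) ?_
      (fun x hx t ht => h.hasDerivWithinAt_time hx ⟨ht.1.le, ht.2⟩) (fun x _ t _ => hbard M x t)
      (fun x hx t ht => (h.equation_closure hx ht).le) ?_ ?_ x hx t ht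
    · intro t ht x n hn
      simp only [gradientWithin_add_const]
      rw [h.neumann_eq hn ⟨ht.1.le, ht.2⟩, h.u₀_neumann_eq hn]
    · intro x hx t _
      simp only [pdeOp_add_const]
      exact (abs_le.1 (hM x hx)).2
    · intro x hx
      simp [h.sol.initial x hx]
  have hlow : u₀ x + -M * t ≤ u (x, t) := by
    refine comparison (q := q) (c := c) h.ε_pos h.isOpen h.smooth h.bounded
      (g := fun x t => u (x, t)) (f := fun x t => u₀ x + -M * t)
      (dg := fun x t => derivWithin (fun s => u (x, s)) (Icc 0 T) t) (df := fun _ _ => -M)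
      (hbar (-M)) h.sol.contDiffOn_one.continuousOn (fun t _ => hbar2 (-M) t) hu2 ?_
      (fun x _ t _ => hbard (-M) x t) (fun x hx t ht => h.hasDerivWithinAt_time hx ⟨ht.1.le, ht.2⟩)
      ?_ (fun x hx t ht => (h.equation_closure hx ht).ge) ?_ x hx t ht
    · intro t ht x n hn
      simp only [gradientWithin_add_const]
      rw [h.neumann_eq hn ⟨ht.1.le, ht.2⟩, h.u₀_neumann_eq hn]
    · intro x hx t _
      simp only [pdeOp_add_const]
      exact (abs_le.1 (hM x hx)).1
    · intro x hx
      simp [h.sol.initial x hx]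
  rw [abs_le]
  constructor <;> linarith

/-- Comparing the solution with its translates in time shows that it is Lipschitz in time. -/
lemma abs_sub_time_le (h : Setting W q c u₀ ε T u) {M : ℝ}
    (hM : ∀ x ∈ closure W, |pdeOp (closure W) q c ε u₀ x| ≤ M) {x : Plane} {t τ : ℝ}
    (hx : x ∈ closure W) (ht : 0 ≤ t) (hτ : 0 < τ) (htτ : t + τ ≤ T) :
    |u (x, t + τ) - u (x, t)| ≤ M * τ := by
  have hsub : ∀ t ∈ Icc 0 (T - τ), t ∈ Icc 0 T := fun t ht => ⟨ht.1, by linarith [ht.2]⟩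
  have hsub' : ∀ t ∈ Icc 0 (T - τ), t + τ ∈ Icc 0 T := fun t ht =>
    ⟨by linarith [ht.1], by linarith [ht.2]⟩
  have hc1 : ∀ k : ℝ, ContinuousOn (fun z : Plane × ℝ => u (z.1, z.2) + k)
      (closure W ×ˢ Icc 0 (T - τ)) := fun k =>
    (h.sol.contDiffOn_one.continuousOn.mono
      (prod_mono subset_rfl fun t ht => hsub t ht)).add continuousOn_const
  have hc2 : ContinuousOn (fun z : Plane × ℝ => u (z.1, z.2 + τ))
      (closure W ×ˢ Icc 0 (T - τ)) :=
    h.sol.contDiffOn_one.continuousOn.comp (by fun_prop) fun z hz => ⟨hz.1, hsub' z.2 hz.2⟩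
  have hs1 : ∀ k : ℝ, ∀ t ∈ Ioc 0 (T - τ), ContDiffOn ℝ 2 (fun x => u (x, t) + k) (closure W) :=
    fun k t ht => ((h.contDiffOn_slice ⟨ht.1, by linarith [ht.2]⟩).of_le (by norm_cast)).add
      contDiffOn_const
  have hs2 : ∀ t ∈ Ioc 0 (T - τ), ContDiffOn ℝ 2 (fun x => u (x, t + τ)) (closure W) :=
    fun t ht => (h.contDiffOn_slice ⟨by linarith [ht.1], by linarith [ht.2]⟩).of_le (by norm_cast)
  have hd1 : ∀ k : ℝ, ∀ x ∈ closure W, ∀ t ∈ Ioc 0 (T - τ),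
      HasDerivWithinAt (fun s => u (x, s) + k) (derivWithin (fun s => u (x, s)) (Icc 0 T) t)
        (Icc 0 (T - τ)) t := fun k x hx t ht =>
    ((h.hasDerivWithinAt_time hx (hsub t ⟨ht.1.le, ht.2⟩)).mono fun s hs => hsub s hs).add_const k
  have hd2 : ∀ x ∈ closure W, ∀ t ∈ Ioc 0 (T - τ),
      HasDerivWithinAt (fun s => u (x, s + τ))
        (derivWithin (fun s => u (x, s)) (Icc 0 T) (t + τ)) (Icc 0 (T - τ)) t := by
    intro x hx t ht
    have h1 := h.hasDerivWithinAt_time hx (hsub' t ⟨ht.1.le, ht.2⟩)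
    have h2 : HasDerivWithinAt (fun s : ℝ => s + τ) 1 (Icc 0 (T - τ)) t :=
      ((hasDerivAt_id t).add_const τ).hasDerivWithinAt
    have h3 := h1.scomp t h2 fun s hs => hsub' s hs
    simpa [Function.comp_def] using h3
  have hn1 : ∀ k : ℝ, ∀ t ∈ Ioc 0 (T - τ), ∀ x n, IsOutwardUnitNormal W x n →
      inner ℝ (gradientWithin (fun x => u (x, t + τ)) (closure W) x) n =
        inner ℝ (gradientWithin (fun x => u (x, t) + k) (closure W) x) n := by
    intro k t ht x n hn
    rw [gradientWithin_add_const, h.neumann_eq hn (hsub t ⟨ht.1.le, ht.2⟩),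
      h.neumann_eq hn (hsub' t ⟨ht.1.le, ht.2⟩)]
  have he1 : ∀ k : ℝ, ∀ x ∈ closure W, ∀ t ∈ Ioc 0 (T - τ),
      derivWithin (fun s => u (x, s)) (Icc 0 T) t =
        pdeOp (closure W) q c ε (fun x => u (x, t) + k) x := by
    intro k x hx t ht
    rw [pdeOp_add_const]
    exact h.equation_closure hx ⟨ht.1, by linarith [ht.2]⟩
  have he2 : ∀ x ∈ closure W, ∀ t ∈ Ioc 0 (T - τ),
      derivWithin (fun s => u (x, s)) (Icc 0 T) (t + τ) =
        pdeOp (closure W) q c ε (fun x => u (x, t + τ)) x := fun x hx t ht =>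
    h.equation_closure hx ⟨by linarith [ht.1], by linarith [ht.2]⟩
  have h0 : ∀ x ∈ closure W, |u (x, τ) - u (x, 0)| ≤ M * τ := fun x hx => by
    rw [h.sol.initial x hx]
    exact h.abs_sub_initial_le hM hx ⟨hτ.le, by linarith⟩
  have hup : u (x, t + τ) ≤ u (x, t) + M * τ := by
    refine comparison (q := q) (c := c) h.ε_pos h.isOpen h.smooth h.bounded
      (f := fun x t => u (x, t + τ)) (g := fun x t => u (x, t) + M * τ) hc2 (hc1 _) hs2 (hs1 _)
      (hn1 _) hd2 (hd1 _) (fun x hx t ht => (he2 x hx t ht).le)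
      (fun x hx t ht => (he1 _ x hx t ht).ge) ?_ x hx t ⟨ht, by linarith⟩
    intro x hx
    have := (abs_le.1 (h0 x hx)).2
    rw [zero_add]
    linarith
  have hlow : u (x, t) + -(M * τ) ≤ u (x, t + τ) := by
    refine comparison (q := q) (c := c) h.ε_pos h.isOpen h.smooth h.bounded
      (g := fun x t => u (x, t + τ)) (f := fun x t => u (x, t) + -(M * τ)) (hc1 _) hc2 (hs1 _) hs2
      (fun t ht x n hn => (hn1 _ t ht x n hn).symm) (hd1 _) hd2
      (fun x hx t ht => (he1 _ x hx t ht).le) (fun x hx t ht => (he2 x hx t ht).ge) ?_ x hx t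
      ⟨ht, by linarith⟩
    intro x hx
    have := (abs_le.1 (h0 x hx)).1
    rw [zero_add]
    linarith
  rw [abs_le]
  constructor <;> linarith

lemma abs_derivWithin_time_le (h : Setting W q c u₀ ε T u) {M : ℝ}
    (hM : ∀ x ∈ closure W, |pdeOp (closure W) q c ε u₀ x| ≤ M) {x : Plane} {t : ℝ}
    (hx : x ∈ closure W) (ht : t ∈ Icc 0 T) :
    |derivWithin (fun s => u (x, s)) (Icc 0 T) t| ≤ M := by
  have hM0 : 0 ≤ M := (abs_nonneg _).trans (hM x hx)
  have h1 : ∀ s ∈ Icc 0 T, ‖u (x, s) - u (x, t)‖ ≤ M * ‖s - t‖ := by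
    intro s hs
    rw [Real.norm_eq_abs, Real.norm_eq_abs]
    rcases lt_trichotomy s t with hst | hst | hst
    · have := h.abs_sub_time_le hM hx hs.1 (sub_pos.2 hst) (by linarith [ht.2])
      rw [add_sub_cancel] at this
      rw [abs_sub_comm, abs_sub_comm s t, abs_of_pos (sub_pos.2 hst)]
      exact this
    · simp [hst]
    · have := h.abs_sub_time_le hM hx ht.1 (sub_pos.2 hst) (by linarith [hs.2])
      rw [add_sub_cancel] at this
      rw [abs_of_pos (sub_pos.2 hst)]
      exact this
  have h2 := (h.hasDerivWithinAt_time hx ht)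
  rw [hasDerivWithinAt_iff_tendsto_slope] at h2
  have hne : (𝓝[Icc 0 T \ {t}] t).NeBot := by
    have := (uniqueDiffOn_Icc h.T_pos t ht).accPt
    rwa [accPt_principal_iff_nhdsWithin] at this
  have h3 := h2.abs
  refine le_of_tendsto h3 ?_
  filter_upwards [self_mem_nhdsWithin] with s hs
  have hst : s - t ≠ 0 := sub_ne_zero.2 hs.2
  rw [slope_def_field, abs_div, div_le_iff₀ (abs_pos.2 hst)]
  exact h1 s hs.1

end Setting

/-! ### Bounds at interior maxima -/

/-- The quantitative form of the estimate at an interior maximum: the forcing term dominates. Here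
`κ` bounds the length of the gradient of the multiplier, `M` bounds the time derivative. -/
lemma le_of_bernstein {ε s w ρ k κ a d c gc re ut M D δ : ℝ} (hε : 0 < ε) (hε1 : ε < 1)
    (hδ : 0 < δ) (hw : w ^ 2 = ε ^ 2 + s ^ 2) (hw0 : 0 < w) (hs : 0 ≤ s) (hρ : 1 ≤ ρ) (hk : 0 ≤ k)
    (hre : |re| ≤ κ) (hut : |ut| ≤ M) (hc : 0 < c) (hcD : c ≤ D) {gcn : ℝ} (hgc : |gc| ≤ gcn)
    (hcond : δ ≤ c ^ 2 - gcn - κ * c - 2 * k)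
    (e1 : ρ * (s * a) + re * w ^ 2 = 0) (e2 : ut = ε ^ 2 * a / w ^ 2 + d + c * w)
    (e3 : ρ * d ^ 2 ≤ 2 * k * (w ^ 2 + ε ^ 2) + ρ * (s * gc * w) - c * s * re * w) :
    w ≤ 2 + (2 * k + 2 * D * (M + κ)) / δ := by
  have hM : 0 ≤ M := (abs_nonneg _).trans hut
  have hκ : 0 ≤ κ := (abs_nonneg _).trans hre
  have hgcn : 0 ≤ gcn := (abs_nonneg _).trans hgc
  have hD : 0 ≤ D := hc.le.trans hcD
  have hfrac : 0 ≤ (2 * k + 2 * D * (M + κ)) / δ := by positivity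
  have hsw : s ≤ w := by
    rw [← sq_le_sq₀ hs hw0.le, hw]
    linarith [sq_nonneg ε]
  rcases lt_or_ge s 1 with hs1 | hs1
  · have : w ≤ 2 := by
      rw [← sq_le_sq₀ hw0.le (by norm_num), hw]
      nlinarith
    linarith
  have hw1 : 1 ≤ w := hs1.trans hsw
  have hε2 : ε ^ 2 ≤ 1 := by nlinarith
  -- The second derivative in the direction of the gradient enters with a small coefficient.
  have hy : |ε ^ 2 * a / w ^ 2| ≤ κ := by
    have h1 : ε ^ 2 * a / w ^ 2 = -(ε ^ 2 * re / (ρ * s)) := by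
      have h2 : ρ * s ≠ 0 := by positivity
      field_simp
      linear_combination e1
    have hρs : 1 ≤ ρ * s := by nlinarith
    rw [h1, abs_neg, abs_div, abs_mul, abs_of_nonneg (sq_nonneg ε),
      abs_of_pos (by linarith : 0 < ρ * s), div_le_iff₀ (by linarith)]
    linarith [mul_le_mul hε2 hre (abs_nonneg _) zero_le_one, mul_le_mul_of_nonneg_left hρs hκ]
  set y := ut - ε ^ 2 * a / w ^ 2 with hydef
  have hyM : |y| ≤ M + κ := (abs_sub _ _).trans (add_le_add hut hy)
  have hd : d = y - c * w := by rw [hydef, e2]; ring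
  have hd2 : c ^ 2 * w ^ 2 - 2 * c * w * (M + κ) ≤ d ^ 2 := by
    rw [hd]
    have := mul_le_mul_of_nonneg_left ((abs_le.1 hyM).2) (mul_pos hc hw0).le
    linarith [sq_nonneg y]
  have hrhs : ρ * d ^ 2 ≤ ρ * (2 * k * (w ^ 2 + 1) + gcn * w ^ 2 + c * κ * w ^ 2) := by
    have h1 : 2 * k * (w ^ 2 + ε ^ 2) ≤ ρ * (2 * k * (w ^ 2 + 1)) := by
      have : 2 * k * (w ^ 2 + ε ^ 2) ≤ 2 * k * (w ^ 2 + 1) := by gcongr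
      exact this.trans (le_mul_of_one_le_left (by positivity) hρ)
    have h2 : s * gc * w ≤ gcn * w ^ 2 := by
      have : s * gc ≤ w * gcn :=
        (mul_le_mul_of_nonneg_left ((le_abs_self gc).trans hgc) hs).trans
          (mul_le_mul_of_nonneg_right hsw hgcn)
      linarith [mul_le_mul_of_nonneg_right this hw0.le]
    have h3 : -(c * s * re * w) ≤ ρ * (c * κ * w ^ 2) := by
      have h4 : -re * s ≤ κ * w :=
        (mul_le_mul_of_nonneg_right ((neg_le_abs re).trans hre) hs).trans
          (mul_le_mul_of_nonneg_left hsw hκ)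
      have h5 : -(c * s * re * w) ≤ c * κ * w ^ 2 := by
        have := mul_le_mul_of_nonneg_left h4 (mul_pos hc hw0).le
        linarith
      exact h5.trans (le_mul_of_one_le_left (by positivity) hρ)
    have h6 := mul_le_mul_of_nonneg_left h2 (by linarith : 0 ≤ ρ)
    linarith
  have hd3 := le_of_mul_le_mul_left hrhs (by linarith)
  have hfin : δ * w ^ 2 ≤ 2 * k + 2 * D * (M + κ) * w := by
    have h1 := mul_le_mul_of_nonneg_right hcond (sq_nonneg w)
    have h2 : 2 * c * w * (M + κ) ≤ 2 * D * (M + κ) * w := by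
      have := mul_le_mul_of_nonneg_right hcD (by positivity : 0 ≤ w * (M + κ))
      linarith
    linarith
  have hfin2 : δ * w ≤ 2 * k + 2 * D * (M + κ) := by
    have : δ * w * w ≤ (2 * k + 2 * D * (M + κ)) * w := by
      have h1 : 2 * k ≤ 2 * k * w := le_mul_of_one_le_right (by positivity) hw1
      linarith
    exact le_of_mul_le_mul_right this hw0
  have : w ≤ (2 * k + 2 * D * (M + κ)) / δ := by
    rw [le_div_iff₀ hδ]
    linarith
  linarith

namespace Setting

variable {W : Set Plane} {q : Plane → Plane} {c u₀ : Plane → ℝ} {ε T : ℝ} {u : Plane × ℝ → ℝ}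

lemma contDiffAt (h : Setting W q c u₀ ε T u) {x : Plane} {t : ℝ} (hx : x ∈ W)
    (ht : t ∈ Ioo 0 T) : ContDiffAt ℝ ∞ u (x, t) := by
  refine h.sol.smooth.contDiffAt (prod_mem_nhds (closure_mem_nhds h.isOpen hx) ?_)
  filter_upwards [isOpen_Ioo.mem_nhds ht] with s hs
  exact ⟨⟨hs.1.le, hs.2.le⟩, hs.1.ne'⟩

lemma jointGrad_eq (h : Setting W q c u₀ ε T u) {x : Plane} {t : ℝ} (hx : x ∈ W)
    (ht : t ∈ Ioo 0 T) : jointGrad u q (x, t) = field W q u t x := by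
  have h1 := ((h.contDiffAt hx ht).differentiableAt (by simp)).hasFDerivAt
  have h2 : HasFDerivAt (fun y => u (y, t)) ((fderiv ℝ u (x, t)).comp
      (ContinuousLinearMap.inl ℝ Plane ℝ)) x :=
    h1.comp x (hasFDerivAt_prodMk_left x t)
  rw [jointGrad, field, gradientWithin,
    h2.hasFDerivWithinAt.fderivWithin (h.uniqueDiffOn x (subset_closure hx))]

lemma equation_joint (h : Setting W q c u₀ ε T u) {x : Plane} {t : ℝ} (hx : x ∈ W)
    (ht : t ∈ Ioo 0 T) :
    fderiv ℝ u (x, t) (0, 1) = curvOp ε (jointGrad u q (x, t))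
      ((fderiv ℝ (jointGrad u q) (x, t)).comp (ContinuousLinearMap.inl ℝ Plane ℝ)) +
        c x * regNorm ε (jointGrad u q (x, t)) := by
  have hxS := subset_closure hx
  have hu := h.contDiffAt hx ht
  have hq := h.q_smooth x hxS
  have h1 : HasDerivAt (fun s => u (x, s)) (fderiv ℝ u (x, t) (0, 1)) t := by
    have := (hu.differentiableAt (by simp)).hasFDerivAt.comp t (hasFDerivAt_prodMk_right x t)
    refine HasDerivAt.congr_deriv (f' := _) this.hasDerivAt ?_
    simp
  have h2 := h.equation_closure hxS ⟨ht.1, ht.2.le⟩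
  rw [h1.hasDerivWithinAt.derivWithin (uniqueDiffOn_Icc h.T_pos t ⟨ht.1.le, ht.2.le⟩)] at h2
  rw [h2, pdeOp, h.jointGrad_eq hx ht]
  have h3 : (fun y => jointGrad u q (y, t)) =ᶠ[𝓝 x]
      fun y => gradientWithin (fun y => u (y, t)) (closure W) y - q y := by
    filter_upwards [h.isOpen.mem_nhds hx] with y hy
    exact h.jointGrad_eq hy ht
  have h4 : HasFDerivAt (fun y => jointGrad u q (y, t))
      ((fderiv ℝ (jointGrad u q) (x, t)).comp (ContinuousLinearMap.inl ℝ Plane ℝ)) x :=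
    HasFDerivAt.comp (g := jointGrad u q) x
      ((contDiffAt_jointGrad hu hq).differentiableAt (by simp)).hasFDerivAt
      (hasFDerivAt_prodMk_left x t)
  have h5 : DifferentiableWithinAt ℝ (gradientWithin (fun y => u (y, t)) (closure W))
      (closure W) x :=
    (contDiffOn_gradientWithin h.uniqueDiffOn (h.contDiffOn_slice ⟨ht.1, ht.2.le⟩) (k := 1)
      (by norm_cast)).differentiableOn (by simp) x hxS
  have h6 := (h5.hasFDerivWithinAt.hasFDerivAt (closure_mem_nhds h.isOpen hx)).sub
    (hq.differentiableAt (by simp)).hasFDerivAt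
  rw [(h4.congr_of_eventuallyEq h3.symm).unique h6]
  rfl

/-- The bound at an interior maximum of the product of a multiplier and the regularized length of
the field. -/
lemma regNorm_le_of_interior_max (h : Setting W q c u₀ ε T u) {M D δ κ k R : ℝ} {x₁ z : Plane}
    {t₁ : ℝ} (hδ : 0 < δ) (hx : x₁ ∈ W) (ht : t₁ ∈ Ioo 0 T)
    (hM : |derivWithin (fun s => u (x₁, s)) (Icc 0 T) t₁| ≤ M) (hc : 0 < c x₁) (hcD : c x₁ ≤ D)
    (hk : 0 ≤ k) (hρ : 1 ≤ multiplier z k R x₁) (hκ : 2 * k * ‖x₁ - z‖ ≤ κ)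
    (hcond : δ ≤ c x₁ ^ 2 - ‖∇ c x₁‖ - κ * c x₁ - 2 * k)
    (hmaxx : ∀ᶠ x in 𝓝 x₁, multiplier z k R x * regNorm ε (field W q u t₁ x) ≤
      multiplier z k R x₁ * regNorm ε (field W q u t₁ x₁))
    (hmaxt : ∀ᶠ t in 𝓝[<] t₁,
      regNorm ε (field W q u t x₁) ≤ regNorm ε (field W q u t₁ x₁)) :
    regNorm ε (field W q u t₁ x₁) ≤ 2 + (2 * k + 2 * D * (M + κ)) / δ := by
  have hW := h.isOpen.mem_nhds hx
  have hxS := subset_closure hx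
  have hM0 : 0 ≤ M := (abs_nonneg _).trans hM
  have hκ0 : 0 ≤ κ := le_trans (by positivity) hκ
  have hut : derivWithin (fun s => u (x₁, s)) (Icc 0 T) t₁ = fderiv ℝ u (x₁, t₁) (0, 1) := by
    have := ((h.contDiffAt hx ht).differentiableAt (by simp)).hasFDerivAt.comp t₁
      (hasFDerivAt_prodMk_right x₁ t₁)
    have h1 : HasDerivAt (fun s => u (x₁, s)) (fderiv ℝ u (x₁, t₁) (0, 1)) t₁ := by
      refine HasDerivAt.congr_deriv (f' := _) this.hasDerivAt ?_
      simp
    exact h1.hasDerivWithinAt.derivWithin (uniqueDiffOn_Icc h.T_pos t₁ ⟨ht.1.le, ht.2.le⟩)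
  rw [hut] at hM
  have hjx : ∀ᶠ x in 𝓝 x₁, jointGrad u q (x, t₁) = field W q u t₁ x := by
    filter_upwards [hW] with x hx'
    exact h.jointGrad_eq hx' ht
  have hjt : ∀ᶠ t in 𝓝[<] t₁, jointGrad u q (x₁, t) = field W q u t x₁ := by
    filter_upwards [nhdsWithin_le_nhds (isOpen_Ioo.mem_nhds ht)] with t ht'
    exact h.jointGrad_eq hx ht'
  have hj := hjx.self_of_nhds
  by_cases hp : field W q u t₁ x₁ = 0
  · have h1 := regNorm_le h.ε_pos.le (field W q u t₁ x₁)
    rw [hp, norm_zero] at h1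
    rw [hp]
    have h2 : 0 ≤ (2 * k + 2 * D * (M + κ)) / δ := by
      have := hc.le.trans hcD
      positivity
    linarith [h.ε_lt_one]
  have hpde : ∀ᶠ y in 𝓝 (x₁, t₁), fderiv ℝ u y (0, 1) = curvOp ε (jointGrad u q y)
      ((fderiv ℝ (jointGrad u q) y).comp (ContinuousLinearMap.inl ℝ Plane ℝ)) +
        c y.1 * regNorm ε (jointGrad u q y) := by
    filter_upwards [prod_mem_nhds hW (isOpen_Ioo.mem_nhds ht)] with y hy
    exact h.equation_joint hy.1 hy.2
  obtain ⟨e, a, d, he, e1, e2, e3⟩ := bernstein_interior (z := z) (k := k) (R := R) h.ε_pos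
    (h.contDiffAt hx ht) (h.q_smooth x₁ hxS)
    (by filter_upwards [hW] with x hx' using h.q_symm x hx')
    ((h.c_smooth.contDiffAt (closure_mem_nhds h.isOpen hx)).differentiableAt (by simp)) hpde
    (by linarith)
    (by filter_upwards [hmaxx, hjx] with x h1 h2; rw [h2, hj]; exact h1)
    (by filter_upwards [hmaxt, hjt] with t h1 h2; rw [h2, hj]; exact h1) (by rwa [hj])
  rw [hj] at e1 e2 e3
  refine le_of_bernstein h.ε_pos h.ε_lt_one hδ (regNorm_sq _ _) (regNorm_pos h.ε_pos _)
    (norm_nonneg _) hρ hk ?_ hM hc hcD (gcn := ‖∇ c x₁‖) ?_ hcond e1 e2 e3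
  · have h1 := abs_real_inner_le_norm (x₁ - z) e
    rw [he, mul_one] at h1
    rw [abs_mul, abs_mul, abs_of_nonneg hk]
    norm_num
    exact (mul_le_mul_of_nonneg_left h1 (by positivity)).trans hκ
  · have h1 := abs_real_inner_le_norm (∇ c x₁) e
    rwa [he, mul_one] at h1

end Setting

/-! ### The normal derivative at the boundary -/

/-- A function that vanishes on the boundary has vanishing tangential derivatives there. -/
lemma fderivWithin_tangent_eq_zero {W : Set Plane} (hW : IsOpen W) {x τ : Plane} {φ f : Plane → ℝ}
    {L : Plane →L[ℝ] ℝ} (hφ : IsDefiningFunctionAt W x φ) (hx : φ x = 0)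
    (hf : HasFDerivWithinAt f L (closure W) x)
    (hf0 : ∀ᶠ y in 𝓝 x, φ y = 0 → f y = 0) (hτ : inner ℝ (∇ φ x) τ = 0) : L τ = 0 := by
  set v := ∇ φ x with hv
  have hv0 : 0 < inner ℝ v v := real_inner_self_pos.2 hφ.gradient_ne_zero
  have hfx : f x = 0 := hf0.self_of_nhds hx
  have key : ∀ η : ℝ, 0 < η → η < 1 → |L τ| ≤ η * (|L v| + (‖τ‖ + ‖v‖)) := by
    intro η hη hη1
    have h1 := eventually_lt_of_hasDerivWithinAt_neg
      (hasDerivAt_line hφ.smooth x (τ - η • v)).hasDerivWithinAt (by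
        rw [← hv, inner_sub_right, inner_smul_right, hτ]; nlinarith)
    have h2 := eventually_lt_of_hasDerivWithinAt_neg
      (g := fun s => -φ (x + s • (τ + η • v)))
      (hasDerivAt_line hφ.smooth x (τ + η • v)).neg.hasDerivWithinAt (by
        rw [← hv, inner_add_right, inner_smul_right, hτ]; nlinarith)
    have h3 := hf.isLittleO.def hη
    rw [eventually_nhdsWithin_iff] at h3
    obtain ⟨d, hd, hball⟩ := Metric.eventually_nhds_iff.1 (h3.and (hf0.and hφ.eventually))
    have h4 : ∀ᶠ s in 𝓝[>] (0 : ℝ), s * (‖τ‖ + ‖v‖) < d := by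
      have : Continuous fun s : ℝ => s * (‖τ‖ + ‖v‖) := by fun_prop
      have h5 := (this.tendsto 0).mono_left (nhdsWithin_le_nhds (s := Ioi 0))
      exact h5.eventually_lt_const (by simpa using hd)
    obtain ⟨s, hs1, hs2, hs3, hs0⟩ := (h1.and (h2.and (h4.and self_mem_nhdsWithin))).exists
    have hs0' : (0 : ℝ) < s := hs0
    simp only [zero_smul, add_zero, hx, neg_zero] at hs1 hs2
    -- The boundary is met between two nearly tangential directions.
    have hcont : ContinuousOn (fun θ : ℝ => φ (x + s • (τ + θ • v))) (Icc (-η) η) :=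
      (hφ.smooth.continuous.comp (by fun_prop)).continuousOn
    obtain ⟨θ, hθ, hφθ⟩ := intermediate_value_Icc (by linarith) hcont
      (show (0 : ℝ) ∈ Icc _ _ from ⟨by
        simp only [neg_smul, ← sub_eq_add_neg]; exact hs1.le, by linarith⟩)
    simp only at hφθ
    have hθ' : |θ| ≤ η := abs_le.2 hθ
    have hnorm : ‖s • (τ + θ • v)‖ ≤ s * (‖τ‖ + ‖v‖) := by
      rw [norm_smul, Real.norm_of_nonneg hs0'.le]
      gcongr
      refine (norm_add_le _ _).trans ?_
      rw [norm_smul, Real.norm_eq_abs]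
      nlinarith [norm_nonneg v]
    obtain ⟨h5, h6, h7⟩ := hball (y := x + s • (τ + θ • v))
      (by rw [dist_eq_norm, add_sub_cancel_left]; linarith)
    have h8 := h5 (frontier_subset_closure (h7.mem_frontier hW hφθ))
    rw [h6 hφθ, hfx, add_sub_cancel_left, sub_zero, zero_sub, norm_neg, map_smul, smul_eq_mul,
      norm_mul, Real.norm_of_nonneg hs0'.le, map_add, map_smul, smul_eq_mul,
      Real.norm_eq_abs] at h8
    have h9 : s * |L τ + θ * L v| ≤ s * (η * (‖τ‖ + ‖v‖)) := by
      nlinarith [mul_le_mul_of_nonneg_left hnorm hη.le]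
    have h10 := le_of_mul_le_mul_left h9 hs0'
    have h11 : |L τ| ≤ |L τ + θ * L v| + |θ * L v| := by
      have := abs_sub (L τ + θ * L v) (θ * L v)
      simpa using this
    rw [abs_mul] at h11
    nlinarith [mul_le_mul_of_nonneg_right hθ' (abs_nonneg (L v))]
  have hlim : Tendsto (fun η : ℝ => η * (|L v| + (‖τ‖ + ‖v‖))) (𝓝[>] 0) (𝓝 0) := by
    have : Continuous fun η : ℝ => η * (|L v| + (‖τ‖ + ‖v‖)) := by fun_prop
    simpa using (this.tendsto 0).mono_left (nhdsWithin_le_nhds (s := Ioi 0))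
  have h0 : |L τ| ≤ 0 := by
    refine ge_of_tendsto hlim ?_
    filter_upwards [Ioo_mem_nhdsGT (zero_lt_one : (0 : ℝ) < 1)] with η hη
    exact key η hη.1 hη.2
  exact abs_nonpos_iff.1 h0

namespace Setting

variable {W : Set Plane} {q : Plane → Plane} {c u₀ : Plane → ℝ} {ε T : ℝ} {u : Plane × ℝ → ℝ}

lemma contDiffOn_field (h : Setting W q c u₀ ε T u) {t : ℝ} (ht : t ∈ Ioc 0 T) :
    ContDiffOn ℝ 1 (field W q u t) (closure W) :=
  (contDiffOn_gradientWithin h.uniqueDiffOn (h.contDiffOn_slice ht) (by norm_cast)).sub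
    fun x hx => ((h.q_smooth x hx).of_le (by norm_cast)).contDiffWithinAt

/-- The derivative of `D(u - θ)` is symmetric up to the boundary. -/
lemma fderivWithin_field_symm (h : Setting W q c u₀ ε T u) {t : ℝ} (ht : t ∈ Ioc 0 T) {x : Plane}
    (hx : x ∈ closure W) (v w : Plane) :
    inner ℝ v (fderivWithin ℝ (field W q u t) (closure W) x w) =
      inner ℝ w (fderivWithin ℝ (field W q u t) (closure W) x v) := by
  have hc : ∀ v w : Plane, ContinuousOn (fun x => inner ℝ v
      (fderivWithin ℝ (field W q u t) (closure W) x w)) (closure W) := fun v w =>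
    continuousOn_const.inner (((h.contDiffOn_field ht).continuousOn_fderivWithin h.uniqueDiffOn
      (by simp)).clm_apply continuousOn_const)
  have key : ∀ x ∈ W, inner ℝ v (fderivWithin ℝ (field W q u t) (closure W) x w) =
      inner ℝ w (fderivWithin ℝ (field W q u t) (closure W) x v) := by
    intro x hx
    have hS := closure_mem_nhds h.isOpen hx
    have hu : ContDiffAt ℝ ∞ (fun y => u (y, t)) x := (h.contDiffOn_slice ht).contDiffAt hS
    have hu2 : DifferentiableAt ℝ (fderiv ℝ fun y => u (y, t)) x :=
      (hu.fderiv_right (m := 1) (by norm_cast)).differentiableAt (by simp)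
    have h1 : ∀ v : Plane, (fun y => inner ℝ v (field W q u t y)) =ᶠ[𝓝 x]
        (fun y => fderiv ℝ (fun y => u (y, t)) y v) - fun y => inner ℝ v (q y) := by
      intro v
      filter_upwards [gradientWithin_closure_eventuallyEq h.isOpen hx fun y => u (y, t)] with y hy
      rw [field, hy, inner_sub_right, real_inner_comm, inner_gradient_left]
      rfl
    have hfd : HasFDerivAt (field W q u t) (fderivWithin ℝ (field W q u t) (closure W) x) x :=
      (((h.contDiffOn_field ht).differentiableOn (by simp)) x
        (subset_closure hx)).hasFDerivWithinAt.hasFDerivAt hS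
    have h2 : ∀ v w : Plane, inner ℝ v (fderivWithin ℝ (field W q u t) (closure W) x w) =
        fderiv ℝ (fun y => fderiv ℝ (fun y => u (y, t)) y v) x w -
          inner ℝ v (fderiv ℝ q x w) := by
      intro v w
      have e1 : HasFDerivAt (fun y => inner ℝ v (field W q u t y)) _ x :=
        (innerSL ℝ v).hasFDerivAt.comp x hfd
      have e2 : HasFDerivAt (fun y => inner ℝ v (q y)) _ x :=
        (innerSL ℝ v).hasFDerivAt.comp x
          ((h.q_smooth x (subset_closure hx)).differentiableAt (by simp)).hasFDerivAt
      have e3 := (hu2.clm_apply (differentiableAt_const v)).hasFDerivAt.sub e2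
      have e4 := congrArg (fun L => L w) ((e1.congr_of_eventuallyEq (h1 v).symm).unique e3)
      simpa using e4
    rw [h2, h2, fderiv_fderiv_comm (hu.of_le (by norm_cast)), h.q_symm x hx]
  exact le_antisymm (le_on_closure (hc v w) (hc w v) (fun y hy => (key y hy).le) x hx)
    (le_on_closure (hc w v) (hc v w) (fun y hy => (key y hy).ge) x hx)

/-- Differentiating the boundary condition along the boundary expresses the normal derivative of
`|D(u - θ)|² / 2` through the curvature. -/
lemma inner_field_normal_derivative (h : Setting W q c u₀ ε T u) {t : ℝ} (ht : t ∈ Ioc 0 T)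
    {x : Plane} {φ : Plane → ℝ} (hx : x ∈ frontier W) (hφ : IsDefiningFunctionAt W x φ) :
    inner ℝ (field W q u t x) (fderivWithin ℝ (field W q u t) (closure W) x
      (‖∇ φ x‖⁻¹ • ∇ φ x)) =
      -(divergence (fun y => ‖∇ φ y‖⁻¹ • ∇ φ y) x) * ‖field W q u t x‖ ^ 2 := by
  have ht' : t ∈ Icc 0 T := ⟨ht.1.le, ht.2⟩
  have hxS := frontier_subset_closure hx
  set p := field W q u t with hp
  set X := fderivWithin ℝ p (closure W) x with hX
  have hpX : HasFDerivWithinAt p X (closure W) x :=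
    (((h.contDiffOn_field ht).differentiableOn (by simp)) x hxS).hasFDerivWithinAt
  have hgφ : DifferentiableAt ℝ (∇ φ) x :=
    (InnerProductSpace.toDual ℝ Plane).symm.toContinuousLinearEquiv.differentiableAt.comp x
      ((hφ.smooth.contDiffAt.fderiv_right (m := 1) (by norm_cast)).differentiableAt (by simp))
  obtain ⟨b, hb⟩ := exists_frame hφ.gradient_ne_zero
  have hg0 : 0 < ‖∇ φ x‖ := norm_pos_iff.2 hφ.gradient_ne_zero
  have hgb : ∇ φ x = ‖∇ φ x‖ • b 0 := by rw [hb, smul_smul, mul_inv_cancel₀ hg0.ne', one_smul]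
  have hneu : ∀ y, IsDefiningFunctionAt W y φ → φ y = 0 → inner ℝ (p y) (∇ φ y) = 0 := by
    intro y h1 h2
    have h3 := h.sol.neumann y _ (h1.isOutwardUnitNormal (h1.mem_frontier h.isOpen h2)) t ht'
    rw [inner_smul_right] at h3
    exact (mul_eq_zero.1 h3).resolve_left (inv_ne_zero (norm_ne_zero_iff.2 h1.gradient_ne_zero))
  have hφ0 := hφ.eq_zero h.isOpen hx
  have htan := fderivWithin_tangent_eq_zero h.isOpen (τ := b 1) hφ hφ0
    (hpX.inner ℝ hgφ.hasFDerivAt.hasFDerivWithinAt)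
    (by filter_upwards [hφ.eventually] with y hy using hneu y hy)
    (by rw [hgb]; simp [inner_smul_left])
  have hpx : p x = inner ℝ (b 1) (p x) • b 1 := by
    have h1 := hneu x hφ hφ0
    rw [hgb, inner_smul_right, real_inner_comm] at h1
    have h2 := (mul_eq_zero.1 h1).resolve_left hg0.ne'
    conv_lhs => rw [eq_frame b (p x)]
    rw [h2, zero_smul, zero_add]
  have hcurv := divergence_normalized_gradient hgφ.hasFDerivAt b hφ.gradient_ne_zero hb
  set κ := divergence (fun y => ‖∇ φ y‖⁻¹ • ∇ φ y) x
  set σ := inner ℝ (b 1) (p x) with hσ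
  have hnorm : ‖p x‖ ^ 2 = σ ^ 2 := by
    rw [hpx, norm_smul, b.norm_eq_one, mul_one, Real.norm_eq_abs, sq_abs]
  simp only [ContinuousLinearMap.comp_apply, ContinuousLinearMap.prod_apply,
    fderivInnerCLM_apply] at htan
  rw [hpx, inner_smul_left, ← hcurv] at htan
  conv at htan => lhs; rw [hgb, inner_smul_right, norm_smul, norm_norm, b.norm_eq_one]
  simp only [conj_trivial, mul_one] at htan
  rw [← hb, hnorm, h.fderivWithin_field_symm ht hxS, ← hp, ← hX]
  conv_lhs => rw [hpx, map_smul, inner_smul_right, real_inner_comm]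
  have h5 : ‖∇ φ x‖ * (σ * κ + inner ℝ (X (b 1)) (b 0)) = 0 := by linear_combination htan
  have h6 := (mul_eq_zero.1 h5).resolve_left hg0.ne'
  linear_combination σ * h6

end Setting

/-! ### The gradient estimate -/

lemma multiplier_le {z x : Plane} {k R : ℝ} (hk : 0 ≤ k) :
    multiplier z k R x ≤ 1 + k * R ^ 2 := by
  unfold multiplier
  nlinarith [mul_nonneg hk (sq_nonneg ‖x - z‖)]

lemma continuous_multiplier (z : Plane) (k R : ℝ) : Continuous (multiplier z k R) := by
  unfold multiplier
  fun_prop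

namespace Setting

variable {W : Set Plane} {q : Plane → Plane} {c u₀ : Plane → ℝ} {ε T : ℝ} {u : Plane × ℝ → ℝ}

/-- At a boundary point, the product of the regularized length of `D(u - θ)` and a multiplier with
inward normal derivative `2 C` increases strictly in the inward normal direction, because the curvature of the boundary
is at least `-C`. -/
lemma eventually_lt_multiplier_mul (h : Setting W q c u₀ ε T u) {C k R t : ℝ} (hC : 0 < C)
    (hkR : k * R = C) (hcurv : ∀ x κ, IsBoundaryCurvature W x κ → -κ ≤ C) {x : Plane}
    {φ : Plane → ℝ} (hx : x ∈ frontier W) (hφ : IsDefiningFunctionAt W x φ) (ht : t ∈ Ioc 0 T) :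
    ∀ᶠ s in 𝓝[>] (0 : ℝ), regNorm ε (field W q u t x) <
      multiplier (x - R • (‖∇ φ x‖⁻¹ • ∇ φ x)) k R (x + s • (-(‖∇ φ x‖⁻¹ • ∇ φ x))) *
        regNorm ε (field W q u t (x + s • (-(‖∇ φ x‖⁻¹ • ∇ φ x)))) := by
  have hxS := frontier_subset_closure hx
  have hform := h.inner_field_normal_derivative ht hx hφ
  have hκ := hcurv x _ ⟨hx, φ, hφ, rfl⟩
  set κ := divergence (fun y => ‖∇ φ y‖⁻¹ • ∇ φ y) x
  have hg0 : 0 < ‖∇ φ x‖ := norm_pos_iff.2 hφ.gradient_ne_zero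
  set n := ‖∇ φ x‖⁻¹ • ∇ φ x with hn
  have hn1 : ‖n‖ = 1 := by
    rw [hn, norm_smul, norm_inv, norm_norm, inv_mul_cancel₀ hg0.ne']
  have hadm : ∀ᶠ s in 𝓝[>] (0 : ℝ), x + s • (-n) ∈ W := by
    refine hφ.eventually_add_smul_mem (hφ.eq_zero h.isOpen hx) ?_
    rw [inner_neg_right, hn, inner_smul_right, real_inner_self_eq_norm_sq]
    have : 0 < ‖∇ φ x‖⁻¹ * ‖∇ φ x‖ ^ 2 := by positivity
    linarith
  set p := field W q u t with hp
  have hpX : HasFDerivWithinAt p (fderivWithin ℝ p (closure W) x) (closure W) x :=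
    (((h.contDiffOn_field ht).differentiableOn (by simp)) x hxS).hasFDerivWithinAt
  have h1 := hasDerivWithinAt_segment hpX hadm
  have hw0 : 0 < regNorm ε (p x) := regNorm_pos h.ε_pos _
  have h2 : HasDerivWithinAt (fun s : ℝ => regNorm ε (p (x + s • (-n)))) _ (Ioi 0) 0 :=
    (h1.norm_sq.const_add (ε ^ 2)).sqrt (by have := h.ε_pos; positivity)
  have h3 := (hasDerivAt_multiplier_line (x - R • n) k R x (-n) 0).hasDerivWithinAt
    (s := Ioi 0)
  have h4 := (h3.mul h2).neg
  have hmul : multiplier (x - R • n) k R x = 1 := by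
    simp [multiplier, norm_smul, hn1]
  have h5 := eventually_lt_of_hasDerivWithinAt_neg h4 (by
    have hinner : inner ℝ (x - (x - R • n)) (-n) = -R := by
      rw [sub_sub_cancel, inner_neg_right, inner_smul_left, real_inner_self_eq_norm_sq, hn1]
      simp
    have hsq : √(ε ^ 2 + ‖p x‖ ^ 2) = regNorm ε (p x) := rfl
    simp only [zero_smul, add_zero, hinner, hmul, map_neg, inner_neg_right, hform, hsq]
    have hwp : ‖p x‖ ^ 2 ≤ regNorm ε (p x) ^ 2 := by
      rw [regNorm_sq]; linarith [sq_nonneg ε]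
    have h6 : -(κ * ‖p x‖ ^ 2 / regNorm ε (p x)) ≤ C * regNorm ε (p x) := by
      rw [← neg_div, div_le_iff₀ hw0]
      have := mul_le_mul_of_nonneg_right hκ (sq_nonneg ‖p x‖)
      have := mul_le_mul_of_nonneg_left hwp hC.le
      linarith
    have h7 : 2 * -(-κ * ‖p x‖ ^ 2) / (2 * regNorm ε (p x)) =
        κ * ‖p x‖ ^ 2 / regNorm ε (p x) := by
      field_simp
    have h8 : -2 * k * -R = 2 * C := by rw [← hkR]; ring
    rw [h7, h8]
    have := mul_pos hC hw0
    linarith)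
  filter_upwards [h5] with s hs
  simp only [Pi.neg_apply, Pi.mul_apply, zero_smul, add_zero, hmul, one_mul] at hs
  linarith

/-- A maximum of the regularized gradient on the boundary is transferred to an interior maximum by a
multiplier on an interior ball that touches the boundary there. -/
theorem regNorm_le_of_boundary_max (h : Setting W q c u₀ ε T u) {M D δ C K w₀ : ℝ} (hδ : 0 < δ)
    (hM : ∀ x ∈ closure W, ∀ t ∈ Icc 0 T, |derivWithin (fun s => u (x, s)) (Icc 0 T) t| ≤ M)
    (hc : ∀ x ∈ W, 0 < c x) (hcD : ∀ x ∈ W, c x ≤ D) (hC : 0 < C) (hK : 0 < K)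
    (hcurv : ∀ x κ, IsBoundaryCurvature W x κ → -κ ≤ C)
    (hball : ∀ x φ, x ∈ frontier W → IsDefiningFunctionAt W x φ →
      ball (x - (K / 2) • (‖∇ φ x‖⁻¹ • ∇ φ x)) (K / 2) ⊆ W)
    (hcond : ∀ x ∈ W, δ ≤ c x ^ 2 - ‖∇ c x‖ - 2 * C * c x - 2 * (2 * C / K))
    (hw₀ : ∀ x ∈ closure W, regNorm ε (field W q u 0 x) ≤ w₀) {x₀ : Plane} {t₀ : ℝ}
    (hxf : x₀ ∈ frontier W) (ht₀ : t₀ ∈ Ioo 0 T)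
    (hmax : ∀ y ∈ closure W, ∀ s ∈ Icc 0 t₀,
      regNorm ε (field W q u s y) ≤ regNorm ε (field W q u t₀ x₀)) {Λ : ℝ} (hw₀0 : 0 ≤ w₀)
    (hΛ0 : 0 ≤ Λ) (hΛ : 2 + (2 * (2 * C / K) + 2 * D * (M + 2 * C)) / δ ≤ Λ) :
    regNorm ε (field W q u t₀ x₀) ≤ (1 + C * K / 2) * (w₀ + Λ) := by
  have hpos := ht₀.1
  have ht₀T := ht₀.2
  have hCK : 0 ≤ C * K / 2 := by positivity
  have hcont : ContinuousOn (fun z : Plane × ℝ => regNorm ε (field W q u z.2 z.1))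
      (closure W ×ˢ Icc 0 t₀) :=
    h.continuousOn_regNorm_field.mono (prod_mono subset_rfl (Icc_subset_Icc_right ht₀T.le))
  obtain ⟨φ, hφ⟩ := h.smooth x₀ hxf
  have hR : 0 < K / 2 := by positivity
  have hkR : 2 * C / K * (K / 2) = C := by field_simp
  have hk0 : 0 ≤ 2 * C / K := by positivity
  have hev := h.eventually_lt_multiplier_mul hC hkR hcurv hxf hφ ⟨hpos, ht₀T.le⟩
  have hbW := hball x₀ φ hxf hφ
  have hg0 : 0 < ‖∇ φ x₀‖ := norm_pos_iff.2 hφ.gradient_ne_zero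
  set n := ‖∇ φ x₀‖⁻¹ • ∇ φ x₀ with hn
  have hn1 : ‖n‖ = 1 := by
    rw [hn, norm_smul, norm_inv, norm_norm, inv_mul_cancel₀ hg0.ne']
  set R := K / 2 with hRdef
  set k := 2 * C / K with hkdef
  set z := x₀ - R • n with hz
  have hbS : closedBall z R ⊆ closure W := by
    rw [← closure_ball z hR.ne']
    exact closure_mono hbW
  obtain ⟨s, hs, hs0, hsR⟩ := (hev.and (Ioo_mem_nhdsGT (by positivity : 0 < 2 * R))).exists
  have hsb : x₀ + s • (-n) ∈ closedBall z R := by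
    rw [mem_closedBall, dist_eq_norm, hz,
      show x₀ + s • (-n) - (x₀ - R • n) = (R - s) • n by rw [sub_smul, smul_neg]; abel,
      norm_smul, hn1, mul_one, Real.norm_eq_abs, abs_le]
    constructor <;> linarith
  obtain ⟨⟨x₁, t₁⟩, ⟨hx₁, ht₁⟩, hmax₁⟩ :=
    ((isCompact_closedBall z R).prod (isCompact_Icc (a := 0) (b := t₀))).exists_isMaxOn
      ⟨(x₀ + s • (-n), t₀), hsb, hpos.le, le_rfl⟩
      (((continuous_multiplier z k R).comp continuous_fst).continuousOn.mul
        (hcont.mono (prod_mono hbS subset_rfl)))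
  simp only at hx₁ ht₁
  have hmax₁' : ∀ y ∈ closedBall z R, ∀ τ ∈ Icc 0 t₀,
      multiplier z k R y * regNorm ε (field W q u τ y) ≤
        multiplier z k R x₁ * regNorm ε (field W q u t₁ x₁) := fun y hy τ hτ =>
    isMaxOn_iff.1 hmax₁ (y, τ) ⟨hy, hτ⟩
  have hlt := hs.trans_le (hmax₁' _ hsb t₀ ⟨hpos.le, le_rfl⟩)
  have hle := hmax x₁ (hbS hx₁) t₁ (ht₁)
  have hw1 : 0 < regNorm ε (field W q u t₁ x₁) := regNorm_pos h.ε_pos _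
  -- The multiplier exceeds `1` at the new maximum, which therefore lies in the open ball.
  have hmul1 : 1 < multiplier z k R x₁ := by
    by_contra hcon
    have := mul_le_mul_of_nonneg_right (not_lt.1 hcon) hw1.le
    linarith
  have hx₁b : x₁ ∈ ball z R := by
    rw [mem_ball, dist_eq_norm]
    by_contra hcon
    have h1 : R ^ 2 ≤ ‖x₁ - z‖ ^ 2 := pow_le_pow_left₀ hR.le (not_lt.1 hcon) 2
    have h2 : k * (R ^ 2 - ‖x₁ - z‖ ^ 2) ≤ 0 :=
      mul_nonpos_of_nonneg_of_nonpos hk0 (by linarith)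
    unfold multiplier at hmul1
    linarith
  have hx₁W := hbW hx₁b
  have hbound : regNorm ε (field W q u t₁ x₁) ≤ w₀ + Λ := by
    rcases ht₁.1.eq_or_lt with h0 | hpos₁
    · rw [← h0]
      linarith [hw₀ x₁ (hbS hx₁)]
    · have h1 := h.regNorm_le_of_interior_max (M := M) (D := D) (δ := δ) (κ := 2 * C) (k := k)
        (R := R) (z := z) hδ hx₁W ⟨hpos₁, ht₁.2.trans_lt ht₀T⟩
        (hM x₁ (hbS hx₁) t₁ ⟨ht₁.1, ht₁.2.trans ht₀.2.le⟩) (hc x₁ hx₁W) (hcD x₁ hx₁W) hk0 hmul1.le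
        (by
          have h2 : ‖x₁ - z‖ ≤ R := by rw [← dist_eq_norm]; exact hx₁
          have := mul_le_mul_of_nonneg_left h2 hk0
          linarith)
        (hcond x₁ hx₁W)
        (by
          filter_upwards [isOpen_ball.mem_nhds hx₁b] with y hy
          exact hmax₁' y (ball_subset_closedBall hy) t₁ ht₁)
        (by
          filter_upwards [Ioo_mem_nhdsLT hpos₁] with τ hτ
          exact le_of_mul_le_mul_left (hmax₁' x₁ hx₁ τ ⟨hτ.1.le, hτ.2.le.trans ht₁.2⟩)
            (by linarith))
      linarith
  have hm : multiplier z k R x₁ ≤ 1 + C * K / 2 := by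
    refine (multiplier_le hk0).trans (le_of_eq ?_)
    rw [hkdef, hRdef]
    field_simp
  calc regNorm ε (field W q u t₀ x₀) ≤ multiplier z k R x₁ * regNorm ε (field W q u t₁ x₁) :=
        hlt.le
    _ ≤ (1 + C * K / 2) * (w₀ + Λ) :=
        mul_le_mul hm hbound hw1.le (by linarith)

/-- The global bound of the regularized gradient. -/
theorem regNorm_field_le (h : Setting W q c u₀ ε T u) {M D δ C K w₀ : ℝ} (hδ : 0 < δ)
    (hM : ∀ x ∈ closure W, ∀ t ∈ Icc 0 T, |derivWithin (fun s => u (x, s)) (Icc 0 T) t| ≤ M)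
    (hc : ∀ x ∈ W, 0 < c x) (hcD : ∀ x ∈ W, c x ≤ D) (hC : 0 < C) (hK : 0 < K)
    (hcurv : ∀ x κ, IsBoundaryCurvature W x κ → -κ ≤ C)
    (hball : ∀ x φ, x ∈ frontier W → IsDefiningFunctionAt W x φ →
      ball (x - (K / 2) • (‖∇ φ x‖⁻¹ • ∇ φ x)) (K / 2) ⊆ W)
    (hcond : ∀ x ∈ W, δ ≤ c x ^ 2 - 2 * ‖∇ c x‖ - 2 * C * |c x| - 8 * C / K)
    (hw₀ : ∀ x ∈ closure W, regNorm ε (field W q u 0 x) ≤ w₀) {x : Plane} {t : ℝ}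
    (hx : x ∈ closure W) (ht : t ∈ Ico 0 T) :
    regNorm ε (field W q u t x) ≤
      (1 + C * K / 2) * (w₀ + (2 + (2 * (2 * C / K) + 2 * D * (M + 2 * C)) / δ)) := by
  have hM0 : 0 ≤ M := (abs_nonneg _).trans (hM x hx t ⟨ht.1, ht.2.le⟩)
  have hD0 : 0 ≤ D := by
    obtain ⟨y, hy⟩ := closure_nonempty_iff.1 ⟨x, hx⟩
    exact (hc y hy).le.trans (hcD y hy)
  have hw₀0 : 0 ≤ w₀ := (regNorm_nonneg _ _).trans (hw₀ x hx)
  set Λ := 2 + (2 * (2 * C / K) + 2 * D * (M + 2 * C)) / δ with hΛ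
  have hΛ0 : 0 ≤ Λ := by positivity
  have hCK : 0 ≤ C * K / 2 := by positivity
  have hbig : w₀ + Λ ≤ (1 + C * K / 2) * (w₀ + Λ) :=
    le_mul_of_one_le_left (by positivity) (by linarith)
  have hsub : Icc 0 t ⊆ Icc 0 T := Icc_subset_Icc_right ht.2.le
  have hcont : ContinuousOn (fun z : Plane × ℝ => regNorm ε (field W q u z.2 z.1))
      (closure W ×ˢ Icc 0 t) :=
    h.continuousOn_regNorm_field.mono (prod_mono subset_rfl hsub)
  obtain ⟨⟨x₀, t₀⟩, ⟨hx₀, ht₀⟩, hmax⟩ :=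
    (h.bounded.isCompact_closure.prod isCompact_Icc).exists_isMaxOn
      ⟨(x, t), hx, ht.1, le_rfl⟩ hcont
  simp only at hx₀ ht₀
  have hmax' : ∀ y ∈ closure W, ∀ s ∈ Icc 0 t,
      regNorm ε (field W q u s y) ≤ regNorm ε (field W q u t₀ x₀) := fun y hy s hs =>
    isMaxOn_iff.1 hmax (y, s) ⟨hy, hs⟩
  refine (hmax' x hx t ⟨ht.1, le_rfl⟩).trans ?_
  rcases ht₀.1.eq_or_lt with h0 | hpos
  · rw [← h0]
    linarith [hw₀ x₀ hx₀]
  have ht₀T : t₀ < T := ht₀.2.trans_lt ht.2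
  have hcond' : ∀ y ∈ W, δ ≤ c y ^ 2 - ‖∇ c y‖ - 2 * C * c y - 2 * (2 * C / K) := fun y hy => by
    have h1 := hcond y hy
    rw [abs_of_pos (hc y hy)] at h1
    have h2 : 8 * C / K = 2 * (2 * C / K) + 2 * (2 * C / K) := by ring
    have h3 : 0 ≤ 2 * C / K := by positivity
    linarith [norm_nonneg (∇ c y)]
  by_cases hxW : x₀ ∈ W
  · -- An interior maximum: the constant multiplier `1` suffices.
    have hone : ∀ y, multiplier x₀ 0 0 y = 1 := fun y => by simp [multiplier]
    have hC2 : 0 ≤ 2 * C * c x₀ := by have := hc x₀ hxW; positivity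
    have hCK2 : 0 ≤ 2 * C / K := by positivity
    have h1 := h.regNorm_le_of_interior_max (M := M) (D := D) (δ := δ) (κ := 0) (k := 0) (R := 0)
      (z := x₀) hδ hxW ⟨hpos, ht₀T⟩ (hM x₀ hx₀ t₀ (hsub ht₀)) (hc x₀ hxW) (hcD x₀ hxW) le_rfl
      (by rw [hone]) (by simp) (by linarith [hcond' x₀ hxW])
      (by
        filter_upwards [h.isOpen.mem_nhds hxW] with y hy
        rw [hone, hone, one_mul, one_mul]
        exact hmax' y (subset_closure hy) t₀ ht₀)
      (by
        filter_upwards [Ioo_mem_nhdsLT hpos] with s hs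
        exact hmax' x₀ hx₀ s ⟨hs.1.le, hs.2.le.trans ht₀.2⟩)
    have h2 : (2 * 0 + 2 * D * (M + 0)) / δ ≤
        (2 * (2 * C / K) + 2 * D * (M + 2 * C)) / δ := by
      gcongr
      linarith
    linarith
  · have hxf : x₀ ∈ frontier W := by rw [h.isOpen.frontier_eq]; exact ⟨hx₀, hxW⟩
    exact h.regNorm_le_of_boundary_max hδ hM hc hcD hC hK hcurv hball hcond' hw₀ hxf ⟨hpos, ht₀T⟩
      (fun y hy s hs => hmax' y hy s ⟨hs.1, hs.2.trans ht₀.2⟩) hw₀0 hΛ0 hΛ.ge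

end Setting

/-! ### The constants of the punctured domain, and the conclusion -/

/-- Every removed disc contributes the curvature `-1/r`, so that the bound for the negative
curvatures is positive. -/
lemma pos_of_isGreatest_negCurvatures {N : ℕ} {Ω : Set Plane} {a : Fin N → Plane} {r C : ℝ}
    (hΩ : IsOpen Ω) (hN : 0 < N) (hr : 0 < r) (hsub : ∀ j, closedBall (a j) r ⊆ Ω)
    (hdisj : ∀ i j, i ≠ j → Disjoint (closedBall (a i) r) (closedBall (a j) r))
    (hC : IsGreatest (negCurvatures (puncturedDomain Ω a r)) C) : 0 < C := by
  set j : Fin N := ⟨0, hN⟩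
  set x : Plane := a j + EuclideanSpace.single 0 r with hx
  have hnorm : ‖x - a j‖ = r := by
    rw [hx, add_sub_cancel_left, PiLp.norm_single, Real.norm_of_nonneg hr.le]
  have hxs : x ∈ sphere (a j) r := by rw [mem_sphere, dist_eq_norm, hnorm]
  have hφ := isDefiningFunctionAt_of_mem_sphere hΩ hr hsub hdisj hxs
  have hφ0 : discComplement (a j) r x = 0 := by rw [discComplement, hnorm, sub_self]
  have hgrad : ∇ (discComplement (a j) r) = fun y => (-2 : ℝ) • (y - a j) :=
    funext fun y => gradient_discComplement (a j) r y
  have hH : HasFDerivAt (∇ (discComplement (a j) r))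
      ((-2 : ℝ) • ContinuousLinearMap.id ℝ Plane) x := by
    rw [hgrad]
    exact ((hasFDerivAt_id x).sub_const (a j)).const_smul (-2 : ℝ)
  obtain ⟨b, hb⟩ := exists_frame hφ.gradient_ne_zero
  have hcurv := divergence_normalized_gradient hH b hφ.gradient_ne_zero hb
  have hle := hC.2 ⟨x, _, ⟨hφ.mem_frontier (isOpen_puncturedDomain hΩ) hφ0, _, hφ, rfl⟩, rfl⟩
  have hneg : ‖∇ (discComplement (a j) r) x‖ * divergence
      (fun y => ‖∇ (discComplement (a j) r) y‖⁻¹ • ∇ (discComplement (a j) r) y) x < 0 := by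
    rw [hcurv]
    simp [inner_smul_right]
  have := neg_of_mul_neg_right hneg (norm_nonneg _)
  linarith

/-- A solution on `[0, ∞)` restricts to a solution on `[0, T]`. -/
lemma IsRegularizedSolution.restrict {W : Set Plane} {q : Plane → Plane} {c u₀ : Plane → ℝ}
    {ε T : ℝ} {u : Plane × ℝ → ℝ} (hT : 0 < T)
    (h : IsRegularizedSolution W q c u₀ ε (Ici 0) u) :
    IsRegularizedSolution W q c u₀ ε (Icc 0 T) u ∧
      ∀ x ∈ closure W, ∀ t ∈ Icc 0 T, derivWithin (fun s => u (x, s)) (Icc 0 T) t =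
        derivWithin (fun s => u (x, s)) (Ici 0) t := by
  have hsub : Icc 0 T ⊆ Ici 0 := Icc_subset_Ici_self
  have hd : ∀ x ∈ closure W, ∀ t ∈ Icc 0 T, derivWithin (fun s => u (x, s)) (Icc 0 T) t =
      derivWithin (fun s => u (x, s)) (Ici 0) t := by
    intro x hx t ht
    have h1 : ContDiffOn ℝ 1 (fun s => u (x, s)) (Ici 0) :=
      h.contDiffOn_one.comp (by fun_prop) fun s hs => ⟨hx, hs⟩
    exact derivWithin_subset hsub (uniqueDiffOn_Icc hT t ht)
      (h1.differentiableOn (by simp) t (hsub ht))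
  refine ⟨⟨?_, ?_, ?_, fun x n hn t ht => h.neumann x n hn t (hsub ht), h.initial⟩, hd⟩
  · exact h.smooth.mono (prod_mono subset_rfl (sdiff_subset_sdiff_left hsub))
  · exact h.contDiffOn_one.mono (prod_mono subset_rfl hsub)
  · intro x hx t ht
    rw [hd x (subset_closure hx) t ht.1]
    exact h.equation x hx t ⟨hsub ht.1, ht.2⟩

lemma norm_fderiv_gradient_le {f : Plane → ℝ} {x : Plane}
    (hf : DifferentiableAt ℝ (fderiv ℝ f) x) : ‖fderiv ℝ (∇ f) x‖ ≤ ‖fderiv ℝ (fderiv ℝ f) x‖ := by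
  refine ContinuousLinearMap.opNorm_le_bound _ (by positivity) fun v => ?_
  have h1 := (InnerProductSpace.toDual ℝ Plane).symm.toContinuousLinearEquiv.hasFDerivAt.comp x
    hf.hasFDerivAt
  have h2 : HasFDerivAt (∇ f) _ x := h1
  rw [h2.fderiv]
  have h3 : ∀ L, ‖(InnerProductSpace.toDual ℝ Plane).symm.toContinuousLinearEquiv L‖ = ‖L‖ :=
    fun L => (InnerProductSpace.toDual ℝ Plane).symm.norm_map L
  rw [ContinuousLinearMap.comp_apply]
  exact (h3 _).le.trans (ContinuousLinearMap.le_opNorm _ v)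

/-- The estimate on a bounded time interval, with an explicit constant. -/
theorem Setting.bounds {W : Set Plane} {q : Plane → Plane} {c u₀ : Plane → ℝ} {ε T : ℝ}
    {u : Plane × ℝ → ℝ} (h : Setting W q c u₀ ε T u) {A B D C K δ : ℝ} (hδ : 0 < δ)
    (hC : 0 < C) (hK : 0 < K) (hc : ∀ x ∈ closure W, 0 < c x)
    (hcurv : ∀ x κ, IsBoundaryCurvature W x κ → -κ ≤ C)
    (hball : ∀ x φ, x ∈ frontier W → IsDefiningFunctionAt W x φ →
      ball (x - (K / 2) • (‖∇ φ x‖⁻¹ • ∇ φ x)) (K / 2) ⊆ W)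
    (hcond : ∀ x ∈ W, δ ≤ c x ^ 2 - 2 * ‖∇ c x‖ - 2 * C * |c x| - 8 * C / K)
    (hA1 : ∀ x ∈ W, ‖fderiv ℝ u₀ x‖ ≤ A) (hA2 : ∀ x ∈ W, ‖fderiv ℝ (fderiv ℝ u₀) x‖ ≤ A)
    (hB1 : ∀ x ∈ W, ‖q x‖ ≤ B) (hB2 : ∀ x ∈ W, ‖fderiv ℝ q x‖ ≤ B)
    (hD : ∀ x ∈ W, |c x| ≤ D) {M : ℝ} (hM : M = 3 * (A + B) + D * (1 + A + B)) {x : Plane} {t : ℝ}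
    (hx : x ∈ W) (ht : t ∈ Icc 0 T) :
    |derivWithin (fun s => u (x, s)) (Icc 0 T) t| ≤ M ∧
      ‖∇ (fun y => u (y, t)) x‖ ≤ (1 + C * K / 2) *
        ((1 + A + B) + (2 + (2 * (2 * C / K) + 2 * D * (M + 2 * C)) / δ)) + B := by
  have hW := h.isOpen
  have hop : ∀ y ∈ closure W, |pdeOp (closure W) q c ε u₀ y| ≤ M := by
    refine le_on_closure (continuousOn_pdeOp h.uniqueDiffOn h.ε_pos h.u₀_smooth h.q_smooth
      h.c_smooth.continuousOn).abs continuousOn_const fun y hy => ?_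
    rw [hM]
    have hu : ContDiffAt ℝ 2 u₀ y := h.u₀_smooth.contDiffAt (closure_mem_nhds hW hy)
    have hg := gradientWithin_closure_eventuallyEq hW hy u₀
    refine abs_pdeOp_le h.ε_pos h.ε_lt_one ?_ ?_ (hB1 y hy) (hB2 y hy) (hD y hy)
    · rw [norm_gradientWithin, fderivWithin_of_mem_nhds (closure_mem_nhds hW hy)]
      exact hA1 y hy
    · rw [fderivWithin_of_mem_nhds (closure_mem_nhds hW hy), hg.fderiv_eq]
      exact (norm_fderiv_gradient_le
        ((hu.fderiv_right (m := 1) (by norm_num)).differentiableAt (by simp))).trans (hA2 y hy)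
  have hut : ∀ y ∈ closure W, ∀ t ∈ Icc 0 T,
      |derivWithin (fun s => u (y, s)) (Icc 0 T) t| ≤ M := fun y hy t ht =>
    h.abs_derivWithin_time_le hop hy ht
  have hw₀ : ∀ y ∈ closure W, regNorm ε (Setting.field W q u 0 y) ≤ 1 + A + B := by
    have h0 : (0 : ℝ) ∈ Icc 0 T := ⟨le_rfl, h.T_pos.le⟩
    refine le_on_closure ?_ continuousOn_const fun y hy => ?_
    · exact h.continuousOn_regNorm_field.comp (f := fun y : Plane => (y, (0 : ℝ))) (by fun_prop)
        fun y hy => ⟨hy, h0⟩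
    · have h1 : gradientWithin (fun y => u (y, 0)) (closure W) y =
          gradientWithin u₀ (closure W) y := by
        rw [gradientWithin, gradientWithin,
          fderivWithin_congr h.sol.initial (h.sol.initial y (subset_closure hy))]
      have h2 := regNorm_le h.ε_pos.le (Setting.field W q u 0 y)
      have h3 := norm_sub_le (gradientWithin u₀ (closure W) y) (q y)
      rw [norm_gradientWithin, fderivWithin_of_mem_nhds (closure_mem_nhds hW hy)] at h3
      rw [Setting.field, h1] at h2 ⊢
      linarith [hA1 y hy, hB1 y hy, h.ε_lt_one]
  have hxS := subset_closure hx
  refine ⟨hut x hxS t ht, ?_⟩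
  have hIco : ∀ s ∈ Ico 0 T, regNorm ε (Setting.field W q u s x) ≤ (1 + C * K / 2) *
      ((1 + A + B) + (2 + (2 * (2 * C / K) + 2 * D * (M + 2 * C)) / δ)) := fun s hs =>
    h.regNorm_field_le hδ hut (fun y hy => hc y (subset_closure hy))
      (fun y hy => (le_abs_self _).trans (hD y hy)) hC hK hcurv hball hcond hw₀ hxS hs
  -- The estimate extends to the final time by continuity.
  have hIcc : regNorm ε (Setting.field W q u t x) ≤ (1 + C * K / 2) *
      ((1 + A + B) + (2 + (2 * (2 * C / K) + 2 * D * (M + 2 * C)) / δ)) := by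
    have hcont : ContinuousOn (fun s => regNorm ε (Setting.field W q u s x)) (Icc 0 T) :=
      h.continuousOn_regNorm_field.comp (f := fun s : ℝ => (x, s)) (by fun_prop)
        fun s hs => ⟨hxS, hs⟩
    have htc : t ∈ closure (Ico 0 T) := by rwa [closure_Ico h.T_pos.ne]
    exact ContinuousWithinAt.closure_le htc ((hcont t ht).mono Ico_subset_Icc_self)
      continuousWithinAt_const hIco
  have h1 := (gradientWithin_closure_eventuallyEq hW hx fun y => u (y, t)).self_of_nhds
  have h2 := norm_le_regNorm ε (Setting.field W q u t x)
  rw [Setting.field, h1] at h2 hIcc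
  have h3 := norm_sub_norm_le (∇ (fun y => u (y, t)) x) (q x)
  linarith [hB1 x hx]

end Spiral

theorem theorem2p1 (A B D C₀ K₀ δ : ℝ) (hδ : 0 < δ) :
    -- the constant depends only on the six numbers above
    ∃ L : ℝ, 0 < L ∧
      ∀ (Ω : Set Spiral.Plane) (N : ℕ) (a : Fin N → Spiral.Plane) (m : Fin N → ℤ) (r : ℝ)
        (W : Set Spiral.Plane) (c u₀ : Spiral.Plane → ℝ),
        -- the domain
        IsOpen Ω → IsConnected Ω → Bornology.IsBounded Ω → Spiral.HasSmoothBoundary Ω →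
        0 < N → 0 < r → (∀ j, m j ≠ 0) →
        (∀ j, Metric.closedBall (a j) r ⊆ Ω) →
        (∀ i j, i ≠ j → Disjoint (Metric.closedBall (a i) r) (Metric.closedBall (a j) r)) →
        W = Spiral.puncturedDomain Ω a r →
        IsGreatest (Spiral.negCurvatures W) C₀ →
        IsLeast (Spiral.inscribedDiameters W) K₀ →
        -- the forcing term
        ContDiffOn ℝ ∞ c (closure W) → (∀ x ∈ closure W, 0 < c x) →
        (∀ x ∈ W, δ ≤ c x ^ 2 - 2 * ‖∇ c x‖ - 2 * C₀ * |c x| - 8 * C₀ / K₀) →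
        -- the initial value
        ContDiffOn ℝ 2 u₀ (closure W) →
        (∀ x n, Spiral.IsOutwardUnitNormal W x n →
          inner ℝ (gradientWithin u₀ (closure W) x - Spiral.gradTheta a m x) n = 0) →
        -- the norms of the data
        Spiral.c2Norm W u₀ ≤ ENNReal.ofReal A →
        Spiral.c1Norm W (Spiral.gradTheta a m) ≤ ENNReal.ofReal B →
        Spiral.c1Norm W c ≤ ENNReal.ofReal D →
        -- the regularization parameter, the time interval and the solution
        ∀ (ε : ℝ) (J : Set ℝ) (u : Spiral.Plane × ℝ → ℝ),
          0 < ε → ε < 1 →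
          ((∃ T : ℝ, 0 < T ∧ J = Set.Icc 0 T) ∨ J = Set.Ici 0) →
          Spiral.IsRegularizedSolution W (Spiral.gradTheta a m) c u₀ ε J u →
          Spiral.supNorm (W ×ˢ J) (fun z => derivWithin (fun s => u (z.1, s)) J z.2) +
            Spiral.supNorm (W ×ˢ J) (fun z => ∇ (fun y => u (y, z.2)) z.1) ≤
              ENNReal.ofReal L := by
  set M := 3 * (|A| + |B|) + |D| * (1 + |A| + |B|) with hM
  set G := (1 + |C₀| * |K₀| / 2) *
    ((1 + |A| + |B|) + (2 + (2 * (2 * |C₀| / |K₀|) + 2 * |D| * (M + 2 * |C₀|)) / δ)) + |B| with hG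
  have hM0 : 0 ≤ M := by positivity
  have hG0 : 0 < G := by positivity
  refine ⟨M + G, by positivity, ?_⟩
  intro Ω N a m r W c u₀ hΩ _ hΩb hΩs hN hr _ hsub hdisj hW hC hK hcs hcpos hcond hu₀ hneu₀
    hA hB hD ε J u hε hε1 hJ hsol
  subst hW
  set W := Spiral.puncturedDomain Ω a r with hWdef
  have hWo : IsOpen W := Spiral.isOpen_puncturedDomain hΩ
  have hWs : Spiral.HasSmoothBoundary W :=
    Spiral.hasSmoothBoundary_puncturedDomain hΩ hΩs hr hsub hdisj
  have hWb : Bornology.IsBounded W := hΩb.subset Set.sdiff_subset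
  have hC0 : 0 < C₀ := Spiral.pos_of_isGreatest_negCurvatures hΩ hN hr hsub hdisj hC
  have hK0 : 0 < K₀ := by
    obtain ⟨z, ρ, hρ, h1⟩ := hK.1
    rw [h1]
    linarith [hρ.1]
  have hne : ∀ x ∈ closure W, ∀ j, x ≠ a j := by
    intro x hx j hxj
    obtain ⟨y, hy1, hy2⟩ := mem_closure_iff.1 hx _ Metric.isOpen_ball
      (hxj ▸ Metric.mem_ball_self hr : x ∈ Metric.ball (a j) r)
    exact hy2.2 (Set.mem_iUnion.2 ⟨j, Metric.ball_subset_closedBall hy1⟩)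
  have key : ∀ T, 0 < T →
      Spiral.IsRegularizedSolution W (Spiral.gradTheta a m) c u₀ ε (Set.Icc 0 T) u →
      ∀ x ∈ W, ∀ t ∈ Set.Icc 0 T, |derivWithin (fun s => u (x, s)) (Set.Icc 0 T) t| ≤ M ∧
        ‖∇ (fun y => u (y, t)) x‖ ≤ G := by
    intro T hT hs x hx t ht
    have hset : Spiral.Setting W (Spiral.gradTheta a m) c u₀ ε T u :=
      { ε_pos := hε, ε_lt_one := hε1, T_pos := hT, isOpen := hWo, smooth := hWs, bounded := hWb
        q_smooth := fun x hx => Spiral.contDiffAt_gradTheta a m (hne x hx)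
        q_symm := fun x hx => Spiral.inner_fderiv_gradTheta_comm a m (hne x (subset_closure hx))
        c_smooth := hcs, u₀_smooth := hu₀, u₀_neumann := hneu₀, sol := hs }
    rw [hG, abs_of_pos hC0, abs_of_pos hK0]
    exact hset.bounds hδ hC0 hK0 hcpos (fun x κ hκ => hC.2 ⟨x, κ, hκ, rfl⟩)
      (fun x φ hx hφ => hφ.ball_subset_of_isLeast hWo hWb hx hK) hcond
      (fun x hx => Spiral.norm_le_of_supNorm_le
        ((le_add_self.trans le_self_add).trans hA) hx)
      (fun x hx => Spiral.norm_le_of_supNorm_le (le_add_self.trans hA) hx)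
      (fun x hx => Spiral.norm_le_of_supNorm_le (le_self_add.trans hB) hx)
      (fun x hx => Spiral.norm_le_of_supNorm_le (le_add_self.trans hB) hx)
      (fun x hx => Spiral.norm_le_of_supNorm_le (f := c) (le_self_add.trans hD) hx) hM hx ht
  have hall : ∀ z ∈ W ×ˢ J, |derivWithin (fun s => u (z.1, s)) J z.2| ≤ M ∧
      ‖∇ (fun y => u (y, z.2)) z.1‖ ≤ G := by
    rintro ⟨x, t⟩ ⟨hx, ht⟩
    rcases hJ with ⟨T, hT, rfl⟩ | rfl
    · exact key T hT hsol x hx t ht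
    · have ht0 : (0 : ℝ) ≤ t := ht
      have htT : t ∈ Set.Icc 0 (t + 1) := ⟨ht0, by linarith⟩
      obtain ⟨h1, h2⟩ := hsol.restrict (by linarith : 0 < t + 1)
      have h3 := key (t + 1) (by linarith) h1 x hx t htT
      rwa [h2 x (subset_closure hx) t htT] at h3
  rw [ENNReal.ofReal_add hM0 hG0.le]
  exact add_le_add (Spiral.supNorm_le fun z hz => (hall z hz).1)
    (Spiral.supNorm_le fun z hz => (hall z hz).2)
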